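/- Let $F$ be a field of arbitrary characteristic and let $q\colon V\to F$ be a quadratic form of even dimension $2m\ge 8$ with $m$ even, nonsingular in the sense that its polar form $b_q(x,y)=q(x+y)-q(x)-q(y)$ is nondegenerate. Let $\mathrm{Ad}_q=(\mathrm{End}_F(V),\sigma_q,f_q)$ be the adjoint algebra with quadratic pair: $\sigma_q$ is the adjoint involution of $b_q$, and $f_q\colon \mathrm{Sym}(\mathrm{End}_F(V),\sigma_q)\to F$ is the linear form with $f_q\bigl(z\mapsto x\,b_q(x,z)\bigr)=q(x)$ for all $x\in V$. For an algebra with quadratic pair $(A,\sigma,f)$ over $F$, the Clifford algebra $\mathcal C(A,\sigma,f)$ is the quotient of the tensor algebra $T(A)$ by the ideal generated by the elements $s-f(s)\cdot 1$ with $\sigma(s)=s$, and the elements $u-\mathrm{Sand}(u)(\ell)$ with $u\in A\otimes A$ such that $\mathrm{Sand}(u)(\sigma(x))=\mathrm{Sand}(u)(x)$ for all $x\in A$; here $\mathrm{Sand}(a\otimes b)(x)=axb$, and $\ell\in A$ satisfies $\ell+\sigma(\ell)=1$ and $f(s)=\mathrm{Trd}_A(\ell s)$ for all symmetric $s$. Let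 $c\colon A\to\mathcal C(A,\sigma,f)$ be the canonical map. Put $\mathcal C=\mathcal C(\mathrm{Ad}_q)$ (the even Clifford algebra), let $Z$ be its centre, and let $\underline{\sigma_q}$ be the canonical involution of $\mathcal C$, the $F$-linear involution with $c(a)\mapsto c(\sigma_q(a))$. Assume that $q$ is isotropic. Then $\underline{\sigma_q}$ is $Z$-linear; the form $$\underline{f_q}\colon \mathrm{Sym}(\mathcal C,\underline{\sigma_q})\to Z,\qquad s\mapsto \mathrm{Trd}_{\mathcal C}(c(\lambda)s),\qquad \lambda\in \mathrm{End}_F(V),\ \mathrm{Trd}(\lambda)=1,$$ does not depend on $\lambda$ and is a semi-trace, i.e. $\underline{f_q}(x+\underline{\sigma_q}(x))=\mathrm{Trd}_{\mathcal C}(x)$ for all $x\in\mathcal C$; and $(\mathcal C,\underline{\sigma_q},\underline{f_q})$ is hyperbolic: there is a right ideal $I\subset\mathcal C$ with $\underline{\sigma_q}(I)I=0$ and $\underline{f_q}(I\cap\mathrm{Sym}(\mathcal C,\underline{\sigma_q}))=0$, free as a $Z$-module of rank $\tfrac12\operatorname{rank}_Z\mathcal C$ (so that, if $Z\cong F\times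 F$, both components of $\mathcal C$ are hyperbolic). If moreover $\operatorname{char}F=2$ or $m\equiv 0 \bmod 4$, then $(\underline{\sigma_q},\underline{f_q})$ is a quadratic pair on $\mathcal C$ over $Z$ (the canonical quadratic pair): $\mathcal C$ is an Azumaya $Z$-algebra, free of rank $n^2$ over $Z$ for some $n$, $\mathrm{Sym}(\mathcal C,\underline{\sigma_q})$ is free over $Z$ of rank $n(n+1)/2$, and $\underline{f_q}$ is a semi-trace. -/

import Mathlib

open scoped TensorProduct

noncomputable section

namespace QuadPair

universe u v w

/-! ### Algebras with involution over a commutative ring -/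

/-- An `R`-linear involution on an `R`-algebra `A`: an `R`-linear anti-automorphism of order at
most two. -/
structure Involution (R : Type u) (A : Type v) [CommRing R] [Ring A] [Algebra R A] where
  toLin : A →ₗ[R] A
  map_mul' : ∀ x y, toLin (x * y) = toLin y * toLin x
  invol' : ∀ x, toLin (toLin x) = x

section General

variable {R : Type u} {A : Type v} [CommRing R] [Ring A] [Algebra R A]

/-- The module of symmetric elements `Sym(A, σ) = {x | σ x = x}`. -/
def Involution.sym (σ : Involution R A) : Submodule R A :=
  LinearMap.ker (σ.toLin - LinearMap.id)

theorem Involution.mem_sym (σ : Involution R A) (x : A) : x ∈ σ.sym ↔ σ.toLin x = x := by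
  simp [Involution.sym, sub_eq_zero]

theorem Involution.add_mem_sym (σ : Involution R A) (x : A) : x + σ.toLin x ∈ σ.sym := by
  rw [σ.mem_sym, map_add, σ.invol', add_comm]

variable (R A)

/-- `t` is the reduced trace of the Azumaya `R`-algebra `A`: over every geometric point
`R → Ω` (`Ω` an algebraically closed field) and for every splitting `Ω ⊗ A ≃ Mₙ(Ω)`, the image of
`t a` in `Ω` is the trace of the matrix corresponding to `1 ⊗ a`. Here `R` is a field, or the
centre of `A` when that centre is a finite product of fields. -/
def IsReducedTrace (t : A →ₗ[R] R) : Prop :=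
  ∀ (Ω : Type u) [Field Ω] [IsAlgClosed Ω] [Algebra R Ω] (n : ℕ)
    (e : (Ω ⊗[R] A) ≃ₐ[Ω] Matrix (Fin n) (Fin n) Ω) (a : A),
    algebraMap R Ω (t a) = (e (1 ⊗ₜ[R] a)).trace

open Classical in
/-- The reduced trace `Trd_A : A → R`. -/
def trd : A →ₗ[R] R :=
  if h : ∃ t : A →ₗ[R] R, IsReducedTrace R A t then h.choose else 0

variable {R A}

/-- `f` is a semi-trace on `(A, σ)`: an `R`-linear form on `Sym(A, σ)` with
`f (x + σ x) = Trd x` for all `x`. -/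
def IsSemitrace (σ : Involution R A) (f : σ.sym →ₗ[R] R) : Prop :=
  ∀ x : A, f ⟨x + σ.toLin x, σ.add_mem_sym x⟩ = trd R A x

/-- `(σ, f)` is a quadratic pair on the `R`-algebra `A`, where `A` is Azumaya of constant degree `n`
over `R` (a field or a finite product of fields): `A` has rank `n²`, the symmetric elements have
(constant) rank `n(n+1)/2`, and `f` is a semi-trace. -/
structure IsQuadraticPair (σ : Involution R A) (f : σ.sym →ₗ[R] R) : Prop where
  isAzumaya : IsAzumaya R A
  exists_degree : ∃ n : ℕ,
    (Module.Free R A ∧ Module.finrank R A = n * n) ∧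
    (Module.Free R σ.sym ∧ 2 * Module.finrank R σ.sym = n * (n + 1))
  isSemitrace : IsSemitrace σ f

/-- The right ideal `I` is isotropic for `(σ, f)`: `σ(I) I = 0` and `f` vanishes on
`I ∩ Sym(A, σ)`. -/
structure IsIsotropicRightIdeal (σ : Involution R A) (f : σ.sym →ₗ[R] R) (I : Submodule R A) :
    Prop where
  right_ideal : ∀ x ∈ I, ∀ a : A, x * a ∈ I
  invol_mul : ∀ x ∈ I, ∀ y ∈ I, σ.toLin x * y = 0
  semitrace_eq_zero : ∀ s : σ.sym, (s : A) ∈ I → f s = 0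

/-- `(A, σ, f)` is hyperbolic: it contains an isotropic right ideal whose reduced dimension is
half the degree of `A`, i.e. whose (constant) `R`-rank is half that of `A`. When `R` is a product
of fields this says that every component of `(A, σ, f)` is hyperbolic. -/
def IsHyperbolic (σ : Involution R A) (f : σ.sym →ₗ[R] R) : Prop :=
  ∃ I : Submodule R A, IsIsotropicRightIdeal σ f I ∧
    Module.Free R I ∧ 2 * Module.finrank R I = Module.finrank R A

end General

/-! ### The Clifford algebra of an algebra with quadratic pair -/

section Clifford

variable {F : Type u} {A : Type v} [Field F] [Ring A] [Algebra F A]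

variable (F A) in
/-- The sandwich map `A ⊗ A → End(A)`, `Sand(a ⊗ b)(x) = a x b`. -/
def sand : A ⊗[F] A →ₗ[F] Module.End F A :=
  TensorProduct.lift ((LinearMap.mul F (Module.End F A)).compl₁₂ (LinearMap.mul F A)
    (LinearMap.mul F A).flip)

@[simp] theorem sand_tmul (a b x : A) : sand F A (a ⊗ₜ b) x = a * (x * b) := by
  simp [sand]

variable (F A) in
/-- The inclusion of `A ⊗ A` into the tensor algebra `T(A)` as the part of degree two. -/
def degTwo : A ⊗[F] A →ₗ[F] TensorAlgebra F A :=
  TensorProduct.lift ((LinearMap.mul F (TensorAlgebra F A)).compl₁₂ (TensorAlgebra.ι F)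
    (TensorAlgebra.ι F))

@[simp] theorem degTwo_tmul (a b : A) :
    degTwo F A (a ⊗ₜ b) = TensorAlgebra.ι F a * TensorAlgebra.ι F b := by
  simp [degTwo]

/-- The element `ℓ` determines the semi-trace `f`: `ℓ + σ ℓ = 1` and `f s = Trd (ℓ s)` for all
symmetric `s`. -/
def Determines (σ : Involution F A) (f : σ.sym →ₗ[F] F) (l : A) : Prop :=
  l + σ.toLin l = 1 ∧ ∀ s : σ.sym, f s = trd F A (l * s)

/-- The defining relations of the Clifford algebra of `(A, σ, f)`: `s = f(s) · 1` for symmetric `s`,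
and `u = Sand(u)(ℓ)` for those `u ∈ A ⊗ A` with `Sand(u)(σ x) = Sand(u)(x)` for all `x`
(i.e. `σ₂ u = u`), where `ℓ` is an element that determines `f`. -/
inductive CliffordRel (σ : Involution F A) (f : σ.sym →ₗ[F] F) :
    TensorAlgebra F A → TensorAlgebra F A → Prop
  | sym (s : σ.sym) :
      CliffordRel σ f (TensorAlgebra.ι F (s : A)) (algebraMap F (TensorAlgebra F A) (f s))
  | sandwich (u : A ⊗[F] A) (hu : ∀ x : A, sand F A u (σ.toLin x) = sand F A u x)
      (l : A) (hl : Determines σ f l) :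
      CliffordRel σ f (degTwo F A u) (TensorAlgebra.ι F (sand F A u l))

/-- The Clifford algebra `C(A, σ, f)` of an algebra with quadratic pair. -/
abbrev Clifford (σ : Involution F A) (f : σ.sym →ₗ[F] F) : Type (max u v) :=
  RingQuot (CliffordRel σ f)

/-- The canonical `F`-linear map `c : A → C(A, σ, f)`. -/
def cliffordMap (σ : Involution F A) (f : σ.sym →ₗ[F] F) : A →ₗ[F] Clifford σ f :=
  (RingQuot.mkAlgHom F (CliffordRel σ f)).toLinearMap ∘ₗ TensorAlgebra.ι F

variable (σ : Involution F A) (f : σ.sym →ₗ[F] F)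

/-- The map `a₁ ⊗ ⋯ ⊗ aᵣ ↦ c (σ aᵣ) ⋯ c (σ a₁)`, as a homomorphism to the opposite algebra. -/
def preInvol : TensorAlgebra F A →ₐ[F] (Clifford σ f)ᵐᵒᵖ :=
  TensorAlgebra.lift F
    ((MulOpposite.opLinearEquiv F).toLinearMap ∘ₗ cliffordMap σ f ∘ₗ σ.toLin)

@[simp] theorem preInvol_ι (a : A) :
    preInvol σ f (TensorAlgebra.ι F a) = MulOpposite.op (cliffordMap σ f (σ.toLin a)) := by
  simp [preInvol]

/-- `a ⊗ b ↦ σ b ⊗ σ a`. -/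
def swapInvol : A ⊗[F] A →ₗ[F] A ⊗[F] A :=
  TensorProduct.map σ.toLin σ.toLin ∘ₗ (TensorProduct.comm F A A).toLinearMap

theorem preInvol_degTwo (u : A ⊗[F] A) :
    preInvol σ f (degTwo F A u) =
      MulOpposite.op (RingQuot.mkAlgHom F (CliffordRel σ f) (degTwo F A (swapInvol σ u))) := by
  induction u with
  | zero => simp
  | add x y hx hy => simp [hx, hy]
  | tmul a b => simp [swapInvol, cliffordMap]

theorem sand_swapInvol (u : A ⊗[F] A) (x : A) :
    sand F A (swapInvol σ u) (σ.toLin x) = σ.toLin (sand F A u x) := by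
  induction u with
  | zero => simp
  | add a b ha hb => simp [ha, hb]
  | tmul a b => simp [swapInvol, σ.map_mul', mul_assoc]

theorem preInvol_rel ⦃x y : TensorAlgebra F A⦄ (h : CliffordRel σ f x y) :
    preInvol σ f x = preInvol σ f y := by
  cases h with
  | sym s =>
    have hs : σ.toLin (s : A) = s := (σ.mem_sym _).1 s.2
    have := RingQuot.mkAlgHom_rel F (CliffordRel.sym (f := f) s)
    rw [preInvol_ι, hs, AlgHom.commutes]
    simp only [cliffordMap, LinearMap.comp_apply, AlgHom.toLinearMap_apply]
    rw [this, AlgHom.commutes]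
    rfl
  | sandwich u hu l hl =>
    have hu' : ∀ x : A, sand F A (swapInvol σ u) (σ.toLin x) = sand F A (swapInvol σ u) x := by
      intro x
      have h2 := sand_swapInvol σ u (σ.toLin x)
      rw [σ.invol', hu] at h2
      rw [sand_swapInvol, h2]
    have := RingQuot.mkAlgHom_rel F (CliffordRel.sandwich (swapInvol σ u) hu' l hl)
    rw [preInvol_ι, preInvol_degTwo, this, ← hu' l, sand_swapInvol]
    rfl

/-- The canonical involution as a homomorphism to the opposite algebra. -/
def canonicalInvolHom : Clifford σ f →ₐ[F] (Clifford σ f)ᵐᵒᵖ :=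
  RingQuot.liftAlgHom F ⟨preInvol σ f, fun _ _ h => preInvol_rel σ f h⟩

theorem canonicalInvolHom_mk (t : TensorAlgebra F A) :
    canonicalInvolHom σ f (RingQuot.mkAlgHom F (CliffordRel σ f) t) = preInvol σ f t := by
  simp [canonicalInvolHom]

/-- The canonical involution of the Clifford algebra, as a linear map. -/
def canonicalInvolLin : Clifford σ f →ₗ[F] Clifford σ f :=
  (MulOpposite.opLinearEquiv F).symm.toLinearMap ∘ₗ (canonicalInvolHom σ f).toLinearMap

theorem canonicalInvolLin_mul (x y : Clifford σ f) :
    canonicalInvolLin σ f (x * y) = canonicalInvolLin σ f y * canonicalInvolLin σ f x := by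
  simp [canonicalInvolLin]

theorem canonicalInvolLin_map (a : A) :
    canonicalInvolLin σ f (cliffordMap σ f a) = cliffordMap σ f (σ.toLin a) := by
  simp [canonicalInvolLin, cliffordMap, canonicalInvolHom_mk]

/-- The canonical involution of the Clifford algebra: the `F`-linear involution with
`c a ↦ c (σ a)`. -/
def canonicalInvol : Involution F (Clifford σ f) where
  toLin := canonicalInvolLin σ f
  map_mul' := canonicalInvolLin_mul σ f
  invol' := by
    intro x
    obtain ⟨t, rfl⟩ := RingQuot.mkAlgHom_surjective F (CliffordRel σ f) x
    induction t using TensorAlgebra.induction with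
    | algebraMap r => simp [canonicalInvolLin]
    | ι a =>
      have h : RingQuot.mkAlgHom F (CliffordRel σ f) (TensorAlgebra.ι F a) = cliffordMap σ f a :=
        rfl
      rw [h, canonicalInvolLin_map, canonicalInvolLin_map, σ.invol']
    | mul a b ha hb => rw [map_mul, canonicalInvolLin_mul, canonicalInvolLin_mul, ha, hb]
    | add a b ha hb => rw [map_add, map_add, map_add, ha, hb]

/-- The centre of the Clifford algebra. -/
abbrev CliffordCentre : Subalgebra F (Clifford σ f) :=
  Subalgebra.center F (Clifford σ f)

/-- The Clifford algebra as an algebra over its centre, the centre acting by multiplication. -/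
instance centreAlgebra : Algebra (CliffordCentre σ f) (Clifford σ f) where
  algebraMap := (CliffordCentre σ f).val.toRingHom
  toSMul := inferInstance
  commutes' z x := (Subalgebra.mem_center_iff.1 z.2 x).symm
  smul_def' _ _ := rfl

/-- `(τ, g)` is the canonical pair of the Clifford algebra `C` of `(A, σ, f)`, viewed as an
algebra over its centre `Z`: `τ` is the canonical involution (in particular that involution is
`Z`-linear), and `g : Sym(C, τ) → Z` is given by `g s = Trd_C (c(a) s)` for *every* `a ∈ A` of
reduced trace `1`. -/
structure IsCanonicalPair (τ : Involution (CliffordCentre σ f) (Clifford σ f))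
    (g : τ.sym →ₗ[CliffordCentre σ f] CliffordCentre σ f) : Prop where
  invol_eq : ∀ x, τ.toLin x = (canonicalInvol σ f).toLin x
  semitrace_eq : ∀ a : A, trd F A a = 1 →
    ∀ s : τ.sym, g s = trd (CliffordCentre σ f) (Clifford σ f) (cliffordMap σ f a * s)

end Clifford

/-! ### The quadratic pair adjoint to a nonsingular quadratic form -/

section Adjoint

variable {F : Type u} {V : Type v} [Field F] [AddCommGroup V] [Module F V]

/-- A quadratic form is nonsingular if its polar form is nondegenerate. -/
def Nonsingular (q : QuadraticForm F V) : Prop :=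
  LinearMap.BilinForm.Nondegenerate (QuadraticMap.polarBilin q)

theorem eq_of_polar {q : QuadraticForm F V} (hq : Nonsingular q) {x x' : V}
    (h : ∀ y, QuadraticMap.polar q x y = QuadraticMap.polar q x' y) :
    x = x' := by
  have h1 := LinearMap.separatingLeft_iff_ker_eq_bot.1 hq.1
  exact LinearMap.ker_eq_bot.1 h1 (LinearMap.ext fun y => by simpa using h y)

/-- The standard identification `φ_q : V ⊗ V → End(V)`, `φ_q (x ⊗ y) z = x b_q(y, z)`. -/
def rankOne (q : QuadraticForm F V) (x y : V) : Module.End F V :=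
  ((QuadraticMap.polarBilin q) y).smulRight x

@[simp] theorem rankOne_apply (q : QuadraticForm F V) (x y z : V) :
    rankOne q x y z = QuadraticMap.polar q y z • x := rfl

variable [FiniteDimensional F V] {q : QuadraticForm F V} (hq : Nonsingular q)

/-- The adjoint of an endomorphism with respect to the polar form. -/
def adjoint (g : Module.End F V) : Module.End F V :=
  LinearMap.BilinForm.leftAdjointOfNondegenerate (QuadraticMap.polarBilin q) hq g

theorem polar_adjoint (g : Module.End F V) (x y : V) :
    QuadraticMap.polar q (adjoint hq g x) y = QuadraticMap.polar q x (g y) :=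
  LinearMap.BilinForm.isAdjointPairLeftAdjointOfNondegenerate
    (QuadraticMap.polarBilin q) hq g x y

/-- The adjoint involution `σ_q` on `End(V)`: `b_q (σ_q g x, y) = b_q (x, g y)`. -/
def adjointInvol : Involution F (Module.End F V) where
  toLin :=
    { toFun := adjoint hq
      map_add' := fun g h => LinearMap.ext fun x => eq_of_polar hq fun y => by
        simp [polar_adjoint, QuadraticMap.polar_add_left, QuadraticMap.polar_add_right]
      map_smul' := fun c g => LinearMap.ext fun x => eq_of_polar hq fun y => by
        simp [polar_adjoint, QuadraticMap.polar_smul_left, QuadraticMap.polar_smul_right] }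
  map_mul' := fun g h => LinearMap.ext fun x => eq_of_polar hq fun y => by
    simp [polar_adjoint]
  invol' := fun g => LinearMap.ext fun x => eq_of_polar hq fun y => by
    simp only [LinearMap.coe_mk, AddHom.coe_mk, polar_adjoint]
    rw [QuadraticMap.polar_comm, polar_adjoint, QuadraticMap.polar_comm]

theorem adjointInvol_apply (g : Module.End F V) : (adjointInvol hq).toLin g = adjoint hq g := rfl

/-- The involution `σ_q` corresponds to the exchange involution of `V ⊗ V`. -/
theorem adjoint_rankOne (x y : V) : adjoint hq (rankOne q x y) = rankOne q y x :=
  LinearMap.ext fun z => eq_of_polar hq fun w => by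
    rw [polar_adjoint]
    simp only [rankOne_apply, QuadraticMap.polar_smul_left, QuadraticMap.polar_smul_right,
      smul_eq_mul]
    rw [QuadraticMap.polar_comm q z x, mul_comm]

theorem rankOne_self_mem_sym (x : V) : rankOne q x x ∈ (adjointInvol hq).sym :=
  ((adjointInvol hq).mem_sym _).2 (adjoint_rankOne hq x x)

theorem exists_adjointSemitrace :
    ∃ f : (adjointInvol hq).sym →ₗ[F] F,
      ∀ x : V, f ⟨rankOne q x x, rankOne_self_mem_sym hq x⟩ = q x := by
  obtain ⟨B, hB⟩ := LinearMap.BilinMap.toQuadraticMap_surjective (R := F) (M := V) (N := F) q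
  let e : V ⊗[F] V ≃ₗ[F] Module.End F V :=
    TensorProduct.comm F V V ≪≫ₗ
      TensorProduct.congr (LinearMap.BilinForm.toDual (QuadraticMap.polarBilin q) hq)
        (LinearEquiv.refl F V) ≪≫ₗ dualTensorHomEquiv F V V
  have he : ∀ x y : V, e (x ⊗ₜ y) = rankOne q x y := fun x y => LinearMap.ext fun z => by
    have h : LinearMap.BilinForm.toDual (QuadraticMap.polarBilin q) hq y z =
        QuadraticMap.polar q y z :=
      LinearMap.BilinForm.toDual_def (B := QuadraticMap.polarBilin q) hq
    simp [e, h]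
  refine ⟨TensorProduct.lift B ∘ₗ e.symm.toLinearMap ∘ₗ (adjointInvol hq).sym.subtype,
    fun x => ?_⟩
  have h1 : e.symm (rankOne q x x) = x ⊗ₜ x := by rw [← he, LinearEquiv.symm_apply_apply]
  have h2 : B x x = q x := by rw [← hB]; rfl
  simp [h1, h2]

/-- The semi-trace `f_q` on `(End(V), σ_q)`: the linear form on the symmetric elements with
`f_q (φ_q (x ⊗ x)) = q x` for all `x ∈ V`. -/
def adjointSemitrace : (adjointInvol hq).sym →ₗ[F] F :=
  (exists_adjointSemitrace hq).choose

theorem adjointSemitrace_apply (x : V) :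
    adjointSemitrace hq ⟨rankOne q x x, rankOne_self_mem_sym hq x⟩ = q x :=
  (exists_adjointSemitrace hq).choose_spec x

end Adjoint

end QuadPair

end

/-! Write `xy` for `gen hq x y`, the class of the rank one map of `x ⊗ y`. In terms of these
elements the defining relations give `xx = q(x)`, `xy + yx = b(x,y)` and `(xy)(yz) = q(y) xz`, the
relations of the even Clifford algebra; a homomorphism to the full Clifford algebra shows that the
quotient `C` is not zero.

An isotropic `q` is an orthogonal sum of a hyperbolic plane `(e, f)`, a plane `(v, v')` with `q(v) ≠
0`, and `m - 2` further planes. For `x` orthogonal to `v` the elements `vx` square to `-q(v)q(x)`,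
so the planes other than `(v, v')` give `m - 1` pairwise anticommuting quaternion pairs, which
together with `w = vv'` generate `C`. If `(E, F)` is one of the pairs, then `1 - 2EF` anticommutes
with `E` and `F` and commutes with the other pairs. Multiplying the later pairs by it makes them
commute with `(E, F)`, in every characteristic. Iterating (`CliffordSystem.exists_quaternionSystem`)
yields commuting pairs `(E i, F i)` and an element `ω` with `ω² = ω - δ`, `1 - 4δ ≠ 0`, commuting
with all of them. Thus `Z = F[ω]`, and `C` is a product of `m - 1` quaternion algebras over `Z`. The
canonical involution multiplies the `i`-th pair by `-(-1)^i`, and it fixes `ω` because `m` is even.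

The structure of such a product is read off from a Casimir element: for the basis `E, F, EF, FE` of
a quaternion algebra and its dual basis `b'` for the reduced trace, `∑ bᵢ x b'ᵢ = Trd x`. This
passes to products and gives the double centralizer property, a basis of monomials, the Azumaya
property and the reduced trace. The involution permutes the monomials up to sign. Hence it preserves
the trace, and the symmetric elements have rank `n(n+1)/2` when the product of the signs is `1`, as
it is in characteristic 2 or for `4 ∣ m`.

Hyperbolicity comes from `ε = ef = E 0 * F 0`, an idempotent with `ε + σ(ε) = 1` that is also `c(λ)`
for a `λ` of trace 1. Then `s ↦ Trd(εs)` is a semi-trace. The ideal `εC` has half the rank of `C`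
and is isotropic, since `σ(ε)ε = 0` and a symmetric `s = εx` has `Trd(εs) = Trd(ε σ(x) σ(ε)) = 0`.

For the independence of `λ`, let `b(x,y) = 0` and choose `g`, `h` orthogonal to `x`, `y` with
`b(g,h) = 1`. Then `z = (xy)(gh)` satisfies `z - σ(z) = xy`, so `Trd((xy)s) = 0` for symmetric `s`.
A bilinear map that vanishes on orthogonal pairs is a multiple of `b`, whence `Trd(c(a)s) = Trd(a)
Trd(εs)` for all `a`. -/

open scoped TensorProduct
noncomputable section
namespace QuadPair

set_option linter.unusedSimpArgs false

/-! ### Families with a Casimir element -/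

section Casimir

/-- The operator `x ↦ ∑ bᵢ x b'ᵢ` attached to two finite families. -/
def casimirOp {A ι : Type*} [Ring A] [Fintype ι] (b b' : ι → A) : A →+ A :=
  ∑ i, (AddMonoidHom.mulLeft (b i)).comp (AddMonoidHom.mulRight (b' i))

theorem casimirOp_apply {A ι : Type*} [Ring A] [Fintype ι] (b b' : ι → A) (x : A) :
    casimirOp b b' x = ∑ i, b i * (x * b' i) := by
  simp [casimirOp]

theorem casimirOp_prod {A ι κ : Type*} [Ring A] [Fintype ι] [Fintype κ] {b b' : ι → A}
    {c c' : κ → A} (h : ∀ i j, Commute (b' i) (c' j)) (x : A) :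
    casimirOp (fun i : ι × κ => b i.1 * c i.2) (fun i => b' i.1 * c' i.2) x =
      casimirOp b b' (casimirOp c c' x) := by
  rw [casimirOp_apply, casimirOp_apply, Fintype.sum_prod_type]
  refine Finset.sum_congr rfl fun i _ => ?_
  rw [casimirOp_apply, Finset.sum_mul, Finset.mul_sum]
  refine Finset.sum_congr rfl fun j _ => ?_
  simp only [(h i j).eq, mul_assoc]

theorem casimirOp_comp_equiv {A ι κ : Type*} [Ring A] [Fintype ι] [Fintype κ] (b b' : ι → A)
    (e : κ ≃ ι) : casimirOp (b ∘ e) (b' ∘ e) = casimirOp b b' := by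
  ext x
  rw [casimirOp_apply, casimirOp_apply]
  exact e.sum_comp fun i => b i * (x * b' i)

/-- `b` and `b'` are dual families of elements of the subring generated by `S`, for a form with
values in the centralizer of `S`; the form is `x ↦ ∑ bᵢ x b'ᵢ`. -/
structure CasimirFamily {A ι : Type*} [Ring A] [Fintype ι] [DecidableEq ι] (S : Set A)
    (b b' : ι → A) (n : ℕ) : Prop where
  commute_op : ∀ y ∈ S, ∀ x, Commute y (casimirOp b b' x)
  commute_left : ∀ x, (∀ y ∈ S, Commute y x) → ∀ i, Commute (b i) x
  commute_right : ∀ x, (∀ y ∈ S, Commute y x) → ∀ i, Commute (b' i) x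
  sum_op : ∀ x, ∑ i, casimirOp b b' (x * b' i) * b i = x
  op_mul : ∀ i j, casimirOp b b' (b i * b' j) = if i = j then 1 else 0
  op_one : casimirOp b b' 1 = n

namespace CasimirFamily

variable {A ι κ : Type*} [Ring A] [Fintype ι] [DecidableEq ι] [Fintype κ] [DecidableEq κ]
  {S T : Set A} {b b' : ι → A} {c c' : κ → A} {n p : ℕ}

theorem op_mul_of_commute (hb : CasimirFamily S b b' n) {z : A} (hz : ∀ y ∈ S, Commute y z)
    (x : A) : casimirOp b b' (x * z) = casimirOp b b' x * z := by
  rw [casimirOp_apply, casimirOp_apply, Finset.sum_mul]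
  refine Finset.sum_congr rfl fun i _ => ?_
  rw [mul_assoc x, (hb.commute_right z hz i).symm.eq, mul_assoc, mul_assoc]

theorem op_of_commute_mul (hb : CasimirFamily S b b' n) {z : A} (hz : ∀ y ∈ S, Commute y z)
    (x : A) : casimirOp b b' (z * x) = z * casimirOp b b' x := by
  rw [casimirOp_apply, casimirOp_apply, Finset.mul_sum]
  refine Finset.sum_congr rfl fun i _ => ?_
  rw [← mul_assoc z (b i), (hb.commute_left z hz i).symm.eq]
  simp only [mul_assoc]

theorem commute_op_of_commute (hb : CasimirFamily S b b' n) {z : A}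
    (hz : ∀ y ∈ S, Commute y z) {x : A} (hx : Commute z x) : Commute z (casimirOp b b' x) := by
  change z * _ = _ * z
  rw [← hb.op_of_commute_mul hz, ← hb.op_mul_of_commute hz, hx.eq]

theorem reindex (hb : CasimirFamily S b b' n) (e : κ ≃ ι) :
    CasimirFamily S (b ∘ e) (b' ∘ e) n := by
  have h := casimirOp_comp_equiv b b' e
  refine ⟨?_, fun x hx i => hb.commute_left x hx _, fun x hx i => hb.commute_right x hx _, ?_, ?_,
    ?_⟩
  · rw [h]; exact hb.commute_op
  · intro x
    rw [h]
    exact (e.sum_comp fun i => casimirOp b b' (x * b' i) * b i).trans (hb.sum_op x)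
  · intro i j
    simp [h, hb.op_mul]
  · rw [h, hb.op_one]

/-- The operator of the product family is the composite of the two operators, and each operator is
linear over whatever commutes with its own generators. Every axiom therefore splits into one for `b`
and one for `c`. -/
theorem prod (hb : CasimirFamily S b b' n) (hc : CasimirFamily T c c' p)
    (hST : ∀ x ∈ S, ∀ y ∈ T, Commute x y) :
    CasimirFamily (S ∪ T) (fun i : ι × κ => b i.1 * c i.2) (fun i => b' i.1 * c' i.2) (n * p) := by
  have hbT : ∀ y ∈ T, ∀ i, Commute (b i) y := fun y hy =>
    hb.commute_left y fun x hx => hST x hx y hy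
  have hb'T : ∀ y ∈ T, ∀ i, Commute (b' i) y := fun y hy =>
    hb.commute_right y fun x hx => hST x hx y hy
  have hSc : ∀ i, ∀ x ∈ S, Commute x (c i) := fun i x hx =>
    (hc.commute_left x (fun y hy => (hST x hx y hy).symm) i).symm
  have hSc' : ∀ i, ∀ x ∈ S, Commute x (c' i) := fun i x hx =>
    (hc.commute_right x (fun y hy => (hST x hx y hy).symm) i).symm
  have hbc' : ∀ i j, Commute (b' i) (c' j) := fun i j => hb.commute_right _ (hSc' j) i
  have hcb : ∀ i, ∀ y ∈ T, Commute y (b i) := fun i y hy => (hbT y hy i).symm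
  have hcb' : ∀ i, ∀ y ∈ T, Commute y (b' i) := fun i y hy => (hb'T y hy i).symm
  have hop := casimirOp_prod (b := b) (c := c) hbc'
  refine ⟨?_, ?_, ?_, ?_, ?_, ?_⟩
  · rintro y (hy | hy) x
    · rw [hop]; exact hb.commute_op y hy _
    · rw [hop]
      exact hb.commute_op_of_commute (fun x hx => hST x hx y hy) (hc.commute_op y hy x)
  · intro x hx i
    exact (hb.commute_left x (fun y hy => hx y (.inl hy)) _).mul_left
      (hc.commute_left x (fun y hy => hx y (.inr hy)) _)
  · intro x hx i
    exact (hb.commute_right x (fun y hy => hx y (.inl hy)) _).mul_left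
      (hc.commute_right x (fun y hy => hx y (.inr hy)) _)
  · intro x
    simp only [hop]
    rw [Fintype.sum_prod_type]
    conv_rhs => rw [← hb.sum_op x]
    refine Finset.sum_congr rfl fun i _ => ?_
    -- `x b'ᵢ` is expanded along `c` before the operator of `b` is applied to it.
    rw [← hc.sum_op (x * b' i), map_sum, Finset.sum_mul]
    refine Finset.sum_congr rfl fun j _ => ?_
    simp only []
    rw [hb.op_mul_of_commute (hSc j), mul_assoc x, mul_assoc _ (c j)]
    rw [((hb.commute_left (c j) (hSc j) i)).eq]
  · rintro ⟨i, j⟩ ⟨k, l⟩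
    rw [hop]
    have h1 : b i * c j * (b' k * c' l) = (b i * b' k) * (c j * c' l) := by
      rw [mul_assoc, ← mul_assoc (c j), ← (hb.commute_right (c j) (hSc j) k).eq]
      simp only [mul_assoc]
    have h2 : ∀ y ∈ T, Commute y (b i * b' k) := fun y hy => (hcb i y hy).mul_right (hcb' k y hy)
    simp only [h1]
    rw [hc.op_of_commute_mul h2, hc.op_mul]
    by_cases hjl : j = l
    · simp [hjl, hb.op_mul]
    · simp [hjl]
  · rw [hop, hc.op_one]
    have : casimirOp b b' ((p : A)) = casimirOp b b' (1 * (p : A)) := by rw [one_mul]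
    rw [this, hb.op_mul_of_commute fun y _ => (Nat.cast_commute p y).symm, hb.op_one]
    push_cast; rfl

end CasimirFamily

end Casimir

/-! ### Pairs of generators of a quaternion algebra -/

section QuaternionPair

variable {R A : Type*} [CommRing R] [Ring A] [Algebra R A]

/-- `E² = α`, `F² = β`, `EF + FE = 1`. -/
structure QuaternionPair (α β : R) (E F : A) : Prop where
  sq_left : E * E = α • (1 : A)
  sq_right : F * F = β • (1 : A)
  swap : F * E = 1 - E * F

/-- The basis `E, F, EF, FE`. -/
def quatBasis (E F : A) : Bool × Bool → A
  | (false, false) => E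
  | (false, true) => F
  | (true, false) => E * F
  | (true, true) => F * E

/-- The basis dual to `E, F, EF, FE` with respect to the reduced trace, where
`γ (1 - 4 α β) = 1`. -/
def quatDual (α β γ : R) (E F : A) : Bool × Bool → A
  | (false, false) => γ • (F - (2 * β) • E)
  | (false, true) => γ • (E - (2 * α) • F)
  | (true, false) => γ • ((1 - 2 * α * β) • (E * F) - (2 * α * β) • (F * E))
  | (true, true) => γ • ((1 - 2 * α * β) • (F * E) - (2 * α * β) • (E * F))

theorem casimirOp_smul {ι : Type*} [Fintype ι] (b b' : ι → A) (r : R) (x : A) :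
    casimirOp b b' (r • x) = r • casimirOp b b' x := by
  simp only [casimirOp_apply, smul_mul_assoc, mul_smul_comm, Finset.smul_sum]

namespace QuaternionPair

variable {α β γ : R} {E F : A} (h : QuaternionPair α β E F)
include h

theorem sq_left_mul (x : A) : E * (E * x) = α • x := by rw [← mul_assoc, h.sq_left]; simp
theorem sq_right_mul (x : A) : F * (F * x) = β • x := by rw [← mul_assoc, h.sq_right]; simp
theorem swap_mul (x : A) : F * (E * x) = x - E * (F * x) := by
  rw [← mul_assoc, h.swap, sub_mul, one_mul, mul_assoc]

theorem op_eq (x : A) : casimirOp (quatBasis E F) (quatDual α β γ E F) x =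
    γ • (E * x * F + F * x * E - (2 * β) • (E * x * E) - (2 * α) • (F * x * F) +
      (E * F * x * (E * F) + F * E * x * (F * E)) -
      (2 * α * β) • x) := by
  rw [casimirOp_apply, Fintype.sum_prod_type, Fintype.sum_bool, Fintype.sum_bool, Fintype.sum_bool]
  simp only [quatBasis, quatDual, h.swap]
  simp only [mul_add, add_mul, mul_sub, sub_mul, smul_mul_assoc, mul_smul_comm, mul_assoc, one_mul,
    mul_one, smul_sub, smul_add]
  module

theorem commute_op_left (x : A) :
    Commute E (casimirOp (quatBasis E F) (quatDual α β γ E F) x) := by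
  rw [h.op_eq]
  change _ * _ = _ * _
  simp only [mul_add, add_mul, mul_sub, sub_mul, smul_mul_assoc, mul_smul_comm, mul_assoc, one_mul,
    mul_one, smul_sub, smul_add, h.sq_left, h.sq_right, h.swap, h.sq_left_mul, h.sq_right_mul,
    h.swap_mul]
  module

theorem commute_op_right (x : A) :
    Commute F (casimirOp (quatBasis E F) (quatDual α β γ E F) x) := by
  rw [h.op_eq]
  change _ * _ = _ * _
  simp only [mul_add, add_mul, mul_sub, sub_mul, smul_mul_assoc, mul_smul_comm, mul_assoc, one_mul,
    mul_one, smul_sub, smul_add, h.sq_left, h.sq_right, h.swap, h.sq_left_mul, h.sq_right_mul,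
    h.swap_mul]
  module

theorem op_one (hγ : γ * (1 - 4 * α * β) = 1) :
    casimirOp (quatBasis E F) (quatDual α β γ E F) 1 = 2 := by
  rw [h.op_eq, show (2 : A) = (2 : R) • 1 by rw [Algebra.smul_def, mul_one, map_ofNat]]
  simp only [mul_add, add_mul, mul_sub, sub_mul, smul_mul_assoc, mul_smul_comm, mul_assoc, one_mul,
    mul_one, smul_sub, smul_add, h.sq_left, h.sq_right, h.swap, h.sq_left_mul, h.sq_right_mul,
    h.swap_mul]
  match_scalars
  all_goals first | ring1 | linear_combination (2 : R) * hγ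

theorem op_left  :
    casimirOp (quatBasis E F) (quatDual α β γ E F) E = 0 := by
  rw [h.op_eq]
  simp only [mul_add, add_mul, mul_sub, sub_mul, smul_mul_assoc, mul_smul_comm, mul_assoc, one_mul,
    mul_one, smul_sub, smul_add, h.sq_left, h.sq_right, h.swap, h.sq_left_mul, h.sq_right_mul,
    h.swap_mul]
  module

theorem op_right  :
    casimirOp (quatBasis E F) (quatDual α β γ E F) F = 0 := by
  rw [h.op_eq]
  simp only [mul_add, add_mul, mul_sub, sub_mul, smul_mul_assoc, mul_smul_comm, mul_assoc, one_mul,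
    mul_one, smul_sub, smul_add, h.sq_left, h.sq_right, h.swap, h.sq_left_mul, h.sq_right_mul,
    h.swap_mul]
  module

theorem op_left_mul_right (hγ : γ * (1 - 4 * α * β) = 1) :
    casimirOp (quatBasis E F) (quatDual α β γ E F) (E * F) = 1 := by
  rw [h.op_eq]
  simp only [mul_add, add_mul, mul_sub, sub_mul, smul_mul_assoc, mul_smul_comm, mul_assoc, one_mul,
    mul_one, smul_sub, smul_add, h.sq_left, h.sq_right, h.swap, h.sq_left_mul, h.sq_right_mul,
    h.swap_mul]
  match_scalars
  all_goals first | ring1 | linear_combination hγ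

theorem op_right_mul_left (hγ : γ * (1 - 4 * α * β) = 1) :
    casimirOp (quatBasis E F) (quatDual α β γ E F) (F * E) = 1 := by
  rw [h.swap, map_sub, h.op_one hγ, h.op_left_mul_right hγ]; norm_num

theorem op_mul (hγ : γ * (1 - 4 * α * β) = 1) (i j : Bool × Bool) :
    casimirOp (quatBasis E F) (quatDual α β γ E F) (quatBasis E F i * quatDual α β γ E F j) =
      if i = j then 1 else 0 := by
  have h1 : casimirOp (quatBasis E F) (quatDual α β γ E F) 1 = (2 : R) • 1 := by
    rw [h.op_one hγ, Algebra.smul_def, mul_one, map_ofNat]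
  obtain ⟨i₁, i₂⟩ := i
  obtain ⟨j₁, j₂⟩ := j
  cases i₁ <;> cases i₂ <;> cases j₁ <;> cases j₂ <;>
  · simp only [quatBasis, quatDual, Prod.mk.injEq, reduceCtorEq, and_self, and_true, and_false,
      true_and, false_and, if_true, if_false]
    simp only [mul_add, add_mul, mul_sub, sub_mul, smul_mul_assoc, mul_smul_comm, mul_assoc,
      one_mul, mul_one, smul_sub, smul_add, h.sq_left, h.sq_right, h.swap, h.sq_left_mul,
      h.sq_right_mul, h.swap_mul, map_add, map_sub, casimirOp_smul, h.op_left, h.op_right, h1,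
      h.op_left_mul_right hγ]
    match_scalars
    all_goals first | ring1 | linear_combination hγ

/-- The operator is symmetric in the two families (`h1`), and it sends the dual basis to `0, 0, 1,
1` (`h2`). Summing over the outer index first leaves `EFx + FEx = x`. -/
theorem sum_op (hγ : γ * (1 - 4 * α * β) = 1) (x : A) :
    ∑ i, casimirOp (quatBasis E F) (quatDual α β γ E F) (x * quatDual α β γ E F i) *
      quatBasis E F i = x := by
  have h1 : ∀ y, ∑ i, quatDual α β γ E F i * y * quatBasis E F i =
      casimirOp (quatBasis E F) (quatDual α β γ E F) y := by
    intro y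
    rw [casimirOp_apply]
    simp only [Fintype.sum_prod_type, Fintype.sum_bool, quatBasis, quatDual]
    simp only [mul_add, add_mul, mul_sub, sub_mul, smul_mul_assoc, mul_smul_comm, mul_assoc,
      one_mul, mul_one, smul_sub, smul_add]
    module
  have h2 : ∀ j, casimirOp (quatBasis E F) (quatDual α β γ E F) (quatDual α β γ E F j) =
      if j.1 then 1 else 0 := by
    rintro ⟨j₁, j₂⟩
    cases j₁ <;> cases j₂ <;>
    · simp only [quatDual, map_sub, casimirOp_smul, h.op_left, h.op_right, h.op_left_mul_right hγ,
        h.op_right_mul_left hγ, if_true, Bool.false_eq_true, if_false]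
      match_scalars
      all_goals first | ring1 | linear_combination hγ
  calc _ = ∑ i, ∑ j, quatBasis E F j * x * (quatDual α β γ E F i * quatDual α β γ E F j *
        quatBasis E F i) := by
        refine Finset.sum_congr rfl fun i _ => ?_
        rw [casimirOp_apply, Finset.sum_mul]
        simp only [mul_assoc]
    _ = ∑ j, quatBasis E F j * x * (if j.1 then 1 else 0) := by
        rw [Finset.sum_comm]
        refine Finset.sum_congr rfl fun j _ => ?_
        rw [← h2, ← h1, Finset.mul_sum]
    _ = x := by
        simp only [Fintype.sum_prod_type, Fintype.sum_bool, quatBasis, if_true,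
          Bool.false_eq_true, if_false, h.swap]
        simp only [mul_zero, mul_one, add_zero]
        rw [sub_mul, one_mul, sub_add_cancel]

theorem casimirFamily (hγ : γ * (1 - 4 * α * β) = 1) :
    CasimirFamily {E, F} (quatBasis E F) (quatDual α β γ E F) 2 where
  commute_op := by
    rintro y (rfl | rfl) x
    · exact h.commute_op_left x
    · exact h.commute_op_right x
  commute_left := by
    intro x hx i
    have h1 : Commute E x := hx _ (by simp)
    have h2 : Commute F x := hx _ (by simp)
    obtain ⟨i₁, i₂⟩ := i
    cases i₁ <;> cases i₂ <;> simp only [quatBasis]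
    exacts [h1, h2, h1.mul_left h2, h2.mul_left h1]
  commute_right := by
    intro x hx i
    have h1 : Commute E x := hx _ (by simp)
    have h2 : Commute F x := hx _ (by simp)
    have h3 := h1.mul_left h2
    have h4 := h2.mul_left h1
    obtain ⟨i₁, i₂⟩ := i
    cases i₁ <;> cases i₂ <;> simp only [quatDual]
    exacts [(h2.sub_left (h1.smul_left _)).smul_left _, (h1.sub_left (h2.smul_left _)).smul_left _,
      ((h3.smul_left _).sub_left (h4.smul_left _)).smul_left _,
      ((h4.smul_left _).sub_left (h3.smul_left _)).smul_left _]
  sum_op := h.sum_op hγ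
  op_mul := h.op_mul hγ
  op_one := by rw [h.op_one hγ]; norm_num

end QuaternionPair
end QuaternionPair

/-! ### Products of several commuting families -/

section ProductFamily

/-- All products of one element from each of the families `b 0, …, b (k - 1)`. -/
def prodFamily {A J : Type*} [Ring A] : ∀ {k : ℕ}, (Fin k → J → A) → (Fin k → J) → A
  | 0, _, _ => 1
  | _ + 1, b, s => b 0 (s 0) * prodFamily (Fin.tail b) (Fin.tail s)

theorem commute_prodFamily {A J : Type*} [Ring A] {k : ℕ} {b : Fin k → J → A} {x : A}
    (h : ∀ i j, Commute x (b i j)) (s : Fin k → J) : Commute x (prodFamily b s) := by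
  induction k with
  | zero => exact Commute.one_right x
  | succ k ih => exact (h 0 _).mul_right (ih (b := Fin.tail b) (fun i j => h i.succ j) _)

theorem CasimirFamily.pi {A J : Type*} [Ring A] [Fintype J] [DecidableEq J] {n k : ℕ}
    {S : Fin k → Set A} {b b' : Fin k → J → A} (h : ∀ i, CasimirFamily (S i) (b i) (b' i) n)
    (hS : ∀ i j, i ≠ j → ∀ x ∈ S i, ∀ y ∈ S j, Commute x y) :
    CasimirFamily (⋃ i, S i) (prodFamily b) (prodFamily b') (n ^ k) := by
  induction k with
  | zero =>
    have h1 : ∀ x, casimirOp (prodFamily b) (prodFamily b') x = x := by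
      intro x; simp [casimirOp_apply, prodFamily]
    refine ⟨by simp, by simp [prodFamily], by simp [prodFamily], fun x => ?_, fun i j => ?_, ?_⟩
    · simp only [h1]; simp [prodFamily]
    · rw [if_pos (Subsingleton.elim i j), h1]; simp [prodFamily]
    · simp [h1]
  | succ k ih =>
    have h1 := ih (S := Fin.tail S) (b := Fin.tail b) (b' := Fin.tail b') (fun i => h i.succ)
      (fun i j hij => hS _ _ (by simpa using hij))
    have h2 := ((h 0).prod h1 (by
      intro x hx y hy
      obtain ⟨i, hi⟩ := Set.mem_iUnion.1 hy
      exact hS 0 i.succ (Fin.succ_ne_zero i).symm x hx y hi)).reindex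
        (Fin.consEquiv fun _ => J).symm
    have h3 : (⋃ i, S i) = S 0 ∪ ⋃ i, Fin.tail S i := by
      ext x
      simp [Fin.exists_fin_succ, Fin.tail]
    rw [h3, pow_succ']
    exact h2

theorem CasimirFamily.op_prodFamily {A J : Type*} [Ring A] [Fintype J] [DecidableEq J] {n k : ℕ}
    {S : Fin k → Set A} {b b' : Fin k → J → A} (h : ∀ i, CasimirFamily (S i) (b i) (b' i) n)
    (hS : ∀ i j, i ≠ j → ∀ x ∈ S i, ∀ y ∈ S j, Commute x y) (d : J → ℕ)
    (hd : ∀ i j, casimirOp (b i) (b' i) (b i j) = d j) (s : Fin k → J) :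
    casimirOp (prodFamily b) (prodFamily b') (prodFamily b s) = ((∏ i, d (s i) : ℕ) : A) := by
  induction k with
  | zero => simp [casimirOp_apply, prodFamily]
  | succ k ih =>
    have hS' : ∀ i j, i ≠ j → ∀ x ∈ Fin.tail S i, ∀ y ∈ Fin.tail S j, Commute x y :=
      fun i j hij => hS _ _ (by simpa using hij)
    have h1 := ih (S := Fin.tail S) (b := Fin.tail b) (b' := Fin.tail b') (fun i => h i.succ)
      hS' (fun i j => hd i.succ j) (Fin.tail s)
    have hpi := CasimirFamily.pi (S := Fin.tail S) (b := Fin.tail b) (b' := Fin.tail b')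
      (fun i => h i.succ) hS'
    have h2 := casimirOp_comp_equiv
      (fun i : J × (Fin k → J) => b 0 i.1 * prodFamily (Fin.tail b) i.2)
      (fun i => b' 0 i.1 * prodFamily (Fin.tail b') i.2) (Fin.consEquiv fun _ => J).symm
    have h3 : ∀ i, ∀ y ∈ ⋃ i, Fin.tail S i, Commute y (b 0 i) := fun i y hy => by
      obtain ⟨j, hj⟩ := Set.mem_iUnion.1 hy
      exact ((h 0).commute_left y (fun x hx => hS 0 _ (Fin.succ_ne_zero j).symm x hx y hj) i).symm
    have h4 : ∀ i j, Commute (b' 0 i) (prodFamily (Fin.tail b') j) := fun i j =>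
      commute_prodFamily (fun l j => (h 0).commute_right _ (fun x hx =>
        ((h l.succ).commute_right x (fun y hy =>
          hS _ _ (Fin.succ_ne_zero l) y hy x hx) j).symm) i) _
    change casimirOp ((fun i : J × (Fin k → J) => b 0 i.1 * prodFamily (Fin.tail b) i.2) ∘
      (Fin.consEquiv fun _ => J).symm) ((fun i : J × (Fin k → J) => b' 0 i.1 *
        prodFamily (Fin.tail b') i.2) ∘ (Fin.consEquiv fun _ => J).symm)
      (b 0 (s 0) * prodFamily (Fin.tail b) (Fin.tail s)) = _
    rw [h2, casimirOp_prod h4, hpi.op_of_commute_mul (h3 _), h1,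
      (h 0).op_mul_of_commute (fun y _ => (Nat.cast_commute _ y).symm), hd, Fin.prod_univ_succ]
    push_cast
    rfl

end ProductFamily

/-! ### Algebras with a Casimir element -/

section IsCasimir

/-- The families `b`, `b'` are dual bases of the `R`-algebra `A` for the linear form `t`, and
`∑ bᵢ x b'ᵢ = t x`. -/
structure IsCasimir {R A ι : Type*} [CommRing R] [Ring A] [Algebra R A] [Fintype ι]
    [DecidableEq ι] (b b' : ι → A) (t : A →ₗ[R] R) (n : ℕ) : Prop where
  op : ∀ x, ∑ i, b i * (x * b' i) = algebraMap R A (t x)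
  sum : ∀ x, ∑ i, t (x * b' i) • b i = x
  dual : ∀ i j, t (b i * b' j) = if i = j then 1 else 0
  one : t 1 = n

variable {R A ι : Type*} [CommRing R] [Ring A] [Algebra R A] [Fintype ι] [DecidableEq ι]
  {b b' : ι → A} {n : ℕ}

/-- Once the centralizer of `S` is the base ring, the operator takes scalar values, and these values
are the form `t`. -/
theorem CasimirFamily.exists_isCasimir {S : Set A} (h : CasimirFamily S b b' n)
    (hinj : Function.Injective (algebraMap R A))
    (hS : ∀ x, (∀ y ∈ S, Commute y x) → x ∈ Set.range (algebraMap R A)) :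
    ∃ t : A →ₗ[R] R, IsCasimir b b' t n := by
  choose t ht using fun x => hS _ fun y hy => h.commute_op y hy x
  let t' : A →ₗ[R] R :=
    { toFun := t
      map_add' := fun x y => hinj <| by simp [ht]
      map_smul' := fun r x => hinj <| by
        rw [ht, casimirOp_smul, ← ht, Algebra.smul_def, RingHom.id_apply, smul_eq_mul, map_mul] }
  have ht' : ∀ x, algebraMap R A (t' x) = casimirOp b b' x := ht
  refine ⟨t', ⟨fun x => ?_, fun x => ?_, fun i j => hinj ?_, hinj ?_⟩⟩
  · rw [ht', casimirOp_apply]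
  · simp only [Algebra.smul_def, ht', h.sum_op]
  · rw [ht', h.op_mul]; split_ifs <;> simp
  · rw [ht', h.op_one]; simp

namespace IsCasimir

variable {t : A →ₗ[R] R} (h : IsCasimir b b' t n)
include h

/-- The family `b` as a basis. -/
def basis : Module.Basis ι R A :=
  .ofEquivFun
    { toFun := fun x i => t (x * b' i)
      map_add' := fun x y => by ext i; simp [add_mul]
      map_smul' := fun r x => by ext i; simp
      invFun := fun c => ∑ i, c i • b i
      left_inv := h.sum
      right_inv := fun c => by
        ext i
        simp [Finset.sum_mul, h.dual] }

@[simp] theorem basis_apply (i : ι) : h.basis i = b i := by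
  simp [basis, Module.Basis.coe_ofEquivFun, Pi.single_apply]

theorem isAzumaya (hinj : Function.Injective (algebraMap R A)) : IsAzumaya R A := by
  have hfree : Module.Free R A := .of_basis h.basis
  have hfin : Module.Finite R A := .of_basis h.basis
  have hfaith : FaithfulSMul R A := (faithfulSMul_iff_algebraMap_injective R A).2 hinj
  have hsurj : Function.Surjective (AlgHom.mulLeftRight R A) := by
    intro φ
    -- The preimage comes from `φ(x) = ∑ᵢ t(x b'ᵢ) φ(bᵢ)`, where the scalar is replaced by the
    -- Casimir sum `∑ⱼ bⱼ x b'ᵢ b'ⱼ`.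
    refine ⟨∑ i, ∑ j, (φ (b i) * b j) ⊗ₜ[R] MulOpposite.op (b' i * b' j), LinearMap.ext fun x => ?_⟩
    conv_rhs => rw [← h.sum x, map_sum]
    simp only [map_sum, LinearMap.sum_apply, AlgHom.mulLeftRight_apply, MulOpposite.unop_op,
      map_smul]
    refine Finset.sum_congr rfl fun i _ => ?_
    rw [Algebra.smul_def, Algebra.commutes, ← h.op, Finset.mul_sum]
    simp only [mul_assoc]
  let B := h.basis.tensorProduct (h.basis.map (MulOpposite.opLinearEquiv R))
  let e : (A ⊗[R] Aᵐᵒᵖ) ≃ₗ[R] Module.End R A :=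
    B.equivFun ≪≫ₗ LinearEquiv.curry R R ι ι ≪≫ₗ (LinearMap.toMatrix h.basis h.basis).symm
  have hfin2 : Module.Finite R (A ⊗[R] Aᵐᵒᵖ) := .of_basis B
  refine { bij := ⟨?_, hsurj⟩ }
  -- Both sides are free of rank `|ι|²`, so surjectivity forces injectivity.
  have h1 := OrzechProperty.injective_of_surjective_endomorphism
    (e.symm.toLinearMap ∘ₗ (AlgHom.mulLeftRight R A).toLinearMap) (e.symm.surjective.comp hsurj)
  exact Function.Injective.of_comp (f := e.symm) (by simpa using h1)

theorem baseChange (Ω : Type*) [CommRing Ω] [Algebra R Ω] :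
    IsCasimir (R := Ω) (fun i => (1 : Ω) ⊗ₜ[R] b i) (fun i => (1 : Ω) ⊗ₜ[R] b' i)
      ((Algebra.TensorProduct.rid R Ω Ω).toLinearMap ∘ₗ t.baseChange Ω) n := by
  refine ⟨fun x => ?_, fun x => ?_, fun i j => ?_, ?_⟩
  · induction x with
    | zero => simp
    | add x y hx hy => simp only [mul_add, add_mul, Finset.sum_add_distrib, hx, hy, map_add]
    | tmul w a =>
      have h1 : ∑ i, (w ⊗ₜ[R] (b i * (a * b' i)) : Ω ⊗[R] A) = w ⊗ₜ algebraMap R A (t a) := by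
        rw [← TensorProduct.tmul_sum, h.op]
      simp [h1, Algebra.algebraMap_eq_smul_one, TensorProduct.smul_tmul', TensorProduct.tmul_smul,
        Algebra.TensorProduct.one_def]
  · induction x with
    | zero => simp
    | add x y hx hy => simp [add_mul, add_smul, Finset.sum_add_distrib] at hx hy ⊢; rw [hx, hy]
    | tmul w a =>
      have h1 : ∑ i, (w ⊗ₜ[R] (t (a * b' i) • b i) : Ω ⊗[R] A) = w ⊗ₜ a := by
        rw [← TensorProduct.tmul_sum, h.sum]
      simpa [TensorProduct.smul_tmul'] using h1
  · simp [h.dual]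
  · have : (1 : Ω ⊗[R] A) = 1 ⊗ₜ 1 := rfl
    rw [this]
    simp [h.one, Algebra.smul_def]

end IsCasimir

/-- A nonzero `x` has a nonzero coordinate `t(x b'ᵢ)`, and the Casimir sum of `x b'ᵢ` puts this unit
into every two-sided ideal that contains `x`. -/
theorem IsCasimir.isSimpleRing {Ω A : Type*} [Field Ω] [Ring A] [Algebra Ω A] [Nontrivial A]
    {b b' : ι → A} {t : A →ₗ[Ω] Ω} (h : IsCasimir b b' t n) : IsSimpleRing A := by
  refine ⟨⟨fun I => ?_⟩⟩
  by_cases hI : I = ⊥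
  · exact .inl hI
  refine .inr ?_
  obtain ⟨x, hx, hx0⟩ : ∃ x ∈ I, x ≠ 0 := by
    by_contra! hc
    exact hI (le_bot_iff.1 fun x hx => (TwoSidedIdeal.mem_bot _).2 (hc x hx))
  obtain ⟨i, hi⟩ : ∃ i, t (x * b' i) ≠ 0 := by
    by_contra! hc
    exact hx0 (by rw [← h.sum x]; simp [hc])
  have h1 : algebraMap Ω A (t (x * b' i)) ∈ I := by
    rw [← h.op]
    exact sum_mem fun j _ => I.mul_mem_left _ _ (I.mul_mem_right _ _ (I.mul_mem_right _ _ hx))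
  rw [← TwoSidedIdeal.one_mem_iff]
  have h2 := I.mul_mem_left (algebraMap Ω A (t (x * b' i))⁻¹) _ h1
  rwa [← map_mul, inv_mul_cancel₀ hi, map_one] at h2

end IsCasimir

/-! ### The reduced trace -/

section ReducedTrace

variable {ι : Type*} [Fintype ι] [DecidableEq ι]

theorem IsCasimir.map {R A B : Type*} [CommRing R] [Ring A] [Algebra R A] [Ring B] [Algebra R B]
    {b b' : ι → A} {t : A →ₗ[R] R} {n : ℕ} (h : IsCasimir b b' t n) (e : A ≃ₐ[R] B) :
    IsCasimir (fun i => e (b i)) (fun i => e (b' i)) (t ∘ₗ e.symm.toLinearMap) n := by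
  refine ⟨fun x => ?_, fun x => ?_, fun i j => ?_, ?_⟩
  · have h1 := congrArg e (h.op (e.symm x))
    simpa using h1
  · have h1 := congrArg e (h.sum (e.symm x))
    simpa using h1
  · simp [h.dual]
  · simp [h.one]

open Matrix in
-- Entries of the Casimir identity at matrix units give `∑ᵢ bᵢ(r,p) b'ᵢ(q,s) = δ_{rs} t(e_{pq})`.
-- Inserting this into the expansion of a matrix unit along `b` leaves products of two values of
-- `t`, which pin `t` down up to a sign.
theorem IsCasimir.matrix_apply_single {Ω : Type*} [CommRing Ω] {N : ℕ}
    {b b' : ι → Matrix (Fin N) (Fin N) Ω} {t : Matrix (Fin N) (Fin N) Ω →ₗ[Ω] Ω} {n : ℕ}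
    (h : IsCasimir b b' t n) (x y a c : Fin N) :
    t (single x a 1) * t (single c y 1) = if x = a ∧ y = c then 1 else 0 := by
  have h1 : ∀ p q r s, ∑ i, b i r p * b' i q s = if r = s then t (single p q 1) else 0 := by
    intro p q r s
    have h2 := congrFun (congrFun (h.op (single p q 1)) r) s
    rw [Matrix.sum_apply, Matrix.algebraMap_matrix_apply] at h2
    rw [Algebra.algebraMap_self, RingHom.id_apply] at h2
    rw [← h2]
    refine Finset.sum_congr rfl fun i _ => ?_
    rw [← mul_assoc, Matrix.mul_apply, Finset.sum_eq_single q]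
    · simp
    · intro j _ hj; rw [Matrix.mul_single_apply_of_ne (hbj := hj), zero_mul]
    · simp
  have h3 : ∀ X : Matrix (Fin N) (Fin N) Ω, t (single x y 1 * X) =
      ∑ d, X y d * t (single x d 1) := by
    intro X
    have h4 : single x y 1 * X = ∑ d, X y d • single x d (1 : Ω) := by
      ext r s
      simp only [Matrix.sum_apply, Matrix.smul_apply, smul_eq_mul]
      rw [Finset.sum_eq_single s]
      · by_cases hr : x = r
        · subst hr; simp
        · rw [Matrix.single_mul_apply_of_ne _ _ _ _ _ (Ne.symm hr), Matrix.single_apply_of_row_ne hr]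
          simp
      · intro d _ hd
        rw [Matrix.single_apply_of_col_ne _ _ hd, mul_zero]
      · simp
    rw [h4, map_sum]
    simp only [map_smul, smul_eq_mul]
  have h5 := congrFun (congrFun (h.sum (single x y 1)) a) c
  simp only [Matrix.sum_apply, Matrix.smul_apply, smul_eq_mul, h3] at h5
  calc _ = ∑ d, t (single x d 1) * (if a = d then t (single c y 1) else 0) := by simp
    _ = ∑ d, t (single x d 1) * ∑ i, b i a c * b' i y d := by simp only [h1]
    _ = ∑ i, (∑ d, b' i y d * t (single x d 1)) * b i a c := by
      simp only [Finset.mul_sum, Finset.sum_mul]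
      rw [Finset.sum_comm]
      exact Finset.sum_congr rfl fun i _ => Finset.sum_congr rfl fun d _ => by ring
    _ = _ := by rw [h5, Matrix.single_apply]

open Matrix in
-- The values at matrix units give `t = κ · trace` with `κ² = 1`, and `t 1 = 2^k = N` settles the
-- sign: if `2 ≠ 0` then `2^k` can be cancelled from `κ · 2^k = 2^k`, and if `2 = 0` then `κ² = 1`
-- already forces `κ = 1`.
theorem IsCasimir.eq_trace {Ω : Type*} [Field Ω] {N k : ℕ}
    {b b' : ι → Matrix (Fin N) (Fin N) Ω} {t : Matrix (Fin N) (Fin N) Ω →ₗ[Ω] Ω}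
    (h : IsCasimir b b' t (2 ^ k)) (hι : Fintype.card ι = 2 ^ k * 2 ^ k)
    (x : Matrix (Fin N) (Fin N) Ω) : t x = x.trace := by
  have hN : N = 2 ^ k := by
    have h1 := Module.finrank_eq_card_basis h.basis
    rw [Module.finrank_matrix, hι] at h1
    simp at h1
    exact Nat.mul_self_inj.1 h1
  have hN0 : 0 < N := hN ▸ by positivity
  set κ := t (single ⟨0, hN0⟩ ⟨0, hN0⟩ 1) with hκ
  have hκ1 : κ * κ = 1 := by rw [hκ, h.matrix_apply_single]; simp
  have hdiag : ∀ i, t (single i i 1) = κ := by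
    intro i
    have h1 : κ * t (single i i 1) = 1 := by rw [hκ, h.matrix_apply_single]; simp
    linear_combination κ * h1 - t (single i i 1) * hκ1
  have hoff : ∀ i j, i ≠ j → t (single i j 1) = 0 := by
    intro i j hij
    have h1 : t (single i j 1) * κ = 0 := by rw [hκ, h.matrix_apply_single]; simp [hij]
    linear_combination κ * h1 - t (single i j 1) * hκ1
  have ht : ∀ x, t x = κ * x.trace := by
    intro x
    conv_lhs => rw [matrix_eq_sum_single x]
    simp only [map_sum]
    rw [trace, Finset.mul_sum]
    refine Finset.sum_congr rfl fun i _ => ?_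
    rw [Finset.sum_eq_single i]
    · have : single i i (x i i) = x i i • single i i 1 := by simp
      rw [this, map_smul, hdiag, diag_apply, smul_eq_mul, mul_comm]
    · intro j _ hj
      have : single i j (x i j) = x i j • single i j 1 := by simp
      rw [this, map_smul, hoff i j hj.symm, smul_zero]
    · simp
  have h1 := h.one
  rw [ht, trace_one, Fintype.card_fin, hN] at h1
  push_cast at h1
  have hκ2 : κ = 1 := by
    by_cases h2 : (2 : Ω) = 0
    · have h3 : (κ - 1) ^ 2 = 0 := by linear_combination hκ1 - (κ - 1) * h2
      exact sub_eq_zero.1 (pow_eq_zero_iff two_ne_zero |>.1 h3)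
    · exact mul_right_cancel₀ (pow_ne_zero k h2) (by rw [h1, one_mul])
  rw [ht, hκ2, one_mul]

variable {R A : Type*} [CommRing R] [Ring A] [Algebra R A]
  {b b' : ι → A} {t : A →ₗ[R] R} {k : ℕ}

theorem IsCasimir.isReducedTrace (h : IsCasimir b b' t (2 ^ k))
    (hι : Fintype.card ι = 2 ^ k * 2 ^ k) : IsReducedTrace R A t := by
  intro Ω _ _ _ N e a
  have h1 := ((h.baseChange Ω).map e).eq_trace hι (e (1 ⊗ₜ a))
  rw [← h1]
  simp [Algebra.algebraMap_eq_smul_one]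

/-- The base change to `Ω` again has a Casimir pair, so it is a simple finite-dimensional algebra
over an algebraically closed field, and Wedderburn's theorem applies. -/
theorem IsCasimir.exists_splitting (h : IsCasimir b b' t (2 ^ k))
    (hι : Fintype.card ι = 2 ^ k * 2 ^ k) (Ω : Type*) [Field Ω] [IsAlgClosed Ω] [Algebra R Ω] :
    ∃ N : ℕ, Nonempty ((Ω ⊗[R] A) ≃ₐ[Ω] Matrix (Fin N) (Fin N) Ω) := by
  have h1 := h.baseChange Ω
  have hfin : Module.Finite Ω (Ω ⊗[R] A) := .of_basis h1.basis
  have hnt : Nontrivial (Ω ⊗[R] A) := by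
    refine Module.nontrivial_of_finrank_pos (R := Ω) ?_
    rw [Module.finrank_eq_card_basis h1.basis, hι]
    positivity
  have := h1.isSimpleRing
  obtain ⟨N, _, he⟩ := IsSimpleRing.exists_algEquiv_matrix_of_isAlgClosed Ω (Ω ⊗[R] A)
  exact ⟨N, he⟩

universe u

/-- The algebraic closures of the fraction fields of the quotients `R ⧸ p` show that `r` lies in
every prime, so it is nilpotent. -/
theorem eq_zero_of_forall_isAlgClosed {R : Type u} [CommRing R] [IsReduced R] {r : R}
    (h : ∀ (Ω : Type u) [Field Ω] [IsAlgClosed Ω] [Algebra R Ω], algebraMap R Ω r = 0) : r = 0 := by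
  refine IsReduced.eq_zero r (nilpotent_iff_mem_prime.2 fun p hp => ?_)
  have h1 := h (AlgebraicClosure (FractionRing (R ⧸ p)))
  rw [IsScalarTower.algebraMap_apply R (R ⧸ p), IsScalarTower.algebraMap_apply (R ⧸ p)
    (FractionRing (R ⧸ p))] at h1
  rw [map_eq_zero, map_eq_zero_iff _ (IsFractionRing.injective _ _)] at h1
  exact Ideal.Quotient.eq_zero_iff_mem.1 h1

/-- Two reduced traces agree at every geometric point because a splitting exists there, and over a
reduced ring the geometric points separate elements. So the arbitrary choice in `trd` is harmless.
-/
theorem IsCasimir.trd_eq {R : Type u} {A : Type*} [CommRing R] [IsReduced R] [Ring A] [Algebra R A]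
    {b b' : ι → A} {t : A →ₗ[R] R} (h : IsCasimir b b' t (2 ^ k))
    (hι : Fintype.card ι = 2 ^ k * 2 ^ k) : trd R A = t := by
  have hex : ∃ t : A →ₗ[R] R, IsReducedTrace R A t := ⟨t, h.isReducedTrace hι⟩
  have h1 : trd R A = hex.choose := dif_pos hex
  ext a
  refine sub_eq_zero.1 (eq_zero_of_forall_isAlgClosed fun Ω _ _ _ => ?_)
  obtain ⟨N, ⟨e⟩⟩ := h.exists_splitting hι Ω
  rw [h1, map_sub, hex.choose_spec Ω N e a, h.isReducedTrace hι Ω N e a, sub_self]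

theorem IsCasimir.apply_mul_comm {R : Type u} {A : Type*} [CommRing R] [IsReduced R] [Ring A]
    [Algebra R A] {b b' : ι → A} {t : A →ₗ[R] R} (h : IsCasimir b b' t (2 ^ k))
    (hι : Fintype.card ι = 2 ^ k * 2 ^ k) (x y : A) : t (x * y) = t (y * x) := by
  refine sub_eq_zero.1 (eq_zero_of_forall_isAlgClosed fun Ω _ _ _ => ?_)
  obtain ⟨N, ⟨e⟩⟩ := h.exists_splitting hι Ω
  have h1 : ∀ x y, algebraMap R Ω (t (x * y)) = (e (1 ⊗ₜ x) * e (1 ⊗ₜ y)).trace := by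
    intro x y
    rw [h.isReducedTrace hι Ω N e, ← map_mul]; simp
  rw [map_sub, h1, h1, Matrix.trace_mul_comm, sub_self]

/-- A basis of `V` gives an explicit splitting over every extension field. Any other splitting has
the same trace, since isomorphisms between matrix algebras preserve the trace. -/
theorem trd_end {F : Type u} {V : Type*} [Field F] [AddCommGroup V] [Module F V]
    [FiniteDimensional F V] : trd F (Module.End F V) = LinearMap.trace F V := by
  let B := Module.finBasis F V
  let e₀ := algEquivMatrix B
  have hmap : ∀ (Ω : Type u) [Field Ω] [Algebra F Ω] (a : Module.End F V),
      algebraMap F Ω (LinearMap.trace F V a) = ((algebraMap F Ω).mapMatrix (e₀ a)).trace := by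
    intro Ω _ _ a
    have h1 : LinearMap.trace F V a = (e₀ a).trace := LinearMap.trace_eq_matrix_trace F B a
    rw [h1, Matrix.trace, map_sum]
    rfl
  have hs : ∀ (Ω : Type u) [Field Ω] [Algebra F Ω], ∃ e : (Ω ⊗[F] Module.End F V) ≃ₐ[Ω]
      Matrix (Fin (Module.finrank F V)) (Fin (Module.finrank F V)) Ω,
      ∀ a, (e (1 ⊗ₜ a)).trace = algebraMap F Ω (LinearMap.trace F V a) := by
    intro Ω _ _
    refine ⟨(Algebra.TensorProduct.congr (AlgEquiv.refl (R := Ω) (A₁ := Ω)) e₀).trans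
      (AlgEquiv.ofRingEquiv
        (f := (matrixEquivTensor (Fin (Module.finrank F V)) F Ω).symm.toRingEquiv) fun r => ?_),
      fun a => ?_⟩
    · change (matrixEquivTensor (Fin (Module.finrank F V)) F Ω).symm (r ⊗ₜ 1) = _
      rw [matrixEquivTensor_apply_symm]
      ext i j
      by_cases hij : i = j
      · subst hij; simp [Matrix.algebraMap_matrix_apply]
      · simp [Matrix.algebraMap_matrix_apply, hij]
    · rw [hmap]
      change ((matrixEquivTensor (Fin (Module.finrank F V)) F Ω).symm (1 ⊗ₜ e₀ a)).trace = _
      rw [matrixEquivTensor_apply_symm]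
      simp [Matrix.trace]
  have h1 : IsReducedTrace F (Module.End F V) (LinearMap.trace F V) := by
    intro Ω _ _ _ n e a
    obtain ⟨e', he'⟩ := hs Ω
    have h2 := Matrix.trace_map (e'.symm.trans e) (e' (1 ⊗ₜ a))
    rw [← he', ← h2]
    simp
  have hex : ∃ t : Module.End F V →ₗ[F] F, IsReducedTrace F (Module.End F V) t := ⟨_, h1⟩
  have h2 : trd F (Module.End F V) = hex.choose := dif_pos hex
  ext a
  obtain ⟨e, he⟩ := hs (AlgebraicClosure F)
  have h3 := hex.choose_spec (AlgebraicClosure F) _ e a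
  rw [he] at h3
  rw [h2]
  exact (algebraMap F (AlgebraicClosure F)).injective h3

end ReducedTrace

/-! ### Ranks of submodules adapted to a basis -/

section Ranks

/-- A fixed vector is determined by one free coordinate for each orbit of `π`. On a two-element
orbit the other coordinate follows up to the sign, and on a fixed point there is no constraint
because the sign is `1`. No division by 2 occurs. -/
theorem free_ker_of_signed_perm {R M ι : Type*} [CommRing R] [Nontrivial R] [AddCommGroup M]
    [Module R M] [Fintype ι] [DecidableEq ι] (B : Module.Basis ι R M) (σ : M →ₗ[R] M) (π : ι → ι)
    (hπ : Function.Involutive π) (s : ι → R) (hs : ∀ i, s i * s i = 1)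
    (hsπ : ∀ i, s (π i) = s i) (hfix : ∀ i, π i = i → s i = 1)
    (hσ : ∀ i, σ (B i) = s i • B (π i)) :
    Module.Free R (LinearMap.ker (σ - LinearMap.id)) ∧
      2 * Module.finrank R (LinearMap.ker (σ - LinearMap.id)) =
        Fintype.card ι + Fintype.card {i // π i = i} := by
  let e := Fintype.equivFin ι
  have hrepr : ∀ x i, B.repr (σ x) (π i) = s i * B.repr x i := by
    intro x i
    conv_lhs => rw [← B.sum_repr x]
    simp only [map_sum, map_smul, hσ, Finsupp.coe_finsetSum, Finset.sum_apply, Finsupp.smul_apply,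
      Module.Basis.repr_self, Finsupp.single_apply, smul_eq_mul, hπ.injective.eq_iff]
    simp [mul_comm]
  have hmem : ∀ x, x ∈ LinearMap.ker (σ - LinearMap.id) ↔
      ∀ i, B.repr x (π i) = s i * B.repr x i := by
    intro x
    rw [LinearMap.mem_ker, LinearMap.sub_apply, LinearMap.id_apply, sub_eq_zero]
    refine ⟨fun h i => by rw [← hrepr, h], fun h => B.repr.injective (Finsupp.ext fun i => ?_)⟩
    rw [← hπ i, hrepr]
    exact (h (π i)).symm
  -- An enumeration of `ι` selects one representative of each orbit of `π`; `ext` extends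
  -- coordinates from these representatives to all of `ι`.
  let T := {i // e i ≤ e (π i)}
  let ext : (T → R) → ι → R := fun c i =>
    if h : e i ≤ e (π i) then c ⟨i, h⟩ else
      s i * c ⟨π i, by rw [hπ i]; exact (not_le.1 h).le⟩
  have hext : ∀ c i, ext c (π i) = s i * ext c i := by
    intro c i
    rcases lt_trichotomy (e i) (e (π i)) with h | h | h
    · have h1 : ¬ e (π i) ≤ e (π (π i)) := by rw [hπ i]; exact not_le.2 h
      simp only [ext, dif_neg h1, dif_pos h.le, hπ i, hsπ]
    · have h1 : π i = i := (e.injective h).symm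
      rw [h1, hfix i h1, one_mul]
    · have h1 : e (π i) ≤ e (π (π i)) := by rw [hπ i]; exact h.le
      simp only [ext, dif_neg (not_le.2 h), dif_pos h1]
      rw [← mul_assoc, hs, one_mul]
  let E : LinearMap.ker (σ - LinearMap.id) ≃ₗ[R] (T → R) :=
    { toFun := fun x i => B.repr x i
      map_add' := fun x y => by funext i; simp
      map_smul' := fun r x => by funext i; simp
      invFun := fun c => ⟨B.equivFun.symm (ext c), (hmem _).2 fun i => by
        have h1 : ⇑(B.repr (B.equivFun.symm (ext c))) = ext c := B.equivFun.apply_symm_apply _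
        rw [h1, hext]⟩
      left_inv := fun x => by
        refine Subtype.ext (B.equivFun.injective (funext fun i => ?_))
        simp only [LinearEquiv.apply_symm_apply, Module.Basis.equivFun_apply]
        by_cases h : e i ≤ e (π i)
        · simp only [ext, dif_pos h]
        · simp only [ext, dif_neg h]
          rw [(hmem _).1 x.2 i, ← mul_assoc, hs, one_mul]
      right_inv := fun c => by
        funext i
        have h1 : B.repr (B.equivFun.symm (ext c)) = B.equivFun (B.equivFun.symm (ext c)) := rfl
        change B.repr (B.equivFun.symm (ext c)) i = c i
        rw [h1, LinearEquiv.apply_symm_apply]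
        exact dif_pos i.2 }
  refine ⟨.of_equiv E.symm, ?_⟩
  rw [E.finrank_eq, Module.finrank_fintype_fun_eq_card]
  simp only [T, Fintype.card_subtype]
  have h1 : (Finset.univ.filter fun i => e (π i) < e i).card =
      (Finset.univ.filter fun i => e i < e (π i)).card :=
    Finset.card_bij (fun i _ => π i) (by simp [hπ _]) (fun i _ j _ h => hπ.injective h)
      (fun i hi => ⟨π i, by simpa [hπ i] using hi, hπ i⟩)
  have h2 : (Finset.univ.filter fun i => e i ≤ e (π i)).card =
      (Finset.univ.filter fun i => e i < e (π i)).card +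
        (Finset.univ.filter fun i => π i = i).card := by
    rw [← Finset.card_union_of_disjoint]
    · congr 1
      ext i
      simp [le_iff_lt_or_eq, eq_comm]
    · rw [Finset.disjoint_filter]
      intro i _ hi h
      rw [h] at hi
      exact lt_irrefl _ hi
  have h3 := Finset.card_filter_add_card_filter_not (s := (Finset.univ : Finset ι))
    (fun i => e i ≤ e (π i))
  simp only [not_le, Finset.card_univ] at h3
  omega

theorem free_range_of_diagonal {R M ι : Type*} [CommRing R] [Nontrivial R] [AddCommGroup M]
    [Module R M] [Fintype ι] (B : Module.Basis ι R M) (P : M →ₗ[R] M) (p : ι → Prop)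
    [DecidablePred p] (hP : ∀ i, P (B i) = if p i then B i else 0) :
    Module.Free R (LinearMap.range P) ∧
      Module.finrank R (LinearMap.range P) = Fintype.card {i // p i} := by
  have hli : LinearIndependent R fun i : {i // p i} => B i :=
    B.linearIndependent.comp _ Subtype.val_injective
  have hr : LinearMap.range P = Submodule.span R (Set.range fun i : {i // p i} => B i) := by
    apply le_antisymm
    · rintro _ ⟨x, rfl⟩
      rw [← B.sum_repr x, map_sum]
      refine sum_mem fun i _ => ?_
      rw [map_smul, hP]
      split_ifs with h
      · exact Submodule.smul_mem _ _ (Submodule.subset_span ⟨⟨i, h⟩, rfl⟩)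
      · simp
    · rw [Submodule.span_le]
      rintro _ ⟨i, rfl⟩
      exact ⟨B i, by rw [hP, if_pos i.2]⟩
  rw [hr]
  exact ⟨.of_basis (Module.Basis.span hli), finrank_span_eq_card hli⟩

theorem card_tuple (k : ℕ) : Fintype.card (Fin k → Bool × Bool) = 2 ^ k * 2 ^ k := by
  simp [← mul_pow]

/-- A tuple is fixed exactly when every first component is `false`, which means that the monomial
involves only single factors `E` or `F`. -/
theorem card_fixed_tuple (k : ℕ) :
    Fintype.card {s : Fin k → Bool × Bool // (fun i => ((s i).1, xor (s i).1 (s i).2)) = s} =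
      2 ^ k := by
  have e : {s : Fin k → Bool × Bool // (fun i => ((s i).1, xor (s i).1 (s i).2)) = s} ≃
      (Fin k → Bool) :=
    { toFun := fun s i => (s.1 i).2
      invFun := fun s => ⟨fun i => (false, s i), by simp⟩
      left_inv := fun s => by
        refine Subtype.ext (funext fun i => ?_)
        have h := congrFun s.2 i
        have h1 : (s.1 i).1 = false := by
          have := congrArg Prod.snd h
          revert this
          cases (s.1 i).1 <;> cases (s.1 i).2 <;> simp
        exact Prod.ext h1.symm rfl
      right_inv := fun s => rfl }
  rw [Fintype.card_congr e]; simp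

/-- Toggling the second component at index `0` exchanges the two halves. -/
theorem card_half_tuple (k : ℕ) :
    2 * Fintype.card {s : Fin (k + 1) → Bool × Bool // (s 0).2 = false} =
      2 ^ (k + 1) * 2 ^ (k + 1) := by
  rw [← card_tuple, Fintype.card_subtype, ← Finset.card_univ,
    ← Finset.card_filter_add_card_filter_not (s := Finset.univ)
      (fun s : Fin (k + 1) → Bool × Bool => (s 0).2 = false), two_mul]
  congr 1
  refine Finset.card_bij' (fun s _ => Function.update s 0 ((s 0).1, !(s 0).2))
    (fun s _ => Function.update s 0 ((s 0).1, !(s 0).2)) ?_ ?_ ?_ ?_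
  all_goals simp

end Ranks

/-! ### Involutions on products of commuting families -/

section InvolutionProduct

variable {R A J : Type*} [CommRing R] [Ring A] [Algebra R A]

theorem Involution.toLin_one (σ : Involution R A) : σ.toLin 1 = 1 := by
  have h := σ.map_mul' (σ.toLin 1) 1
  rw [mul_one, σ.invol', mul_one] at h
  exact h.symm

theorem Involution.prodFamily (σ : Involution R A) {π : J → J} {k : ℕ} {b : Fin k → J → A}
    {c : Fin k → J → R} (hb : ∀ i i' j j', i ≠ i' → Commute (b i j) (b i' j'))
    (hσ : ∀ i j, σ.toLin (b i j) = c i j • b i (π j)) (s : Fin k → J) :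
    σ.toLin (prodFamily b s) = (∏ i, c i (s i)) • QuadPair.prodFamily b fun i => π (s i) := by
  induction k with
  | zero => simp [QuadPair.prodFamily, σ.toLin_one]
  | succ k ih =>
    have h1 := ih (b := Fin.tail b) (c := Fin.tail c)
      (fun i i' j j' h => hb _ _ _ _ (by simpa using h)) (fun i j => hσ i.succ j) (Fin.tail s)
    have h2 : Commute (b 0 (π (s 0))) (QuadPair.prodFamily (Fin.tail b) fun i =>
        π (Fin.tail s i)) :=
      commute_prodFamily (fun i j => hb _ _ _ _ (Fin.succ_ne_zero i).symm) _
    change σ.toLin (b 0 (s 0) * QuadPair.prodFamily (Fin.tail b) (Fin.tail s)) =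
      _ • (b 0 (π (s 0)) * QuadPair.prodFamily (Fin.tail b) fun i => π (Fin.tail s i))
    rw [σ.map_mul', h1, hσ, h2.eq, Fin.prod_univ_succ, smul_mul_smul_comm, mul_comm (c 0 (s 0))]
    rfl

end InvolutionProduct

/-! ### Commuting systems of quaternion pairs -/

section QuaternionSystem

/-- Pairwise commuting quaternion pairs `(E i, F i)`. -/
structure QuaternionSystem {R A : Type*} [CommRing R] [Ring A] [Algebra R A] {k : ℕ}
    (α β γ : Fin k → R) (E F : Fin k → A) : Prop where
  pair : ∀ i, QuaternionPair (α i) (β i) (E i) (F i)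
  disc : ∀ i, γ i * (1 - 4 * α i * β i) = 1
  left_left : ∀ i j, i ≠ j → Commute (E i) (E j)
  left_right : ∀ i j, i ≠ j → Commute (E i) (F j)
  right_right : ∀ i j, i ≠ j → Commute (F i) (F j)

namespace QuaternionSystem

variable {R A : Type*} [CommRing R] [Ring A] [Algebra R A] {k : ℕ}
  {α β γ : Fin k → R} {E F : Fin k → A}

/-- The products of one basis element from each pair. -/
abbrev monomials (E F : Fin k → A) : (Fin k → Bool × Bool) → A :=
  prodFamily fun i => quatBasis (E i) (F i)

/-- The family dual to the monomials. -/
abbrev dualMonomials (α β γ : Fin k → R) (E F : Fin k → A) : (Fin k → Bool × Bool) → A :=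
  prodFamily fun i => quatDual (α i) (β i) (γ i) (E i) (F i)

variable (h : QuaternionSystem α β γ E F)
include h

theorem commute_pairs (i j : Fin k) (hij : i ≠ j) :
    ∀ x ∈ ({E i, F i} : Set A), ∀ y ∈ ({E j, F j} : Set A), Commute x y := by
  rintro x (rfl | rfl) y (rfl | rfl)
  · exact h.left_left i j hij
  · exact h.left_right i j hij
  · exact (h.left_right j i hij.symm).symm
  · exact h.right_right i j hij

theorem casimirFamily : CasimirFamily (⋃ i, {E i, F i}) (monomials E F)
    (dualMonomials α β γ E F) (2 ^ k) :=
  CasimirFamily.pi (fun i => (h.pair i).casimirFamily (h.disc i)) h.commute_pairs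

theorem commute_basis (i i' : Fin k) (j j' : Bool × Bool) (hi : i ≠ i') :
    Commute (quatBasis (E i) (F i) j) (quatBasis (E i') (F i') j') :=
  ((h.pair i).casimirFamily (h.disc i)).commute_left _ (fun x hx =>
    (((h.pair i').casimirFamily (h.disc i')).commute_left _
      (fun y hy => h.commute_pairs _ _ hi.symm y hy x hx) _).symm) _

theorem exists_isCasimir (hinj : Function.Injective (algebraMap R A))
    (hcent : ∀ x, (∀ i, Commute (E i) x ∧ Commute (F i) x) → x ∈ Set.range (algebraMap R A)) :
    ∃ t : A →ₗ[R] R, IsCasimir (monomials E F) (dualMonomials α β γ E F) t (2 ^ k) := by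
  refine h.casimirFamily.exists_isCasimir hinj fun x hx => hcent x fun i => ?_
  exact ⟨hx _ (Set.mem_iUnion.2 ⟨i, by simp⟩), hx _ (Set.mem_iUnion.2 ⟨i, by simp⟩)⟩

/-- `E ↦ E`, `F ↦ F`, `EF ↔ FE` on each factor. -/
def flip (s : Fin k → Bool × Bool) : Fin k → Bool × Bool :=
  fun i => ((s i).1, xor (s i).1 (s i).2)

omit h in
theorem flip_flip (s : Fin k → Bool × Bool) : flip (flip s) = s := by
  funext i
  simp only [flip]
  rcases s i with ⟨_ | _, _ | _⟩ <;> rfl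

/-- The sign of a monomial under an involution with `E i ↦ c i E i`, `F i ↦ c i F i`. -/
def sign (c : Fin k → R) (s : Fin k → Bool × Bool) : R :=
  ∏ i, if (s i).1 then 1 else c i

theorem involution_monomials (σ : Involution R A) (c : Fin k → R)
    (hE : ∀ i, σ.toLin (E i) = c i • E i) (hF : ∀ i, σ.toLin (F i) = c i • F i)
    (hc : ∀ i, c i * c i = 1) (s : Fin k → Bool × Bool) :
    σ.toLin (monomials E F s) = sign c s • monomials E F (flip s) := by
  refine σ.prodFamily (π := fun j => (j.1, xor j.1 j.2))
    (c := fun i j => if j.1 then 1 else c i) (fun i i' j j' => h.commute_basis i i' j j') ?_ s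
  rintro i ⟨j₁, j₂⟩
  cases j₁ <;> cases j₂ <;>
    simp [quatBasis, hE, hF, σ.map_mul', smul_smul, hc]

omit h in
theorem sign_mul_self {c : Fin k → R} (hc : ∀ i, c i * c i = 1) (s : Fin k → Bool × Bool) :
    sign c s * sign c s = 1 := by
  rw [sign, ← Finset.prod_mul_distrib]
  refine Finset.prod_eq_one fun i _ => ?_
  split_ifs <;> simp [hc]

omit h in
theorem sign_of_flip_eq {c : Fin k → R} {s : Fin k → Bool × Bool} (hs : flip s = s) :
    sign c s = ∏ i, c i := by
  refine Finset.prod_congr rfl fun i _ => ?_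
  have h1 := congrArg Prod.snd (congrFun hs i)
  simp only [flip] at h1
  revert h1
  rcases s i with ⟨_ | _, _ | _⟩ <;> simp

variable {t : A →ₗ[R] R}
  (ht : IsCasimir (monomials E F) (dualMonomials α β γ E F) t (2 ^ k))
include ht

/-- A monomial fixed by `flip` takes `E` or `F` from every pair, so its sign is the full product `∏
c i`. When this is `1`, the `2^k` fixed monomials are symmetric and the others are swapped in pairs
up to sign. -/
theorem sym_free_finrank [Nontrivial R] (σ : Involution R A) (c : Fin k → R)
    (hE : ∀ i, σ.toLin (E i) = c i • E i) (hF : ∀ i, σ.toLin (F i) = c i • F i)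
    (hc : ∀ i, c i * c i = 1) (hprod : ∏ i, c i = 1) :
    Module.Free R σ.sym ∧ 2 * Module.finrank R σ.sym = 2 ^ k * (2 ^ k + 1) := by
  have h1 := free_ker_of_signed_perm ht.basis σ.toLin flip flip_flip (sign c)
    (sign_mul_self hc) (fun s => rfl) (fun s hs => (sign_of_flip_eq hs).trans hprod)
    (fun s => by simpa using h.involution_monomials σ c hE hF hc s)
  refine ⟨h1.1, h1.2.trans ?_⟩
  rw [card_tuple, mul_add, mul_one]
  congr 1
  exact card_fixed_tuple k

omit h in
theorem finrank_eq [Nontrivial R] : Module.Free R A ∧ Module.finrank R A = 2 ^ k * 2 ^ k := by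
  refine ⟨.of_basis ht.basis, ?_⟩
  rw [Module.finrank_eq_card_basis ht.basis, card_tuple]

/-- The trace of one pair is `0` on `E` and `F` and `1` on `EF` and `FE`, and it is multiplicative
over the pairs. -/
theorem form_monomials (hinj : Function.Injective (algebraMap R A)) (s : Fin k → Bool × Bool) :
    t (monomials E F s) = ((∏ i, (s i).1.toNat : ℕ) : R) := by
  apply hinj
  rw [← ht.op, ← casimirOp_apply, map_natCast]
  refine CasimirFamily.op_prodFamily (fun i => (h.pair i).casimirFamily (h.disc i))
    h.commute_pairs (fun j => j.1.toNat) ?_ s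
  rintro i ⟨j₁, j₂⟩
  cases j₁ <;> cases j₂ <;> simp [quatBasis, (h.pair i).op_left, (h.pair i).op_right,
    (h.pair i).op_left_mul_right (h.disc i), (h.pair i).op_right_mul_left (h.disc i)]

/-- The trace vanishes on all monomials except those taking `EF` or `FE` from every pair; these have
sign `1` and are permuted among themselves by `flip`. -/
theorem form_involution (hinj : Function.Injective (algebraMap R A)) (σ : Involution R A)
    (c : Fin k → R) (hE : ∀ i, σ.toLin (E i) = c i • E i) (hF : ∀ i, σ.toLin (F i) = c i • F i)
    (hc : ∀ i, c i * c i = 1) (x : A) : t (σ.toLin x) = t x := by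
  have h1 : t ∘ₗ σ.toLin = t := ht.basis.ext fun s => by
    rw [ht.basis_apply, LinearMap.comp_apply, h.involution_monomials σ c hE hF hc, map_smul,
      h.form_monomials ht hinj, h.form_monomials ht hinj]
    by_cases hs : ∀ i, (s i).1 = true
    · have h2 : sign c s = 1 := Finset.prod_eq_one fun i _ => by simp [hs i]
      simp [h2, flip]
    · push Not at hs
      obtain ⟨i, hi⟩ := hs
      have h2 : ∏ i, (s i).1.toNat = 0 :=
        Finset.prod_eq_zero (Finset.mem_univ i) (by simp [hi])
      have h3 : ∏ i, (flip s i).1.toNat = 0 :=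
        Finset.prod_eq_zero (Finset.mem_univ i) (by simp [flip, hi])
      simp [h2, h3]
  exact LinearMap.congr_fun h1 x

end QuaternionSystem

/-- When `E² = F² = 0`, left multiplication by `EF` fixes `E` and `EF` and kills `F` and `FE`, so it
is diagonal on the monomials and keeps half of them. -/
theorem QuaternionSystem.ideal_free_finrank {R A : Type*} [CommRing R] [Nontrivial R] [Ring A]
    [Algebra R A] {k : ℕ} {α β γ : Fin (k + 1) → R} {E F : Fin (k + 1) → A}
    (h : QuaternionSystem α β γ E F) {t : A →ₗ[R] R}
    (ht : IsCasimir (monomials E F) (dualMonomials α β γ E F) t (2 ^ (k + 1)))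
    (hα : α 0 = 0) (hβ : β 0 = 0) :
    Module.Free R (LinearMap.range (LinearMap.mulLeft R (E 0 * F 0))) ∧
      2 * Module.finrank R (LinearMap.range (LinearMap.mulLeft R (E 0 * F 0))) =
        Module.finrank R A := by
  have h1 := free_range_of_diagonal ht.basis (LinearMap.mulLeft R (E 0 * F 0))
    (fun s => (s 0).2 = false) (fun s => by
      rw [ht.basis_apply, LinearMap.mulLeft_apply]
      have hp := h.pair 0
      have h2 : E 0 * F 0 * quatBasis (E 0) (F 0) (s 0) =
          if (s 0).2 = false then quatBasis (E 0) (F 0) (s 0) else 0 := by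
        rcases s 0 with ⟨_ | _, _ | _⟩ <;>
          simp [quatBasis, mul_assoc, hp.swap, hp.swap_mul, mul_sub, hp.sq_left_mul,
            hp.sq_right_mul, hp.sq_left, hp.sq_right, hα, hβ]
      change E 0 * F 0 * (quatBasis (E 0) (F 0) (s 0) * _) = _
      rw [← mul_assoc, h2, ite_mul, zero_mul]
      rfl)
  refine ⟨h1.1, ?_⟩
  rw [h1.2, (finrank_eq ht).2, card_half_tuple]

end QuaternionSystem

/-! ### The double centralizer property -/

section Centralizer

variable {R A : Type*} [CommRing R] [Ring A] [Algebra R A]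

theorem QuaternionPair.exists_coeff {α β : R} {E F : A} (h : QuaternionPair α β E F) {y : A}
    (hy : y ∈ Algebra.adjoin R {E, F}) :
    ∃ a b c d : R, y = a • (1 : A) + b • E + c • F + d • (E * F) := by
  induction hy using Algebra.adjoin_induction with
  | mem x hx =>
    rcases hx with rfl | rfl
    · exact ⟨0, 1, 0, 0, by simp⟩
    · exact ⟨0, 0, 1, 0, by simp⟩
  | algebraMap r => exact ⟨r, 0, 0, 0, by simp [Algebra.algebraMap_eq_smul_one]⟩
  | add x y _ _ hx hy =>
    obtain ⟨a, b, c, d, rfl⟩ := hx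
    obtain ⟨a', b', c', d', rfl⟩ := hy
    exact ⟨a + a', b + b', c + c', d + d', by module⟩
  | mul x y _ _ hx hy =>
    obtain ⟨a, b, c, d, rfl⟩ := hx
    obtain ⟨a', b', c', d', rfl⟩ := hy
    refine ⟨a * a' + b * b' * α + c * b' + c * c' * β - d * d' * α * β,
      a * b' + b * a' - c * d' * β + d * b' + d * c' * β,
      a * c' + c * a' + b * d' * α + c * d' - d * b' * α,
      a * d' + d * a' + b * c' - c * b' + d * d', ?_⟩
    simp only [mul_add, add_mul, mul_sub, sub_mul, smul_mul_assoc, mul_smul_comm, mul_assoc,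
      one_mul, mul_one, smul_sub, smul_add, h.sq_left, h.sq_right, h.swap, h.sq_left_mul,
      h.sq_right_mul, h.swap_mul]
    module

/-- The operator `G` is linear over `U` and takes scalar values on the subalgebra of the pair, so it
maps the algebra generated by both into `U`. For `x` commuting with the pair, `G(x E F) = x G(EF) =
x`. -/
theorem QuaternionPair.mem_of_commute {α β γ : R} {E F : A} (h : QuaternionPair α β E F)
    (hγ : γ * (1 - 4 * α * β) = 1) {U : Subalgebra R A}
    (hU : ∀ u ∈ U, Commute E u ∧ Commute F u) {x : A}
    (hx : x ∈ Algebra.adjoin R ((U : Set A) ∪ {E, F})) (hEx : Commute E x) (hFx : Commute F x) :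
    x ∈ U := by
  have hC := h.casimirFamily hγ
  set G := casimirOp (quatBasis E F) (quatDual α β γ E F) with hG
  have hGs : ∀ (r : R) y, G (r • y) = r • G y := casimirOp_smul _ _
  have h1 : ∀ y ∈ Algebra.adjoin R {E, F}, G (1 * y) ∈ U := by
    intro y hy
    obtain ⟨a, b, c, d, rfl⟩ := h.exists_coeff hy
    rw [one_mul, map_add, map_add, map_add, hGs, hGs, hGs, hGs, hG, h.op_one hγ, h.op_left,
      h.op_right, h.op_left_mul_right hγ]
    have h2 : (2 : A) ∈ U := by exact_mod_cast natCast_mem U 2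
    simp only [smul_zero, add_zero]
    exact add_mem (U.smul_mem h2 _) (U.smul_mem (one_mem U) _)
  -- The extra left factor `z` lets the induction pass through products.
  have hind : ∀ z, (∀ y ∈ Algebra.adjoin R {E, F}, G (z * y) ∈ U) →
      ∀ y ∈ Algebra.adjoin R {E, F}, G (z * x * y) ∈ U := by
    clear hEx hFx
    induction hx using Algebra.adjoin_induction with
    | mem u hu =>
      intro z hz y hy
      rcases hu with hu | hu
      · have hcu : ∀ v ∈ ({E, F} : Set A), Commute v u := by
          rintro v (rfl | rfl)
          exacts [(hU u hu).1, (hU u hu).2]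
        have huy : Commute u y := by
          have h2 : y ∈ Subalgebra.centralizer R {u} :=
            Algebra.adjoin_le (S := Subalgebra.centralizer R {u}) (fun v hv =>
              Subalgebra.mem_centralizer_iff R |>.2 (by
                rintro _ rfl; exact (hcu v hv).symm.eq)) hy
          exact (Subalgebra.mem_centralizer_iff R).1 h2 u rfl
        rw [mul_assoc, huy.eq, ← mul_assoc, hC.op_mul_of_commute hcu]
        exact mul_mem (hz y hy) hu
      · rw [mul_assoc]
        exact hz _ (mul_mem (Algebra.subset_adjoin hu) hy)
    | algebraMap r =>
      intro z hz y hy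
      rw [mul_assoc, ← Algebra.smul_def]
      exact hz _ (Subalgebra.smul_mem _ hy r)
    | add u v _ _ hu hv =>
      intro z hz y hy
      rw [mul_add, add_mul, map_add]
      exact add_mem (hu z hz y hy) (hv z hz y hy)
    | mul u v _ _ hu hv =>
      intro z hz y hy
      rw [← mul_assoc z]
      exact hv _ (hu z hz) y hy
  have h3 := hind 1 h1 (E * F) (mul_mem (Algebra.subset_adjoin (by simp))
    (Algebra.subset_adjoin (by simp)))
  have h4 : ∀ v ∈ ({E, F} : Set A), Commute v x := by
    rintro v (rfl | rfl)
    exacts [hEx, hFx]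
  rwa [one_mul, hC.op_of_commute_mul h4, h.op_left_mul_right hγ, mul_one] at h3

/-- The pairs are removed one at a time: an element commuting with the first pair lies in the
algebra generated by `K` and the remaining pairs. -/
theorem QuaternionSystem.mem_of_commute {k : ℕ} {α β γ : Fin k → R} {E F : Fin k → A}
    (h : QuaternionSystem α β γ E F) {K : Subalgebra R A}
    (hK : ∀ u ∈ K, ∀ i, Commute (E i) u ∧ Commute (F i) u) {x : A}
    (hx : x ∈ Algebra.adjoin R ((K : Set A) ∪ (Set.range E ∪ Set.range F)))
    (hxc : ∀ i, Commute (E i) x ∧ Commute (F i) x) : x ∈ K := by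
  induction k with
  | zero => simpa [Algebra.adjoin_eq] using hx
  | succ k ih =>
    have htail : QuaternionSystem (Fin.tail α) (Fin.tail β) (Fin.tail γ) (Fin.tail E)
        (Fin.tail F) :=
      ⟨fun i => h.pair i.succ, fun i => h.disc i.succ,
        fun i j hij => h.left_left _ _ (by simpa using hij),
        fun i j hij => h.left_right _ _ (by simpa using hij),
        fun i j hij => h.right_right _ _ (by simpa using hij)⟩
    refine ih htail (fun u hu i => hK u hu i.succ) ?_ fun i => hxc i.succ
    refine (h.pair 0).mem_of_commute (h.disc 0) ?_ ?_ (hxc 0).1 (hxc 0).2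
    · intro u hu
      have h2 : u ∈ Subalgebra.centralizer R {E 0, F 0} := by
        refine Algebra.adjoin_le (S := Subalgebra.centralizer R {E 0, F 0}) ?_ hu
        rintro v (hv | ⟨i, rfl⟩ | ⟨i, rfl⟩) <;>
          refine (Subalgebra.mem_centralizer_iff R).2 ?_ <;> rintro y (rfl | rfl)
        · exact (hK v hv 0).1
        · exact (hK v hv 0).2
        · exact h.left_left _ _ (Fin.succ_ne_zero i).symm
        · exact (h.left_right _ _ (Fin.succ_ne_zero i)).symm
        · exact h.left_right _ _ (Fin.succ_ne_zero i).symm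
        · exact h.right_right _ _ (Fin.succ_ne_zero i).symm
      exact ⟨(Subalgebra.mem_centralizer_iff R).1 h2 _ (by simp),
        (Subalgebra.mem_centralizer_iff R).1 h2 _ (by simp)⟩
    · refine Algebra.adjoin_mono ?_ hx |> fun h => h
      rintro v (hv | ⟨i, rfl⟩ | ⟨i, rfl⟩)
      · exact .inl (Algebra.subset_adjoin (.inl hv))
      · refine Fin.cases ?_ (fun i => ?_) i
        · exact .inr (by simp)
        · exact .inl (Algebra.subset_adjoin (.inr (.inl ⟨i, rfl⟩)))
      · refine Fin.cases ?_ (fun i => ?_) i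
        · exact .inr (by simp)
        · exact .inl (Algebra.subset_adjoin (.inr (.inr ⟨i, rfl⟩)))

end Centralizer

/-! ### Anticommuting systems -/

section CliffordSystem

/-- Pairwise anticommuting quaternion pairs `(e i, f i)`, together with an element `w` such that
`e i w = (1 - w) e i`, `f i w = (1 - w) f i`. -/
structure CliffordSystem {R A : Type*} [CommRing R] [Ring A] [Algebra R A] {k : ℕ}
    (a b c : Fin k → R) (δ : R) (e f : Fin k → A) (w : A) : Prop where
  pair : ∀ i, QuaternionPair (a i) (b i) (e i) (f i)
  disc : ∀ i, c i * (1 - 4 * a i * b i) = 1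
  left_left : ∀ i j, i ≠ j → e i * e j = -(e j * e i)
  left_right : ∀ i j, i ≠ j → e i * f j = -(f j * e i)
  right_right : ∀ i j, i ≠ j → f i * f j = -(f j * f i)
  left_mul : ∀ i, e i * w = (1 - w) * e i
  right_mul : ∀ i, f i * w = (1 - w) * f i
  mul_self : w * w = w - δ • (1 : A)
  isUnit : IsUnit (1 - 4 * δ)

variable {R A : Type*} [CommRing R] [Ring A] [Algebra R A]

/-- `1 - 2 e f`, which anticommutes with `e` and `f`. -/
abbrev discElement (e f : A) : A := 1 - (e * f + e * f)

namespace QuaternionPair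

variable {a b : R} {e f : A} (h : QuaternionPair a b e f)
include h

theorem discElement_mul_self :
    discElement e f * discElement e f = (1 - 4 * a * b) • (1 : A) := by
  simp only [discElement, mul_add, add_mul, mul_sub, sub_mul, smul_mul_assoc, mul_smul_comm,
    mul_assoc, one_mul, mul_one, smul_sub, smul_add, h.sq_left, h.sq_right, h.swap, h.sq_left_mul,
    h.sq_right_mul, h.swap_mul]
  module

omit h in
theorem commute_mul_of_anticommute {x : A} (he : e * x = -(x * e)) (hf : f * x = -(x * f)) :
    Commute (e * f) x := by
  change e * f * x = x * (e * f)
  rw [mul_assoc, hf, mul_neg, ← mul_assoc, he, neg_mul, neg_neg, mul_assoc]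

omit h in
theorem commute_discElement {x : A} (hx : Commute (e * f) x) : Commute (discElement e f) x :=
  (Commute.one_left x).sub_left (hx.add_left hx)

theorem left_mul_discElement : e * discElement e f = -(discElement e f * e) := by
  simp only [discElement, mul_add, add_mul, mul_sub, sub_mul, smul_mul_assoc, mul_smul_comm,
    mul_assoc, one_mul, mul_one, smul_sub, smul_add, h.sq_left, h.sq_right, h.swap, h.sq_left_mul,
    h.sq_right_mul, h.swap_mul]
  module

theorem right_mul_discElement : f * discElement e f = -(discElement e f * f) := by
  simp only [discElement, mul_add, add_mul, mul_sub, sub_mul, smul_mul_assoc, mul_smul_comm,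
    mul_assoc, one_mul, mul_one, smul_sub, smul_add, h.sq_left, h.sq_right, h.swap, h.sq_left_mul,
    h.sq_right_mul, h.swap_mul]
  module

end QuaternionPair
end CliffordSystem

/-! ### From anticommuting to commuting pairs -/

section Untwist

variable {R A : Type*} [CommRing R] [Ring A] [Algebra R A]

namespace CliffordSystem

variable {k : ℕ} {a b c : Fin (k + 1) → R} {δ : R} {e f : Fin (k + 1) → A} {w : A}
  (h : CliffordSystem a b c δ e f w)
include h

theorem right_left (i j : Fin (k + 1)) (hij : i ≠ j) : f i * e j = -(e j * f i) := by
  rw [h.left_right j i hij.symm, neg_neg]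

theorem commute_zero_left (i : Fin k) : Commute (e 0 * f 0) (e i.succ) :=
  QuaternionPair.commute_mul_of_anticommute (h.left_left _ _ (Fin.succ_ne_zero i).symm)
    (h.right_left _ _ (Fin.succ_ne_zero i).symm)

theorem commute_zero_right (i : Fin k) : Commute (e 0 * f 0) (f i.succ) :=
  QuaternionPair.commute_mul_of_anticommute (h.left_right _ _ (Fin.succ_ne_zero i).symm)
    (h.right_right _ _ (Fin.succ_ne_zero i).symm)

theorem commute_mul (i : Fin (k + 1)) : Commute (e i * f i) w := by
  change e i * f i * w = w * (e i * f i)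
  rw [mul_assoc, h.right_mul, ← mul_assoc, mul_sub, mul_one, h.left_mul, sub_mul, sub_mul, sub_mul]
  simp [mul_assoc]

theorem disc_mul {x y : A} (hx : Commute (e 0 * f 0) x) :
    (discElement (e 0) (f 0) * x) * (discElement (e 0) (f 0) * y) =
      (1 - 4 * a 0 * b 0) • (x * y) := by
  have h1 := (QuaternionPair.commute_discElement hx).eq
  calc _ = (discElement (e 0) (f 0) * discElement (e 0) (f 0)) * (x * y) := by
        rw [mul_assoc, ← mul_assoc x, ← h1]; simp only [mul_assoc]
    _ = _ := by
      rw [(h.pair 0).discElement_mul_self, smul_mul_assoc, one_mul]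

/-- The pairs with positive index, multiplied by `1 - 2 e 0 f 0`, form a smaller system, which
commutes with the first pair. -/
theorem tail : CliffordSystem (fun i => (1 - 4 * a 0 * b 0) * a i.succ)
    (fun i => c 0 * b i.succ) (fun i => c i.succ) (δ + a 0 * b 0 - 4 * δ * (a 0 * b 0))
    (fun i => discElement (e 0) (f 0) * e i.succ)
    (fun i => c 0 • (discElement (e 0) (f 0) * f i.succ))
    (w + e 0 * f 0 - (w * (e 0 * f 0) + w * (e 0 * f 0))) := by
  have hd := h.disc 0
  have he := h.commute_zero_left
  have hf := h.commute_zero_right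
  have hw := h.commute_mul 0
  have hDw := QuaternionPair.commute_discElement hw
  have hDW : Commute (discElement (e 0) (f 0)) (e 0 * f 0) :=
    QuaternionPair.commute_discElement (Commute.refl _)
  have hDw' : Commute (discElement (e 0) (f 0))
      (w + e 0 * f 0 - (w * (e 0 * f 0) + w * (e 0 * f 0))) :=
    (hDw.add_right hDW).sub_right ((hDw.mul_right hDW).add_right (hDw.mul_right hDW))
  -- With `W = e 0 * f 0`, the new element `w' = w + W - 2wW` satisfies `1 - 2w' = (1 - 2w)(1 -
  -- 2W)`, but its formula keeps its content in characteristic 2. An `x` that turns `w` into `1 - w`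
  -- and commutes with `W` turns `w'` into `1 - w'`.
  have hcomm : ∀ x, x * w = (1 - w) * x → Commute (e 0 * f 0) x →
      x * (w + e 0 * f 0 - (w * (e 0 * f 0) + w * (e 0 * f 0))) =
      (1 - (w + e 0 * f 0 - (w * (e 0 * f 0) + w * (e 0 * f 0)))) * x := by
    intro x hx hWx
    have h1 : x * (w * (e 0 * f 0)) = (1 - w) * (e 0 * f 0) * x := by
      rw [← mul_assoc, hx, mul_assoc, ← hWx.eq, mul_assoc (1 - w)]
    rw [mul_sub, mul_add, mul_add, h1, hx, ← hWx.eq]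
    noncomm_ring
  refine ⟨fun i => ⟨?_, ?_, ?_⟩, fun i => ?_, fun i j hij => ?_, fun i j hij => ?_,
    fun i j hij => ?_, fun i => ?_, fun i => ?_, ?_, ?_⟩
  · rw [h.disc_mul (he i), (h.pair i.succ).sq_left, smul_smul]
  · rw [smul_mul_smul_comm, h.disc_mul (hf i), (h.pair i.succ).sq_right, smul_smul, smul_smul]
    congr 1
    linear_combination c 0 * b i.succ * hd
  · rw [smul_mul_assoc, mul_smul_comm, h.disc_mul (hf i), h.disc_mul (he i), smul_smul, smul_smul,
      hd, one_smul, one_smul, (h.pair i.succ).swap]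
  · linear_combination h.disc i.succ - c i.succ * 4 * a i.succ * b i.succ * hd
  · have hij' : i.succ ≠ j.succ := by simpa using hij
    rw [h.disc_mul (he i), h.disc_mul (he j), h.left_left _ _ hij', smul_neg]
  · have hij' : i.succ ≠ j.succ := by simpa using hij
    rw [mul_smul_comm, smul_mul_assoc, h.disc_mul (he i), h.disc_mul (hf j),
      h.left_right _ _ hij', smul_neg, smul_neg]
  · have hij' : i.succ ≠ j.succ := by simpa using hij
    rw [smul_mul_smul_comm, smul_mul_smul_comm, h.disc_mul (hf i), h.disc_mul (hf j),
      h.right_right _ _ hij', smul_neg, smul_neg]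
  · rw [mul_assoc, hcomm _ (h.left_mul _) (he i)]
    exact ((Commute.one_right _).sub_right hDw').left_comm _
  · rw [smul_mul_assoc, mul_smul_comm, mul_assoc, hcomm _ (h.right_mul _) (hf i)]
    congr 1
    exact ((Commute.one_right _).sub_right hDw').left_comm _
  · have h1 : e 0 * f 0 * (e 0 * f 0) = e 0 * f 0 - (a 0 * b 0) • (1 : A) := by
      have hp := h.pair 0
      simp only [mul_assoc, hp.swap_mul, mul_sub, hp.sq_left, hp.sq_right, mul_smul_comm,
        mul_one, smul_smul, mul_comm (b 0)]
    have h2 : e 0 * f 0 * w = w * (e 0 * f 0) := hw.eq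
    have h3 := h.mul_self
    generalize e 0 * f 0 = W at *
    have h2' : ∀ y, W * (w * y) = w * (W * y) := fun y => by
      rw [← mul_assoc, h2, mul_assoc]
    have h3' : ∀ y, w * (w * y) = w * y - δ • y := fun y => by
      rw [← mul_assoc, h3, sub_mul, smul_mul_assoc, one_mul]
    simp only [mul_add, add_mul, mul_sub, sub_mul, mul_assoc, h1, h2, h3, h2', h3',
      mul_smul_comm, mul_one, smul_sub]
    module
  -- Discriminants multiply.
  · have h1 : (1 : R) - 4 * (δ + a 0 * b 0 - 4 * δ * (a 0 * b 0)) =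
        (1 - 4 * δ) * (1 - 4 * a 0 * b 0) := by ring
    rw [h1]
    exact h.isUnit.mul (IsUnit.of_mul_eq_one _ (by rw [mul_comm]; exact hd))

/-- Both `discElement` and the later generators anticommute with the first pair, and the two signs
cancel. -/
theorem zero_commute_tail (i : Fin k) :
    (Commute (e 0) (discElement (e 0) (f 0) * e i.succ) ∧
      Commute (f 0) (discElement (e 0) (f 0) * e i.succ)) ∧
    (Commute (e 0) (c 0 • (discElement (e 0) (f 0) * f i.succ)) ∧
      Commute (f 0) (c 0 • (discElement (e 0) (f 0) * f i.succ))) := by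
  have h0 := Fin.succ_ne_zero i
  have key : ∀ x y : A, x * discElement (e 0) (f 0) = -(discElement (e 0) (f 0) * x) →
      x * y = -(y * x) → Commute x (discElement (e 0) (f 0) * y) := by
    intro x y h1 h2
    change _ * _ = _ * _
    rw [← mul_assoc, h1, neg_mul, mul_assoc, h2, mul_neg, neg_neg, mul_assoc]
  have hl := (h.pair 0).left_mul_discElement
  have hr := (h.pair 0).right_mul_discElement
  exact ⟨⟨key _ _ hl (h.left_left _ _ h0.symm), key _ _ hr (h.right_left _ _ h0.symm)⟩,
    (key _ _ hl (h.left_right _ _ h0.symm)).smul_right _,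
    (key _ _ hr (h.right_right _ _ h0.symm)).smul_right _⟩

/-- Moving `e 0` or `f 0` past `w` and `W = e 0 * f 0` replaces them by `1 - w` and `1 - W`, and `w
+ W - 2wW` is invariant under this double replacement. -/
theorem zero_commute_tail_central :
    Commute (e 0) (w + e 0 * f 0 - (w * (e 0 * f 0) + w * (e 0 * f 0))) ∧
      Commute (f 0) (w + e 0 * f 0 - (w * (e 0 * f 0) + w * (e 0 * f 0))) := by
  have key : ∀ x, x * w = (1 - w) * x → x * (e 0 * f 0) = (1 - e 0 * f 0) * x →
      Commute x (w + e 0 * f 0 - (w * (e 0 * f 0) + w * (e 0 * f 0))) := by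
    intro x h1 h2
    change _ * _ = _ * _
    have h3 : x * (w * (e 0 * f 0)) = (1 - w) * (1 - e 0 * f 0) * x := by
      rw [← mul_assoc, h1, mul_assoc, h2, mul_assoc (1 - w)]
    rw [mul_sub, mul_add, mul_add, h3, h1, h2]
    noncomm_ring
  have hp := h.pair 0
  refine ⟨key _ (h.left_mul 0) ?_, key _ (h.right_mul 0) ?_⟩
  · rw [sub_mul, one_mul, mul_assoc, hp.swap, mul_sub, mul_one, hp.sq_left_mul, sub_sub_cancel]
  · rw [sub_mul, one_mul, hp.swap_mul, mul_assoc]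

end CliffordSystem

/-- Induction through `tail`: the first pair is kept and the rest is untwisted. Since `discElement`
is negated by an involution acting on the pairs through a sign, each step reverses the sign on the
later pairs and exchanges the cases `w ↦ w` and `w ↦ 1 - w`; this produces `(-1)^i` and the parity
of `p + k`. -/
theorem CliffordSystem.exists_quaternionSystem {k : ℕ} {a b c : Fin k → R} {δ : R}
    {e f : Fin k → A} {w : A} (h : CliffordSystem a b c δ e f w) :
    ∃ (α β γ : Fin k → R) (E F : Fin k → A) (ω : A) (δ' : R),
      QuaternionSystem α β γ E F ∧ (∀ i, Commute (E i) ω ∧ Commute (F i) ω) ∧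
      ω * ω = ω - δ' • (1 : A) ∧ IsUnit (1 - 4 * δ') ∧
      (∀ i : Fin k, (i : ℕ) = 0 → (α i = a i ∧ β i = b i) ∧ E i = e i ∧ F i = f i) ∧
      Algebra.adjoin R (Set.range e ∪ Set.range f ∪ {w}) =
        Algebra.adjoin R (Set.range E ∪ Set.range F ∪ {ω}) ∧
      ∀ (σ : Involution R A) (s : R), s * s = 1 →
        (∀ i, σ.toLin (e i) = s • e i ∧ σ.toLin (f i) = s • f i) →
        (∀ i, σ.toLin (E i) = ((-1) ^ (i : ℕ) * s) • E i ∧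
          σ.toLin (F i) = ((-1) ^ (i : ℕ) * s) • F i) ∧
        ∀ p : ℕ, σ.toLin w = (if Even p then w else 1 - w) →
          σ.toLin ω = if Even (p + k) then ω else 1 - ω := by
  induction k generalizing δ w with
  | zero =>
    exact ⟨a, b, c, e, f, w, δ, ⟨h.pair, h.disc, fun i => i.elim0, fun i => i.elim0,
      fun i => i.elim0⟩, fun i => i.elim0, h.mul_self, h.isUnit, fun i => i.elim0, rfl,
      fun σ s _ _ => ⟨fun i => i.elim0, fun p hp => hp⟩⟩
  | succ k ih =>
    obtain ⟨α, β, γ, E, F, ω, δ', hsys, hω, hωω, hδ', -, hadj, hσ⟩ := ih h.tail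
    have hp := h.pair 0
    set D := discElement (e 0) (f 0) with hD
    set w' := w + e 0 * f 0 - (w * (e 0 * f 0) + w * (e 0 * f 0)) with hw'
    have hcent : ∀ x ∈ Algebra.adjoin R (Set.range E ∪ Set.range F ∪ {ω}),
        Commute (e 0) x ∧ Commute (f 0) x := by
      intro x hx
      rw [← hadj] at hx
      have h1 : x ∈ Subalgebra.centralizer R {e 0, f 0} := by
        refine Algebra.adjoin_le (S := Subalgebra.centralizer R {e 0, f 0}) ?_ hx
        rintro v ((⟨i, rfl⟩ | ⟨i, rfl⟩) | rfl) <;>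
          refine (Subalgebra.mem_centralizer_iff R).2 ?_ <;> rintro y (rfl | rfl)
        · exact (h.zero_commute_tail i).1.1
        · exact (h.zero_commute_tail i).1.2
        · exact (h.zero_commute_tail i).2.1
        · exact (h.zero_commute_tail i).2.2
        · exact h.zero_commute_tail_central.1
        · exact h.zero_commute_tail_central.2
      exact ⟨(Subalgebra.mem_centralizer_iff R).1 h1 _ (by simp),
        (Subalgebra.mem_centralizer_iff R).1 h1 _ (by simp)⟩
    have hE : ∀ i, Commute (e 0) (E i) ∧ Commute (f 0) (E i) := fun i =>
      hcent _ (Algebra.subset_adjoin (.inl (.inl ⟨i, rfl⟩)))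
    have hF : ∀ i, Commute (e 0) (F i) ∧ Commute (f 0) (F i) := fun i =>
      hcent _ (Algebra.subset_adjoin (.inl (.inr ⟨i, rfl⟩)))
    have hω0 := hcent ω (Algebra.subset_adjoin (.inr rfl))
    refine ⟨Fin.cons (a 0) α, Fin.cons (b 0) β, Fin.cons (c 0) γ, Fin.cons (e 0) E,
      Fin.cons (f 0) F, ω, δ', ⟨?_, ?_, ?_, ?_, ?_⟩, ?_, hωω, hδ', ?_, ?_, ?_⟩
    · exact Fin.cases hp hsys.pair
    · exact Fin.cases (h.disc 0) hsys.disc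
    · refine Fin.cases (Fin.cases (fun h => absurd rfl h) fun j _ => ?_) fun i =>
        Fin.cases (fun _ => ?_) fun j hij => ?_
      · exact (hE j).1
      · exact (hE i).1.symm
      · exact hsys.left_left i j (by simpa using hij)
    · refine Fin.cases (Fin.cases (fun h => absurd rfl h) fun j _ => ?_) fun i =>
        Fin.cases (fun _ => ?_) fun j hij => ?_
      · exact (hF j).1
      · exact (hE i).2.symm
      · exact hsys.left_right i j (by simpa using hij)
    · refine Fin.cases (Fin.cases (fun h => absurd rfl h) fun j _ => ?_) fun i =>
        Fin.cases (fun _ => ?_) fun j hij => ?_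
      · exact (hF j).2
      · exact (hF i).2.symm
      · exact hsys.right_right i j (by simpa using hij)
    · exact Fin.cases hω0 hω
    · intro i hi
      obtain rfl : i = 0 := Fin.ext hi
      simp
    · have hsub : ∀ {S T : Set A} {i : Fin k → Fin (k + 1)}, S ⊆ T →
        (Algebra.adjoin R S : Set A) ⊆ Algebra.adjoin R T := fun h => Algebra.adjoin_mono h
      apply le_antisymm
      · set T := Algebra.adjoin R (Set.range (Fin.cons (e 0) E : Fin (k + 1) → A) ∪
          Set.range (Fin.cons (f 0) F : Fin (k + 1) → A) ∪ {ω}) with hT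
        have hle : Algebra.adjoin R (Set.range E ∪ Set.range F ∪ {ω}) ≤ T := by
          refine Algebra.adjoin_mono ?_
          rintro v ((⟨i, rfl⟩ | ⟨i, rfl⟩) | rfl)
          · exact .inl (.inl ⟨i.succ, by simp⟩)
          · exact .inl (.inr ⟨i.succ, by simp⟩)
          · exact .inr rfl
        have he0 : e 0 ∈ T := Algebra.subset_adjoin (.inl (.inl ⟨0, by simp⟩))
        have hf0 : f 0 ∈ T := Algebra.subset_adjoin (.inl (.inr ⟨0, by simp⟩))
        have hW : e 0 * f 0 ∈ T := mul_mem he0 hf0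
        have hDT : D ∈ T := sub_mem (one_mem T) (add_mem hW hW)
        rw [← hadj] at hle
        -- `D` is invertible with inverse `c 0 • D`, so the old generators are recovered from the
        -- new ones.
        have hDD : ∀ x, c 0 • (D * (D * x)) = x := fun x => by
          rw [← mul_assoc, hp.discElement_mul_self, smul_mul_assoc, one_mul, smul_smul, h.disc,
            one_smul]
        refine Algebra.adjoin_le ?_
        rintro v ((⟨i, rfl⟩ | ⟨i, rfl⟩) | hv)
        · refine Fin.cases he0 (fun i => ?_) i
          have h1 : D * e i.succ ∈ T := hle (Algebra.subset_adjoin (.inl (.inl ⟨i, rfl⟩)))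
          rw [← hDD (e i.succ)]
          exact T.smul_mem (mul_mem hDT h1) _
        · refine Fin.cases hf0 (fun i => ?_) i
          have h1 : c 0 • (D * f i.succ) ∈ T := hle (Algebra.subset_adjoin (.inl (.inr ⟨i, rfl⟩)))
          rw [← hDD (f i.succ), ← mul_smul_comm]
          exact mul_mem hDT h1
        · have h1 : w' ∈ T := hle (Algebra.subset_adjoin (.inr rfl))
          have h2 : D * w = w' - e 0 * f 0 := by
            rw [hD, hw', discElement, sub_mul, one_mul, add_mul, (h.commute_mul 0).eq]; abel
          rw [Set.mem_singleton_iff.1 hv, ← hDD w, h2]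
          exact T.smul_mem (mul_mem hDT (sub_mem h1 hW)) _
      · set T := Algebra.adjoin R (Set.range e ∪ Set.range f ∪ {w}) with hT
        have he : ∀ i, e i ∈ T := fun i => Algebra.subset_adjoin (.inl (.inl ⟨i, rfl⟩))
        have hf : ∀ i, f i ∈ T := fun i => Algebra.subset_adjoin (.inl (.inr ⟨i, rfl⟩))
        have hw : w ∈ T := Algebra.subset_adjoin (.inr rfl)
        have hW : e 0 * f 0 ∈ T := mul_mem (he 0) (hf 0)
        have hDT : D ∈ T := sub_mem (one_mem T) (add_mem hW hW)
        have hle : Algebra.adjoin R (Set.range E ∪ Set.range F ∪ {ω}) ≤ T := by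
          rw [← hadj]
          refine Algebra.adjoin_le ?_
          rintro v ((⟨i, rfl⟩ | ⟨i, rfl⟩) | rfl)
          · exact mul_mem hDT (he _)
          · exact T.smul_mem (mul_mem hDT (hf _)) _
          · exact sub_mem (add_mem hw hW) (add_mem (mul_mem hw hW) (mul_mem hw hW))
        refine Algebra.adjoin_le ?_
        rintro v ((⟨i, rfl⟩ | ⟨i, rfl⟩) | rfl)
        · refine Fin.cases (he 0) (fun i => ?_) i
          exact hle (Algebra.subset_adjoin (.inl (.inl ⟨i, rfl⟩)))
        · refine Fin.cases (hf 0) (fun i => ?_) i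
          exact hle (Algebra.subset_adjoin (.inl (.inr ⟨i, rfl⟩)))
        · exact hle (Algebra.subset_adjoin (.inr rfl))
    · intro σ s hs hσe
      have hσW : σ.toLin (e 0 * f 0) = 1 - e 0 * f 0 := by
        rw [σ.map_mul', (hσe 0).1, (hσe 0).2, smul_mul_smul_comm, hs, one_smul, hp.swap]
      have hσD : σ.toLin D = -D := by
        rw [hD, discElement, map_sub, σ.toLin_one, map_add, hσW]; abel
      -- `σ` negates `D`, so it acts on the tail by `-s`.
      have h1 := hσ σ (-s) (by rw [neg_mul_neg, hs]) (fun i => by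
        refine ⟨?_, ?_⟩
        · rw [σ.map_mul', hσD, (hσe i.succ).1, smul_mul_assoc, mul_neg, smul_neg, neg_smul,
            (QuaternionPair.commute_discElement (h.commute_zero_left i)).eq]
        · rw [map_smul, σ.map_mul', hσD, (hσe i.succ).2, smul_mul_assoc, mul_neg, smul_neg,
            neg_smul, (QuaternionPair.commute_discElement (h.commute_zero_right i)).eq, smul_neg,
            smul_comm])
      refine ⟨?_, ?_⟩
      · refine Fin.cases (by simpa using hσe 0) fun i => ?_
        have h2 : (-1 : R) ^ ((i.succ : Fin (k + 1)) : ℕ) * s = (-1) ^ (i : ℕ) * -s := by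
          rw [Fin.val_succ, pow_succ]; ring
        rw [h2]
        simpa using h1.1 i
      · intro p hpw
        -- As `σ` sends `e 0 * f 0` to its complement to `1`, the behaviour of the third element
        -- changes parity.
        have h2 := h1.2 (p + 1) (by
          have h3 := (h.commute_mul 0).eq
          rw [hw', map_sub, map_add, map_add, σ.map_mul' w, hσW, hpw]
          by_cases h4 : Even p
          · rw [if_pos h4, if_neg (by simpa [Nat.even_add_one] using h4), sub_mul, one_mul, h3]
            noncomm_ring
          · rw [if_neg h4, if_pos (by simpa [Nat.even_add_one] using h4), sub_mul, one_mul, mul_sub,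
              mul_one, h3]
            noncomm_ring)
        rwa [show p + 1 + k = p + (k + 1) by ring] at h2

end Untwist

/-! ### Decomposition of quadratic spaces into planes -/

section Planes

open QuadraticMap Module

variable {F : Type*} [Field F] {V : Type*} [AddCommGroup V] [Module F V]

/-- `e`, `f` span a nonsingular plane, and `b(e, f) = 1`. -/
structure IsPlane (q : QuadraticForm F V) (e f : V) : Prop where
  polar_eq : polar q e f = 1
  disc : 1 - 4 * q e * q f ≠ 0

theorem polar_self_eq (q : QuadraticForm F V) (x : V) : polar q x x = 2 * q x := by
  rw [polar_self]; simp

/-- The orthogonal complement of the plane spanned by `e` and `f`. -/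
def planeOrthogonal (q : QuadraticForm F V) (e f : V) : Submodule F V :=
  LinearMap.ker ((polarBilin q e).prod (polarBilin q f))

theorem mem_planeOrthogonal {q : QuadraticForm F V} {e f x : V} :
    x ∈ planeOrthogonal q e f ↔ polar q e x = 0 ∧ polar q f x = 0 := by
  simp [planeOrthogonal]

theorem polar_restrict (q : QuadraticForm F V) (W : Submodule F V) (x y : W) :
    polar (q.comp W.subtype) x y = polar q (x : V) y := by
  simp [polar]

namespace IsPlane

variable {q : QuadraticForm F V} {e f : V} (h : IsPlane q e f)
include h

/-- The coefficients solve the linear system of the Gram matrix of the plane, whose determinant is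
`4 q(e) q(f) - 1`. -/
theorem exists_sub_mem (x : V) : ∃ α β : F, x - (α • e + β • f) ∈ planeOrthogonal q e f := by
  have hd := mul_inv_cancel₀ h.disc
  refine ⟨(polar q f x - 2 * q f * polar q e x) * (1 - 4 * q e * q f)⁻¹,
    (polar q e x - 2 * q e * polar q f x) * (1 - 4 * q e * q f)⁻¹, ?_⟩
  rw [mem_planeOrthogonal, polar_sub_right, polar_add_right, polar_smul_right, polar_smul_right,
    polar_sub_right, polar_add_right, polar_smul_right, polar_smul_right, polar_self_eq,
    polar_self_eq, polar_comm q f e, h.polar_eq]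
  simp only [smul_eq_mul]
  constructor
  · linear_combination -polar q e x * hd
  · linear_combination -polar q f x * hd

theorem nondegenerate_planeOrthogonal (hq : ∀ x, (∀ y, polar q x y = 0) → x = 0) :
    ∀ x, (∀ y, polar (q.comp (planeOrthogonal q e f).subtype) x y = 0) → x = 0 := by
  intro x hx
  refine Subtype.ext (hq x fun y => ?_)
  obtain ⟨α, β, hy⟩ := h.exists_sub_mem y
  have h1 := hx ⟨_, hy⟩
  rw [polar_restrict] at h1
  have h2 := mem_planeOrthogonal.1 x.2
  rw [polar_comm q e, polar_comm q f] at h2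
  simpa [polar_sub_right, polar_add_right, polar_smul_right, h2.1, h2.2] using h1

theorem finrank_planeOrthogonal [FiniteDimensional F V] :
    finrank F (planeOrthogonal q e f) + 2 = finrank F V := by
  have hr : LinearMap.range ((polarBilin q e).prod (polarBilin q f)) = ⊤ := by
    rw [eq_top_iff]
    rintro ⟨s, t⟩ -
    refine ⟨((t - 2 * q f * s) * (1 - 4 * q e * q f)⁻¹) • e +
      ((s - 2 * q e * t) * (1 - 4 * q e * q f)⁻¹) • f, ?_⟩
    have hd := mul_inv_cancel₀ h.disc
    refine Prod.ext ?_ ?_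
    · change polar q e _ = s
      simp only [polar_add_right, polar_smul_right, polar_self_eq, h.polar_eq, smul_eq_mul]
      linear_combination s * hd
    · change polar q f _ = t
      simp only [polar_add_right, polar_smul_right, polar_self_eq, polar_comm q f e, h.polar_eq,
        smul_eq_mul]
      linear_combination t * hd
  have h1 := LinearMap.finrank_range_add_finrank_ker ((polarBilin q e).prod (polarBilin q f))
  rw [hr, finrank_top, finrank_prod, finrank_self] at h1
  rw [planeOrthogonal]
  omega

end IsPlane

theorem exists_ne_zero_of_nondegenerate {q : QuadraticForm F V}
    (hq : ∀ x, (∀ y, polar q x y = 0) → x = 0) [Nontrivial V] : ∃ x, q x ≠ 0 := by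
  by_contra! hc
  obtain ⟨x, hx⟩ := exists_ne (0 : V)
  exact hx (hq x fun y => by simp [polar, hc])

theorem exists_polar_eq_one {q : QuadraticForm F V}
    (hq : ∀ x, (∀ y, polar q x y = 0) → x = 0) {x : V} (hx : x ≠ 0) : ∃ y, polar q x y = 1 := by
  obtain ⟨y, hy⟩ : ∃ y, polar q x y ≠ 0 := by
    by_contra! hc
    exact hx (hq x hc)
  exact ⟨(polar q x y)⁻¹ • y, by rw [polar_smul_right, smul_eq_mul, inv_mul_cancel₀ hy]⟩

/-- Start from an anisotropic `x`. In characteristic 2 any `y` with `b(x,y) = 1` will do, since the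
discriminant is `1`. Otherwise an anisotropic `u` orthogonal to `x` is found and shifted by a
multiple of `x`. -/
theorem exists_isPlane {q : QuadraticForm F V} (hq : ∀ x, (∀ y, polar q x y = 0) → x = 0)
    (hV : 1 < finrank F V) : ∃ e f, q e ≠ 0 ∧ IsPlane q e f := by
  have : Nontrivial V := nontrivial_of_finrank_pos (R := F) (by omega)
  obtain ⟨x, hx⟩ := exists_ne_zero_of_nondegenerate hq
  have hx0 : x ≠ 0 := by rintro rfl; simp at hx
  by_cases h2 : (2 : F) = 0
  · obtain ⟨y, hy⟩ := exists_polar_eq_one hq hx0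
    refine ⟨x, y, hx, hy, ?_⟩
    rw [show (4 : F) = 2 * 2 by norm_num, h2]
    simp
  · have hdec : ∀ y, polar q x (y - (polar q x y / (2 * q x)) • x) = 0 := by
      intro y
      rw [polar_sub_right, polar_smul_right, polar_self_eq, smul_eq_mul]
      field_simp
      ring
    -- Otherwise `q`, and with it the polar form, would vanish on the orthogonal complement of `x`,
    -- and a nonzero vector of this complement would lie in the radical.
    obtain ⟨u, hxu, hu⟩ : ∃ u, polar q x u = 0 ∧ q u ≠ 0 := by
      by_contra! hc
      obtain ⟨y, hy⟩ : ∃ y, y ∉ Submodule.span F {x} := by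
        by_contra! hc
        have h1 : Submodule.span F {x} = ⊤ := eq_top_iff.2 fun y _ => hc y
        have h3 := finrank_span_singleton (K := F) hx0
        rw [h1, finrank_top] at h3
        omega
      set z := y - (polar q x y / (2 * q x)) • x with hz
      have hz0 : z ≠ 0 := fun h0 => hy (by
        rw [sub_eq_zero.1 h0]
        exact Submodule.smul_mem _ _ (Submodule.mem_span_singleton_self x))
      refine hz0 (hq z fun w => ?_)
      have h4 : polar q z (w - (polar q x w / (2 * q x)) • x) = 0 := by
        rw [polar, hc _ (by rw [polar_add_right, hdec, hdec, add_zero]), hc _ (hdec _),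
          hc _ (hdec _)]
        simp
      rwa [polar_sub_right, polar_smul_right, polar_comm q z x, hdec, smul_zero, sub_zero] at h4
    -- The multiple of `x` makes the polar value `1`; the discriminant becomes `-4 q(x) q(u)`.
    refine ⟨x, u + (2 * q x)⁻¹ • x, hx, ?_, ?_⟩
    · rw [polar_add_right, hxu, polar_smul_right, polar_self_eq, smul_eq_mul, zero_add]
      field_simp
    · rw [QuadraticMap.map_add (⇑q), polar_smul_right, polar_comm, hxu, q.map_smul]
      have h3 : 1 - 4 * q x * (q u + (2 * q x)⁻¹ * (2 * q x)⁻¹ * q x + 0) =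
          -(2 * 2 * q x * q u) := by
        field_simp; ring
      simp only [smul_eq_mul, mul_zero]
      rw [h3]
      exact neg_ne_zero.2 (mul_ne_zero (mul_ne_zero (mul_ne_zero h2 h2) hx) hu)

/-- The pairs `(e i, f i)` span pairwise orthogonal nonsingular planes. -/
structure IsPlaneSystem {k : ℕ} (q : QuadraticForm F V) (e f : Fin k → V) : Prop where
  isPlane : ∀ i, IsPlane q (e i) (f i)
  left_left : ∀ i j, i ≠ j → polar q (e i) (e j) = 0
  left_right : ∀ i j, i ≠ j → polar q (e i) (f j) = 0
  right_right : ∀ i j, i ≠ j → polar q (f i) (f j) = 0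

theorem IsPlaneSystem.cons {k : ℕ} {q : QuadraticForm F V} {e f : V} (h : IsPlane q e f)
    {e' f' : Fin k → planeOrthogonal q e f}
    (h' : IsPlaneSystem (q.comp (planeOrthogonal q e f).subtype) e' f') :
    IsPlaneSystem q (Fin.cons e fun i => (e' i : V)) (Fin.cons f fun i => (f' i : V)) := by
  have he := fun i => mem_planeOrthogonal.1 (e' i).2
  have hf := fun i => mem_planeOrthogonal.1 (f' i).2
  refine ⟨?_, ?_, ?_, ?_⟩
  · refine Fin.cases h fun i => ⟨?_, ?_⟩
    · exact (polar_restrict q _ _ _).symm.trans (h'.isPlane i).polar_eq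
    · exact (h'.isPlane i).disc
  · refine Fin.cases (Fin.cases (fun h => absurd rfl h) fun j _ => (he j).1) fun i =>
      Fin.cases (fun _ => ?_) fun j hij => ?_
    · exact (polar_comm _ _ _).trans (he i).1
    · exact (polar_restrict q _ _ _).symm.trans (h'.left_left i j (by simpa using hij))
  · refine Fin.cases (Fin.cases (fun h => absurd rfl h) fun j _ => (hf j).1) fun i =>
      Fin.cases (fun _ => ?_) fun j hij => ?_
    · exact (polar_comm _ _ _).trans (he i).2
    · exact (polar_restrict q _ _ _).symm.trans (h'.left_right i j (by simpa using hij))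
  · refine Fin.cases (Fin.cases (fun h => absurd rfl h) fun j _ => (hf j).2) fun i =>
      Fin.cases (fun _ => ?_) fun j hij => ?_
    · exact (polar_comm _ _ _).trans (hf i).2
    · exact (polar_restrict q _ _ _).symm.trans (h'.right_right i j (by simpa using hij))

theorem span_cons {k : ℕ} {q : QuadraticForm F V} {e f : V} (h : IsPlane q e f)
    {e' f' : Fin k → planeOrthogonal q e f}
    (h' : Submodule.span F (Set.range e' ∪ Set.range f') = ⊤) :
    Submodule.span F (Set.range (Fin.cons e fun i => (e' i : V) : Fin (k + 1) → V) ∪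
      Set.range (Fin.cons f fun i => (f' i : V) : Fin (k + 1) → V)) = ⊤ := by
  rw [eq_top_iff]
  intro x _
  obtain ⟨α, β, hx⟩ := h.exists_sub_mem x
  set S := Submodule.span F (Set.range (Fin.cons e fun i => (e' i : V) : Fin (k + 1) → V) ∪
      Set.range (Fin.cons f fun i => (f' i : V) : Fin (k + 1) → V))
  have h1 : (planeOrthogonal q e f) ≤ S := by
    have h2 : (⊤ : Submodule F (planeOrthogonal q e f)) ≤
        S.comap (planeOrthogonal q e f).subtype := by
      rw [← h', Submodule.span_le]
      rintro v (⟨i, rfl⟩ | ⟨i, rfl⟩)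
      · exact Submodule.subset_span (.inl ⟨i.succ, by simp⟩)
      · exact Submodule.subset_span (.inr ⟨i.succ, by simp⟩)
    exact fun y hy => h2 (Submodule.mem_top (x := ⟨y, hy⟩))
  have h3 := h1 hx
  rw [← sub_add_cancel x (α • e + β • f)]
  exact add_mem h3 (add_mem
    (S.smul_mem _ (Submodule.subset_span (.inl ⟨0, by simp⟩)))
    (S.smul_mem _ (Submodule.subset_span (.inr ⟨0, by simp⟩))))

universe v

theorem exists_isPlaneSystem (k : ℕ) : ∀ {V : Type v} [AddCommGroup V] [Module F V]
    [FiniteDimensional F V] (q : QuadraticForm F V), (∀ x, (∀ y, polar q x y = 0) → x = 0) →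
    finrank F V = 2 * k → ∃ e f : Fin k → V, IsPlaneSystem q e f ∧
      Submodule.span F (Set.range e ∪ Set.range f) = ⊤ := by
  induction k with
  | zero =>
    intro V _ _ _ q hq hV
    have := finrank_zero_iff.1 (show finrank F V = 0 by simpa using hV)
    refine ⟨fun i => i.elim0, fun i => i.elim0, ⟨fun i => i.elim0, fun i => i.elim0,
      fun i => i.elim0, fun i => i.elim0⟩, Subsingleton.elim _ _⟩
  | succ k ih =>
    intro V _ _ _ q hq hV
    obtain ⟨e, f, -, h⟩ := exists_isPlane hq (by omega)
    have h1 := h.finrank_planeOrthogonal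
    obtain ⟨e', f', h', hs⟩ := ih _ (h.nondegenerate_planeOrthogonal hq) (by omega)
    exact ⟨_, _, h'.cons h, span_cons h hs⟩

theorem exists_hyperbolic {q : QuadraticForm F V}
    (hq : ∀ x, (∀ y, polar q x y = 0) → x = 0) (hiso : ¬ q.Anisotropic) :
    ∃ e f, q e = 0 ∧ q f = 0 ∧ IsPlane q e f := by
  obtain ⟨e, he, he0⟩ : ∃ e, q e = 0 ∧ e ≠ 0 := by
    simpa [QuadraticMap.Anisotropic] using hiso
  obtain ⟨f, hf⟩ := exists_polar_eq_one hq he0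
  refine ⟨e, f - q f • e, he, ?_, ?_, by rw [he]; simp⟩
  · rw [sub_eq_add_neg, QuadraticMap.map_add (⇑q), QuadraticMap.map_neg, QuadraticMap.map_smul, he,
      polar_neg_right, polar_smul_right, polar_comm, hf]
    simp
  · rw [polar_sub_right, polar_smul_right, polar_self_eq, he, hf]; simp

/-- A nonsingular isotropic form of dimension `2 (k + 2)` has a decomposition into planes,
the first of which contains an anisotropic vector, and the second of which is hyperbolic. -/
theorem exists_isotropic_decomposition {k : ℕ} {V : Type v} [AddCommGroup V] [Module F V]
    [FiniteDimensional F V] (q : QuadraticForm F V) (hq : ∀ x, (∀ y, polar q x y = 0) → x = 0)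
    (hiso : ¬ q.Anisotropic) (hV : finrank F V = 2 * (k + 2)) :
    ∃ (v v' : V) (e f : Fin (k + 1) → V), q v ≠ 0 ∧ IsPlane q v v' ∧ IsPlaneSystem q e f ∧
      (∀ i, (e i ∈ planeOrthogonal q v v' ∧ f i ∈ planeOrthogonal q v v')) ∧
      q (e 0) = 0 ∧ q (f 0) = 0 ∧
      Submodule.span F ({v, v'} ∪ (Set.range e ∪ Set.range f)) = ⊤ := by
  obtain ⟨e₀, f₀, he₀, hf₀, h₀⟩ := exists_hyperbolic hq hiso
  have h1 := h₀.finrank_planeOrthogonal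
  have hq1 := h₀.nondegenerate_planeOrthogonal hq
  obtain ⟨v, v', hv, hp⟩ := exists_isPlane hq1 (by omega)
  have h2 := hp.finrank_planeOrthogonal
  obtain ⟨e', f', h', hs⟩ := exists_isPlaneSystem k _ (hp.nondegenerate_planeOrthogonal hq1)
    (by omega)
  have h3 := h'.cons hp
  have h4 := h3.cons h₀
  have hs1 := span_cons h₀ (span_cons hp hs)
  -- In the combined system plane `0` is the hyperbolic one and plane `1` is `(v, v')`. Deleting
  -- index `1` with `succAbove` leaves the hyperbolic plane at index `0`.
  set e₂ : Fin (k + 2) → V := Fin.cons e₀ fun i =>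
    ((Fin.cons v fun i => (e' i : planeOrthogonal q e₀ f₀) :
      Fin (k + 1) → planeOrthogonal q e₀ f₀) i : V) with he₂
  set f₂ : Fin (k + 2) → V := Fin.cons f₀ fun i =>
    ((Fin.cons v' fun i => (f' i : planeOrthogonal q e₀ f₀) :
      Fin (k + 1) → planeOrthogonal q e₀ f₀) i : V) with hf₂
  have hev : e₂ 1 = v := rfl
  have hfv : f₂ 1 = v' := rfl
  have he0 : e₂ 0 = e₀ := rfl
  have hf0 : f₂ 0 = f₀ := rfl
  clear_value e₂ f₂
  have hne : ∀ i, (1 : Fin (k + 2)).succAbove i ≠ 1 := fun i => Fin.succAbove_ne 1 i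
  have hzero : (1 : Fin (k + 2)).succAbove 0 = 0 := rfl
  refine ⟨e₂ 1, f₂ 1, fun i => e₂ ((1 : Fin (k + 2)).succAbove i),
    fun i => f₂ ((1 : Fin (k + 2)).succAbove i), ?_, h4.isPlane 1, ?_, fun i => ⟨?_, ?_⟩, ?_, ?_, ?_⟩
  · rw [hev]; exact hv
  · exact ⟨fun i => h4.isPlane _,
      fun i j hij => h4.left_left _ _ (by simpa using hij),
      fun i j hij => h4.left_right _ _ (by simpa using hij),
      fun i j hij => h4.right_right _ _ (by simpa using hij)⟩
  · exact mem_planeOrthogonal.2 ⟨h4.left_left _ _ (hne i).symm,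
      (polar_comm _ _ _).trans (h4.left_right _ _ (hne i))⟩
  · exact mem_planeOrthogonal.2 ⟨h4.left_right _ _ (hne i).symm, h4.right_right _ _ (hne i).symm⟩
  · simp only [hzero, he0, he₀]
  · simp only [hzero, hf0, hf₀]
  · rw [eq_top_iff, ← hs1, Submodule.span_le]
    rintro x (⟨i, rfl⟩ | ⟨i, rfl⟩)
    · rcases eq_or_ne i 1 with rfl | hi
      · exact Submodule.subset_span (.inl (by simp))
      · obtain ⟨j, rfl⟩ := Fin.exists_succAbove_eq hi
        exact Submodule.subset_span (.inr (.inl ⟨j, rfl⟩))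
    · rcases eq_or_ne i 1 with rfl | hi
      · exact Submodule.subset_span (.inl (by simp))
      · obtain ⟨j, rfl⟩ := Fin.exists_succAbove_eq hi
        exact Submodule.subset_span (.inr (.inr ⟨j, rfl⟩))

end Planes

/-! ### The Clifford algebra of the adjoint quadratic pair -/

section AdjointClifford

open QuadraticMap

variable {F : Type*} {V : Type*} [Field F] [AddCommGroup V] [Module F V]

/-- The terms at `(i, j)` and `(j, i)` cancel. The diagonal is required to vanish separately, which
matters in characteristic 2. -/
theorem sum_eq_zero_of_alternating {ι M : Type*} [Fintype ι] [AddCommGroup M] (g : ι → ι → M)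
    (h0 : ∀ i, g i i = 0) (h1 : ∀ i j, g i j + g j i = 0) : ∑ i, ∑ j, g i j = 0 := by
  classical
  rw [← Fintype.sum_prod_type']
  refine Finset.sum_involution (fun p _ => p.swap) (fun p _ => h1 p.1 p.2) ?_ (by simp) (by simp)
  rintro ⟨i, j⟩ _ hne heq
  obtain rfl : j = i := congrArg Prod.fst heq
  exact hne (h0 _)

section RankOne

variable (q : QuadraticForm F V)

theorem rankOne_add_left (x x' y : V) : rankOne q (x + x') y = rankOne q x y + rankOne q x' y :=
  LinearMap.ext fun z => by simp
theorem rankOne_add_right (x y y' : V) : rankOne q x (y + y') = rankOne q x y + rankOne q x y' :=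
  LinearMap.ext fun z => by simp [polar_add_left, add_smul]
theorem rankOne_smul_left (r : F) (x y : V) : rankOne q (r • x) y = r • rankOne q x y :=
  LinearMap.ext fun z => by simp [smul_comm r]
theorem rankOne_smul_right (r : F) (x y : V) : rankOne q x (r • y) = r • rankOne q x y :=
  LinearMap.ext fun z => by simp [polar_smul_left, mul_smul]

theorem mul_rankOne (g : Module.End F V) (x y : V) : g * rankOne q x y = rankOne q (g x) y :=
  LinearMap.ext fun z => by simp

theorem trace_rankOne [FiniteDimensional F V] (x y : V) :
    LinearMap.trace F V (rankOne q x y) = polar q y x := by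
  have h : rankOne q x y = (polarBilin q y).smulRight x := rfl
  rw [h, LinearMap.trace_smulRight]
  rfl

end RankOne

variable [FiniteDimensional F V] {q : QuadraticForm F V} (hq : Nonsingular q)

/-- A basis of `V`. -/
abbrev vBasis (F V : Type*) [Field F] [AddCommGroup V] [Module F V] [FiniteDimensional F V] :
    Module.Basis (Fin (Module.finrank F V)) F V := Module.finBasis F V

/-- The basis dual to `vBasis` for the polar form. -/
def wBasis : Module.Basis (Fin (Module.finrank F V)) F V :=
  LinearMap.BilinForm.dualBasis (polarBilin q) hq (vBasis F V)

include hq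

theorem polar_wBasis_vBasis (i j : Fin (Module.finrank F V)) :
    polar q (wBasis hq i) (vBasis F V j) = if j = i then 1 else 0 :=
  LinearMap.BilinForm.apply_dualBasis_left hq _ i j

theorem sum_polar_wBasis (x : V) : ∑ i, polar q (wBasis hq i) x • vBasis F V i = x := by
  conv_rhs => rw [← (vBasis F V).sum_repr x]
  refine Finset.sum_congr rfl fun i _ => ?_
  congr 1
  have h1 : polarBilin q (wBasis hq i) x =
      polarBilin q (wBasis hq i) (∑ j, (vBasis F V).repr x j • vBasis F V j) := by
    rw [(vBasis F V).sum_repr]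
  rw [polarBilin_apply_apply] at h1
  rw [h1, map_sum]
  simp [polar_wBasis_vBasis, -Module.Basis.sum_repr]

theorem sum_polar_vBasis (x : V) : ∑ i, polar q (vBasis F V i) x • wBasis hq i = x := by
  refine eq_of_polar hq fun y => ?_
  have h1 : polarBilin q (∑ i, polar q (vBasis F V i) x • wBasis hq i) y =
      ∑ i, polar q (vBasis F V i) x * polar q (wBasis hq i) y := by
    simp [map_sum, LinearMap.sum_apply]
  rw [polarBilin_apply_apply] at h1
  rw [h1]
  conv_rhs => rw [← sum_polar_wBasis hq y]
  have h2 : polarBilin q x (∑ i, polar q (wBasis hq i) y • vBasis F V i) =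
      ∑ i, polar q (wBasis hq i) y * polar q x (vBasis F V i) := by
    simp [map_sum]
  rw [polarBilin_apply_apply] at h2
  rw [h2]
  exact Finset.sum_congr rfl fun i _ => by rw [polar_comm q x, mul_comm]

theorem sum_rankOne (g : Module.End F V) :
    ∑ i, rankOne q (g (wBasis hq i)) (vBasis F V i) = g := by
  refine LinearMap.ext fun x => ?_
  conv_rhs => rw [← sum_polar_vBasis hq x]
  simp [LinearMap.sum_apply, map_sum]

theorem end_ext {M : Type*} [AddCommGroup M] [Module F M] {φ ψ : Module.End F V →ₗ[F] M}
    (h : ∀ x y, φ (rankOne q x y) = ψ (rankOne q x y)) : φ = ψ := by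
  refine LinearMap.ext fun g => ?_
  rw [← sum_rankOne hq g, map_sum, map_sum]
  exact Finset.sum_congr rfl fun i _ => h _ _

theorem sum_sum_rankOne (g : Module.End F V) :
    ∑ i, ∑ j, polar q (wBasis hq i) (g (wBasis hq j)) • rankOne q (vBasis F V i) (vBasis F V j) =
      g := by
  rw [Finset.sum_comm]
  conv_rhs => rw [← sum_rankOne hq g]
  refine Finset.sum_congr rfl fun j _ => ?_
  conv_rhs => rw [← sum_polar_wBasis hq (g (wBasis hq j))]
  refine LinearMap.ext fun x => ?_
  simp [LinearMap.sum_apply, Finset.smul_sum, smul_smul, mul_comm]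

theorem sum_sum_rankOne' (g : Module.End F V) :
    ∑ i, ∑ j, polar q (vBasis F V i) (g (vBasis F V j)) • rankOne q (wBasis hq i) (wBasis hq j) =
      g := by
  rw [Finset.sum_comm]
  refine LinearMap.ext fun x => ?_
  conv_rhs => rw [← sum_polar_wBasis hq x, map_sum]
  simp only [LinearMap.sum_apply, LinearMap.smul_apply, rankOne_apply, map_smul]
  refine Finset.sum_congr rfl fun j _ => ?_
  conv_rhs => rw [← sum_polar_vBasis hq (g (vBasis F V j))]
  rw [Finset.smul_sum]
  exact Finset.sum_congr rfl fun i _ => smul_comm _ _ _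

/-- Modulo the span of the `x ⊗ x`, the tensor `x ⊗ y` is alternating, while the coefficients of a
symmetric `s` in the basis `vᵢ ⊗ vⱼ` are symmetric; so `s` vanishes in the quotient. -/
theorem sym_eq_span : (adjointInvol hq).sym =
    Submodule.span F (Set.range fun x => rankOne q x x) := by
  apply le_antisymm
  · intro s hs
    set S := Submodule.span F (Set.range fun x => rankOne q x x)
    have hS : ∀ x, rankOne q x x ∈ S := fun x => Submodule.subset_span ⟨x, rfl⟩
    rw [← Submodule.Quotient.mk_eq_zero, ← Submodule.mkQ_apply, ← sum_sum_rankOne hq s, map_sum]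
    simp only [map_sum]
    refine sum_eq_zero_of_alternating _ (fun i => ?_) fun i j => ?_
    · rw [map_smul, Submodule.mkQ_apply, (Submodule.Quotient.mk_eq_zero S).2 (hS _), smul_zero]
    · have h1 : polar q (wBasis hq j) (s (wBasis hq i)) =
          polar q (wBasis hq i) (s (wBasis hq j)) := by
        have h2 : adjoint hq s = s := ((adjointInvol hq).mem_sym s).1 hs
        rw [← polar_adjoint hq, h2, polar_comm]
      rw [h1, ← map_add, ← smul_add, Submodule.mkQ_apply, Submodule.Quotient.mk_eq_zero]
      refine S.smul_mem _ ?_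
      have h3 := sub_mem (sub_mem (hS (vBasis F V i + vBasis F V j)) (hS (vBasis F V i)))
        (hS (vBasis F V j))
      rw [rankOne_add_left, rankOne_add_right, rankOne_add_right] at h3
      convert h3 using 1
      abel
  · rw [Submodule.span_le]
    rintro _ ⟨x, rfl⟩
    exact rankOne_self_mem_sym hq x

theorem sym_ext {M : Type*} [AddCommGroup M] [Module F M] {φ ψ : (adjointInvol hq).sym →ₗ[F] M}
    (h : ∀ x, φ ⟨_, rankOne_self_mem_sym hq x⟩ = ψ ⟨_, rankOne_self_mem_sym hq x⟩) : φ = ψ := by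
  refine LinearMap.ext fun s => ?_
  obtain ⟨s, hs⟩ := s
  have hs' := hs
  rw [sym_eq_span hq] at hs'
  induction hs' using Submodule.span_induction with
  | mem x hx => obtain ⟨x, rfl⟩ := hx; exact h x
  | zero => exact (map_zero φ).trans (map_zero ψ).symm
  | add x y hx hy h1 h2 =>
    rw [← sym_eq_span hq] at hx hy
    have h3 : (⟨x + y, hs⟩ : (adjointInvol hq).sym) = ⟨x, hx⟩ + ⟨y, hy⟩ := rfl
    rw [h3, map_add, map_add, h1 hx, h2 hy]
  | smul r x hx h1 =>
    rw [← sym_eq_span hq] at hx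
    have h3 : (⟨r • x, hs⟩ : (adjointInvol hq).sym) = r • ⟨x, hx⟩ := rfl
    rw [h3, map_smul, map_smul, h1 hx]

/-- In terms of the bilinear form `B(x,y) = b(x, ℓ y)`, the element `ℓ` determines `f_q` exactly
when `B(x,x) = q(x)`, with symmetrization the polar form. -/
theorem determines_iff (l : Module.End F V) :
    Determines (adjointInvol hq) (adjointSemitrace hq) l ↔
      (∀ x y, polar q x (l y) + polar q y (l x) = polar q x y) ∧ ∀ x, polar q x (l x) = q x := by
  refine and_congr ⟨fun h x y => ?_, fun h => ?_⟩ ⟨fun h x => ?_, fun h s => ?_⟩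
  · have h1 := congrArg (fun g : Module.End F V => polar q x (g y)) h
    simp only [adjointInvol_apply, LinearMap.add_apply, polar_add_right, Module.End.one_apply] at h1
    rw [← h1, polar_comm q x (adjoint hq l y), polar_adjoint]
  · refine LinearMap.ext fun y => eq_of_polar hq fun x => ?_
    rw [LinearMap.add_apply, adjointInvol_apply, polar_add_left, polar_adjoint, Module.End.one_apply,
      polar_comm q y x, ← h x y, polar_comm]
  · have h1 := h ⟨_, rankOne_self_mem_sym hq x⟩
    rw [adjointSemitrace_apply, trd_end, mul_rankOne, trace_rankOne] at h1
    exact h1.symm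
  · have h1 : adjointSemitrace hq = (LinearMap.trace F V ∘ₗ LinearMap.mulLeft F l) ∘ₗ
        (adjointInvol hq).sym.subtype := by
      refine sym_ext hq fun x => ?_
      rw [adjointSemitrace_apply]
      change _ = LinearMap.trace F V (l * rankOne q x x)
      rw [mul_rankOne, trace_rankOne, h]
    rw [trd_end]
    exact LinearMap.congr_fun h1 s

/-- Every quadratic form over a field is `x ↦ B(x,x)` for a bilinear `B`, and nondegeneracy converts
`B` into an endomorphism. -/
theorem exists_determines : ∃ l, Determines (adjointInvol hq) (adjointSemitrace hq) l := by
  obtain ⟨B, hB⟩ := LinearMap.BilinMap.toQuadraticMap_surjective (R := F) (M := V) (N := F) q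
  let D := LinearMap.BilinForm.toDual (polarBilin q) hq
  let l : Module.End F V := D.symm.toLinearMap ∘ₗ B.flip
  have hl : ∀ x y, polar q x (l y) = B x y := by
    intro x y
    rw [polar_comm]
    have h : D (l y) x = polar q (l y) x :=
      LinearMap.BilinForm.toDual_def (B := polarBilin q) hq
    rw [← h]
    simp [l]
  refine ⟨l, (determines_iff hq l).2 ⟨fun x y => ?_, fun x => ?_⟩⟩
  · rw [hl, hl, ← hB, LinearMap.BilinMap.polar_toQuadraticMap]
  · rw [hl, ← hB]; rfl

end AdjointClifford

/-! ### Relations between the generators `xy` -/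

section AdjointRelations

open QuadraticMap

variable {F : Type*} {V : Type*} [Field F] [AddCommGroup V] [Module F V]
  [FiniteDimensional F V] {q : QuadraticForm F V} (hq : Nonsingular q)

/-- The Clifford algebra of the quadratic pair adjoint to `q`. -/
abbrev AdjointClifford := Clifford (adjointInvol hq) (adjointSemitrace hq)

/-- The generator of the Clifford algebra that corresponds to `x y`. -/
def gen (x y : V) : AdjointClifford hq :=
  cliffordMap (adjointInvol hq) (adjointSemitrace hq) (rankOne q x y)

theorem gen_self (x : V) : gen hq x x = q x • (1 : AdjointClifford hq) := by
  have h := RingQuot.mkAlgHom_rel F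
    (CliffordRel.sym (f := adjointSemitrace hq) ⟨_, rankOne_self_mem_sym hq x⟩)
  rw [adjointSemitrace_apply, AlgHom.commutes, Algebra.algebraMap_eq_smul_one] at h
  exact h

theorem gen_add_left (x x' y : V) : gen hq (x + x') y = gen hq x y + gen hq x' y := by
  rw [gen, rankOne_add_left, map_add]; rfl
theorem gen_add_right (x y y' : V) : gen hq x (y + y') = gen hq x y + gen hq x y' := by
  rw [gen, rankOne_add_right, map_add]; rfl
theorem gen_smul_right (r : F) (x y : V) : gen hq x (r • y) = r • gen hq x y := by
  rw [gen, rankOne_smul_right, map_smul]; rfl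

/-- The sandwich of `(x ⊗ y) ⊗ (y ⊗ z)` is `g ↦ b(y, g y) x ⊗ z`, which does not change when `g` is
replaced by its adjoint, so the second relation applies; at `ℓ` the coefficient is `q(y)`. -/
theorem gen_mul_gen_self (x y z : V) : gen hq x y * gen hq y z = q y • gen hq x z := by
  obtain ⟨l, hl⟩ := exists_determines hq
  have h1 : ∀ g, sand F (Module.End F V) (rankOne q x y ⊗ₜ rankOne q y z) g =
      polar q y (g y) • rankOne q x z := by
    intro g
    rw [sand_tmul, mul_rankOne, mul_rankOne, rankOne_apply, rankOne_smul_left]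
  have h := RingQuot.mkAlgHom_rel F (CliffordRel.sandwich (σ := adjointInvol hq)
    (f := adjointSemitrace hq) (rankOne q x y ⊗ₜ rankOne q y z) (fun g => by
      rw [h1, h1, adjointInvol_apply, polar_comm, polar_adjoint]) l hl)
  rw [h1, ((determines_iff hq l).1 hl).2, degTwo_tmul, map_mul, map_smul, map_smul] at h
  exact h

theorem gen_add_gen (x y : V) : gen hq x y + gen hq y x = polar q x y • (1 : AdjointClifford hq) := by
  have h := gen_self hq (x + y)
  rw [gen_add_left, gen_add_right, gen_add_right, gen_self, gen_self,
    QuadraticMap.map_add (⇑q)] at h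
  have h1 : gen hq x y + gen hq y x =
      (q x • (1 : AdjointClifford hq) + gen hq x y + (gen hq y x + q y • 1)) - q x • 1 - q y • 1 := by
    abel
  rw [h1, h]
  module

theorem gen_swap (x y : V) :
    gen hq x y = polar q x y • (1 : AdjointClifford hq) - gen hq y x := by
  rw [← gen_add_gen, add_sub_cancel_right]

/-- Polarization of `gen_mul_gen_self` in the middle vector. -/
theorem gen_mul_gen (x y z t : V) :
    gen hq x y * gen hq z t = polar q y z • gen hq x t - gen hq x z * gen hq y t := by
  have h := gen_mul_gen_self hq x (y + z) t
  rw [gen_add_left, gen_add_right, mul_add, add_mul, add_mul, gen_mul_gen_self, gen_mul_gen_self,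
    QuadraticMap.map_add (⇑q)] at h
  have h1 : gen hq x y * gen hq z t = (q y • gen hq x t + gen hq x z * gen hq y t +
      (gen hq x y * gen hq z t + q z • gen hq x t)) - q y • gen hq x t - q z • gen hq x t -
        gen hq x z * gen hq y t := by abel
  rw [h1, h]
  module

theorem canonicalInvol_gen (x y : V) :
    (canonicalInvol (adjointInvol hq) (adjointSemitrace hq)).toLin (gen hq x y) = gen hq y x := by
  change canonicalInvolLin _ _ _ = _
  rw [gen, canonicalInvolLin_map, adjointInvol_apply, adjoint_rankOne]
  rfl

theorem adjoin_gen : Algebra.adjoin F (Set.range fun p : V × V => gen hq p.1 p.2) = ⊤ := by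
  set S := Algebra.adjoin F (Set.range fun p : V × V => gen hq p.1 p.2)
  have h1 : ∀ g, cliffordMap (adjointInvol hq) (adjointSemitrace hq) g ∈ S := by
    intro g
    rw [← sum_rankOne hq g, map_sum]
    exact sum_mem fun i _ => Algebra.subset_adjoin ⟨(_, _), rfl⟩
  rw [eq_top_iff]
  rintro x -
  obtain ⟨t, rfl⟩ := RingQuot.mkAlgHom_surjective F _ x
  induction t using TensorAlgebra.induction with
  | algebraMap r => rw [AlgHom.commutes]; exact S.algebraMap_mem r
  | ι a => exact h1 a
  | mul a b ha hb => rw [map_mul]; exact mul_mem ha hb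
  | add a b ha hb => rw [map_add]; exact add_mem ha hb

/-! ### The Clifford algebra is nontrivial -/

/-- Changing the form by a bilinear form identifies the Clifford algebra linearly with the exterior
algebra. -/
theorem nontrivial_cliffordAlgebra (q : QuadraticForm F V) : Nontrivial (CliffordAlgebra q) := by
  obtain ⟨B, hB⟩ := LinearMap.BilinMap.toQuadraticMap_surjective (R := F) (M := V) (N := F) (-q)
  have h : LinearMap.BilinMap.toQuadraticMap B = (0 : QuadraticForm F V) - q := by
    rw [hB, zero_sub]
  have : Nontrivial (CliffordAlgebra (0 : QuadraticForm F V)) :=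
    inferInstanceAs (Nontrivial (ExteriorAlgebra F V))
  exact (CliffordAlgebra.changeFormEquiv h).symm.injective.nontrivial

/-- The linear map `x ⊗ y ↦ x m y` to the full Clifford algebra. -/
def mulVec (m : CliffordAlgebra q) : Module.End F V →ₗ[F] CliffordAlgebra q :=
  ∑ i, (LinearMap.mulRight F (m * CliffordAlgebra.ι q (vBasis F V i))) ∘ₗ CliffordAlgebra.ι q ∘ₗ
    LinearMap.applyₗ (wBasis hq i)

theorem mulVec_rankOne (m : CliffordAlgebra q) (x y : V) :
    mulVec hq m (rankOne q x y) = CliffordAlgebra.ι q x * (m * CliffordAlgebra.ι q y) := by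
  have h1 : mulVec hq m (rankOne q x y) = CliffordAlgebra.ι q x * (m * CliffordAlgebra.ι q
      (∑ i, polar q (wBasis hq i) y • vBasis F V i)) := by
    simp [mulVec, LinearMap.sum_apply, Finset.mul_sum, polar_comm q y, mul_assoc]
  rw [h1, sum_polar_wBasis]

theorem mulVec_add (m m' : CliffordAlgebra q) : mulVec hq (m + m') = mulVec hq m + mulVec hq m' :=
  end_ext hq fun x y => by simp [mulVec_rankOne, add_mul, mul_add]

theorem mulVec_smul (r : F) (m : CliffordAlgebra q) : mulVec hq (r • m) = r • mulVec hq m :=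
  end_ext hq fun x y => by simp [mulVec_rankOne]

/-- The homomorphism `T(End V) → C(q)` with `x ⊗ y ↦ x y`. -/
def preToClifford : TensorAlgebra F (Module.End F V) →ₐ[F] CliffordAlgebra q :=
  TensorAlgebra.lift F (mulVec hq 1)

/-- Expanding the two middle vectors of `xyzt` in a basis shows that the image of `u` depends on `u`
only through its sandwich map, which is all that the second relation controls. -/
theorem preToClifford_degTwo (u : Module.End F V ⊗[F] Module.End F V) :
    preToClifford hq (degTwo F _ u) = ∑ j, ∑ k,
      mulVec hq (CliffordAlgebra.ι q (vBasis F V j) * CliffordAlgebra.ι q (vBasis F V k))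
        (sand F _ u (rankOne q (wBasis hq j) (wBasis hq k))) := by
  have key : ∀ x y z t, preToClifford hq (degTwo F _ (rankOne q x y ⊗ₜ rankOne q z t)) =
      ∑ j, ∑ k,
      mulVec hq (CliffordAlgebra.ι q (vBasis F V j) * CliffordAlgebra.ι q (vBasis F V k))
        (sand F _ (rankOne q x y ⊗ₜ rankOne q z t) (rankOne q (wBasis hq j) (wBasis hq k))) := by
    intro x y z t
    have h1 : ∀ j k, sand F _ (rankOne q x y ⊗ₜ rankOne q z t)
        (rankOne q (wBasis hq j) (wBasis hq k)) =
        (polar q (wBasis hq j) y * polar q (wBasis hq k) z) • rankOne q x t := by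
      intro j k
      rw [sand_tmul, mul_rankOne, mul_rankOne, rankOne_apply, rankOne_apply,
        rankOne_smul_left, polar_smul_right, smul_eq_mul, polar_comm q y, mul_comm]
    rw [degTwo_tmul, map_mul, preToClifford, TensorAlgebra.lift_ι_apply,
      TensorAlgebra.lift_ι_apply, mulVec_rankOne, mulVec_rankOne]
    simp only [h1, map_smul, mulVec_rankOne]
    conv_lhs => rw [← sum_polar_wBasis hq y, ← sum_polar_wBasis hq z]
    simp only [map_sum, map_smul, one_mul, Finset.mul_sum, Finset.sum_mul, mul_assoc,
      smul_mul_assoc, mul_smul_comm, Finset.smul_sum, smul_smul]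
    rw [Finset.sum_comm]
    exact Finset.sum_congr rfl fun i _ => Finset.sum_congr rfl fun j _ => by rw [mul_comm (polar q _ z)]
  let L2 : Module.End F V ⊗[F] Module.End F V →ₗ[F] CliffordAlgebra q := ∑ j, ∑ k,
    mulVec hq (CliffordAlgebra.ι q (vBasis F V j) * CliffordAlgebra.ι q (vBasis F V k)) ∘ₗ
      LinearMap.applyₗ (rankOne q (wBasis hq j) (wBasis hq k)) ∘ₗ sand F _
  have h : (preToClifford hq).toLinearMap ∘ₗ degTwo F _ = L2 := by
    refine TensorProduct.ext ?_
    refine end_ext hq fun x y => end_ext hq fun z t => ?_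
    simpa [L2, LinearMap.sum_apply] using key x y z t
  simpa [L2, LinearMap.sum_apply] using LinearMap.congr_fun h u

/-- For the sandwich relation, the difference of the two sides is a sum over `(j, k)` of `vⱼ vₖ -
b(vⱼ, ℓ vₖ)`, inserted between the factors of `Sand(u)(wⱼ ⊗ wₖ)`. The first is alternating in `j, k`
by the Clifford relations and the choice of `ℓ`; the second is symmetric by the hypothesis on `u`.
-/
theorem preToClifford_rel ⦃s t : TensorAlgebra F (Module.End F V)⦄
    (h : CliffordRel (adjointInvol hq) (adjointSemitrace hq) s t) :
    preToClifford hq s = preToClifford hq t := by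
  cases h with
  | sym s =>
    rw [AlgHom.commutes, preToClifford, TensorAlgebra.lift_ι_apply]
    have h1 : mulVec hq 1 ∘ₗ (adjointInvol hq).sym.subtype =
        Algebra.linearMap F (CliffordAlgebra q) ∘ₗ adjointSemitrace hq := by
      refine sym_ext hq fun x => ?_
      simp [mulVec_rankOne, adjointSemitrace_apply]
    exact LinearMap.congr_fun h1 s
  | sandwich u hu l hl =>
    obtain ⟨h1, h2⟩ := (determines_iff hq l).1 hl
    rw [preToClifford_degTwo]
    have h3 : preToClifford hq (TensorAlgebra.ι F (sand F _ u l)) = ∑ j, ∑ k,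
        polar q (vBasis F V j) (l (vBasis F V k)) •
          mulVec hq 1 (sand F _ u (rankOne q (wBasis hq j) (wBasis hq k))) := by
      rw [preToClifford, TensorAlgebra.lift_ι_apply]
      conv_lhs => rw [← sum_sum_rankOne' hq l]
      simp only [map_sum, map_smul]
    rw [h3, ← sub_eq_zero, ← Finset.sum_sub_distrib]
    simp only [← Finset.sum_sub_distrib]
    refine sum_eq_zero_of_alternating _ (fun i => ?_) fun i j => ?_
    · rw [CliffordAlgebra.ι_sq_scalar, Algebra.algebraMap_eq_smul_one, mulVec_smul, h2]
      simp
    · have h4 : sand F _ u (rankOne q (wBasis hq j) (wBasis hq i)) =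
          sand F _ u (rankOne q (wBasis hq i) (wBasis hq j)) := by
        rw [← hu, adjointInvol_apply, adjoint_rankOne]
      rw [h4]
      generalize sand F _ u (rankOne q (wBasis hq i) (wBasis hq j)) = N
      have h5 := congrArg (fun m => mulVec hq m N) (CliffordAlgebra.ι_mul_ι_add_swap
        (Q := q) (vBasis F V i) (vBasis F V j))
      simp only [mulVec_add, LinearMap.add_apply, Algebra.algebraMap_eq_smul_one, mulVec_smul,
        LinearMap.smul_apply] at h5
      rw [← h1 (vBasis F V i) (vBasis F V j), add_smul] at h5
      rw [sub_add_sub_comm, h5, sub_self]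

theorem nontrivial_adjointClifford : Nontrivial (AdjointClifford hq) := by
  have := nontrivial_cliffordAlgebra q
  exact (RingQuot.liftAlgHom F ⟨preToClifford hq, preToClifford_rel hq⟩).toRingHom.domain_nontrivial

end AdjointRelations

/-! ### Semi-traces and isotropic ideals from a quaternion system -/

section TraceForm

variable {R A : Type*} [CommRing R] [Ring A] [Algebra R A] (σ : Involution R A)

/-- The linear form `s ↦ t (l s)` on the symmetric elements. -/
def traceForm (t : A →ₗ[R] R) (l : A) : σ.sym →ₗ[R] R :=
  t ∘ₗ LinearMap.mulLeft R l ∘ₗ σ.sym.subtype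

@[simp] theorem traceForm_apply (t : A →ₗ[R] R) (l : A) (s : σ.sym) :
    traceForm σ t l s = t (l * s) := rfl

variable {σ} {t : A →ₗ[R] R} (hcomm : ∀ x y, t (x * y) = t (y * x))
  (hσ : ∀ x, t (σ.toLin x) = t x)
include hcomm hσ

/-- Hence `t ((z - σ z) s) = 0` for symmetric `s`; this is what makes the canonical semi-trace
independent of choices. -/
theorem apply_involution_mul_of_mem_sym (z : A) (s : σ.sym) : t (σ.toLin z * s) = t (z * s) := by
  have h1 : σ.toLin z * s = σ.toLin (s * z) := by
    rw [σ.map_mul', (σ.mem_sym _).1 s.2]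
  rw [h1, hσ, hcomm]

theorem traceForm_add_involution {l : A} (hl : l + σ.toLin l = 1) (x : A) :
    traceForm σ t l ⟨x + σ.toLin x, σ.add_mem_sym x⟩ = t x := by
  have h1 : t (l * σ.toLin x) = t (σ.toLin l * x) := by
    rw [← hσ, σ.map_mul', σ.invol', hcomm]
  rw [traceForm_apply, mul_add, map_add, h1, ← map_add, ← add_mul, hl, one_mul]

omit hσ in
-- Here `σ(l) = 1 - l` and `l² = l`, so `σ(l) l = 0`. A symmetric `s = l x` also equals `σ(x) σ(l)`,
-- and `t(l σ(x) σ(l))` becomes zero after a cyclic permutation.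
theorem isIsotropicRightIdeal_range_mulLeft {l : A} (hl : l + σ.toLin l = 1) (hll : l * l = l) :
    IsIsotropicRightIdeal σ (traceForm σ t l) (LinearMap.range (LinearMap.mulLeft R l)) := by
  have h1 : σ.toLin l = 1 - l := eq_sub_of_add_eq' hl
  have h2 : σ.toLin l * l = 0 := by rw [h1, sub_mul, one_mul, hll, sub_self]
  refine ⟨?_, ?_, ?_⟩
  · rintro _ ⟨x, rfl⟩ a
    exact ⟨x * a, by simp [mul_assoc]⟩
  · rintro _ ⟨x, rfl⟩ _ ⟨y, rfl⟩
    rw [LinearMap.mulLeft_apply, LinearMap.mulLeft_apply, σ.map_mul', mul_assoc,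
      ← mul_assoc (σ.toLin l), h2, zero_mul, mul_zero]
  · rintro s ⟨x, hx⟩
    rw [LinearMap.mulLeft_apply] at hx
    have h4 : (s : A) = σ.toLin x * σ.toLin l := by
      rw [← σ.map_mul', hx, (σ.mem_sym _).1 s.2]
    rw [traceForm_apply, h4, ← mul_assoc, hcomm, ← mul_assoc, h2, zero_mul, map_zero]

end TraceForm

/-! ### The centre generated by `ω` -/

section Centre

variable {F A : Type*} [Field F] [Ring A] [Algebra F A] {k : ℕ} {α β γ : Fin k → F}
  {E G : Fin k → A} {ω : A} {δ : F}

theorem QuaternionSystem.extendScalars (h : QuaternionSystem α β γ E G) (Z : Type*) [CommRing Z]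
    [Algebra F Z] [Algebra Z A] [IsScalarTower F Z A] :
    QuaternionSystem (fun i => algebraMap F Z (α i)) (fun i => algebraMap F Z (β i))
      (fun i => algebraMap F Z (γ i)) E G where
  pair i := ⟨by rw [algebraMap_smul, (h.pair i).sq_left],
    by rw [algebraMap_smul, (h.pair i).sq_right], (h.pair i).swap⟩
  disc i := by
    have h1 := congrArg (algebraMap F Z) (h.disc i)
    simpa only [map_mul, map_sub, map_one, map_ofNat] using h1
  left_left := h.left_left
  left_right := h.left_right
  right_right := h.right_right

/-- By the double centralizer property an element commuting with all the pairs lies in the algebra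
generated by `ω`, which the quadratic equation of `ω` reduces to `F + Fω`. -/
theorem QuaternionSystem.exists_eq_of_commute (h : QuaternionSystem α β γ E G)
    (hω : ∀ i, Commute (E i) ω ∧ Commute (G i) ω) (hωω : ω * ω = ω - δ • (1 : A))
    (htop : Algebra.adjoin F (Set.range E ∪ Set.range G ∪ {ω}) = ⊤) {x : A}
    (hx : ∀ i, Commute (E i) x ∧ Commute (G i) x) : ∃ a b : F, x = a • (1 : A) + b • ω := by
  have h1 : ∀ u ∈ Algebra.adjoin F {ω}, ∀ i, Commute (E i) u ∧ Commute (G i) u := by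
    intro u hu i
    have h2 : u ∈ Subalgebra.centralizer F {E i, G i} := by
      refine Algebra.adjoin_le (S := Subalgebra.centralizer F {E i, G i}) ?_ hu
      rintro _ rfl
      rw [SetLike.mem_coe, Subalgebra.mem_centralizer_iff]
      rintro y (rfl | rfl)
      exacts [(hω i).1, (hω i).2]
    rw [Subalgebra.mem_centralizer_iff] at h2
    exact ⟨h2 _ (by simp), h2 _ (by simp)⟩
  have h3 : x ∈ Algebra.adjoin F {ω} := by
    refine h.mem_of_commute h1 ?_ hx
    have h4 : x ∈ Algebra.adjoin F (Set.range E ∪ Set.range G ∪ {ω}) := htop ▸ Algebra.mem_top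
    refine Algebra.adjoin_mono ?_ h4
    rintro y (hy | rfl)
    exacts [Or.inr hy, Or.inl (Algebra.subset_adjoin rfl)]
  induction h3 using Algebra.adjoin_induction with
  | mem y hy => exact ⟨0, 1, by rw [Set.mem_singleton_iff.1 hy]; simp⟩
  | algebraMap r => exact ⟨r, 0, by simp [Algebra.algebraMap_eq_smul_one]⟩
  | add y z hy hz h5 h6 =>
    obtain ⟨a, b, rfl⟩ := h5 (h1 _ hy)
    obtain ⟨a', b', rfl⟩ := h6 (h1 _ hz)
    exact ⟨a + a', b + b', by module⟩
  | mul y z hy hz h5 h6 =>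
    obtain ⟨a, b, rfl⟩ := h5 (h1 _ hy)
    obtain ⟨a', b', rfl⟩ := h6 (h1 _ hz)
    refine ⟨a * a' - b * b' * δ, a * b' + b * a' + b * b', ?_⟩
    simp only [add_mul, mul_add, smul_mul_smul_comm, mul_one, one_mul, hωω]
    module

/-- An element `z` with `z² = 0` satisfies `Tr(z) z = N(z)`. If `Tr(z) ≠ 0` then `z` is a scalar,
hence `0`; if `Tr(z) = 0` then `N(z) = 0`, and the nonzero discriminant `1 - 4δ` forces `z = 0`,
also in characteristic 2. -/
theorem isReduced_of_quadratic {Z : Type*} [CommRing Z] [Algebra F Z] {ω : Z}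
    (hωω : ω * ω = ω - δ • (1 : Z)) (hδ : IsUnit (1 - 4 * δ))
    (hZ : ∀ z : Z, ∃ a b : F, z = a • (1 : Z) + b • ω) : IsReduced Z := by
  cases subsingleton_or_nontrivial Z
  · infer_instance
  rw [isReduced_iff_pow_one_lt 2 one_lt_two]
  intro z hz
  obtain ⟨a, b, rfl⟩ := hZ z
  have h1 : (2 * a + b) • (a • (1 : Z) + b • ω) = (a * a + a * b + δ * (b * b)) • (1 : Z) := by
    have h2 : (a • (1 : Z) + b • ω) ^ 2 =
        (2 * a + b) • (a • (1 : Z) + b • ω) - (a * a + a * b + δ * (b * b)) • (1 : Z) := by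
      rw [pow_two]
      simp only [add_mul, mul_add, smul_mul_smul_comm, mul_one, one_mul, hωω]
      module
    rw [hz] at h2
    exact (sub_eq_zero.1 h2.symm)
  set n := a * a + a * b + δ * (b * b) with hn
  by_cases hab : 2 * a + b = 0
  · rw [hab, zero_smul] at h1
    have h3 : n = 0 := (smul_eq_zero_iff_left one_ne_zero).1 h1.symm
    have hb : b = -(2 * a) := by linear_combination hab
    have h4 : a * a * (1 - 4 * δ) = 0 := by
      have h5 : n = -(a * a * (1 - 4 * δ)) := by rw [hn, hb]; ring
      rw [← neg_eq_zero, ← h5, h3]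
    have ha : a = 0 := by
      rcases mul_eq_zero.1 h4 with h5 | h5
      · exact mul_self_eq_zero.1 h5
      · exact absurd h5 hδ.ne_zero
    rw [hb, ha]; simp
  · have h3 : a • (1 : Z) + b • ω = ((2 * a + b)⁻¹ * n) • (1 : Z) := by
      rw [mul_smul, ← h1, smul_smul, inv_mul_cancel₀ hab, one_smul]
    rw [h3, smul_pow, one_pow] at hz
    have h4 := pow_eq_zero_iff two_ne_zero |>.1 ((smul_eq_zero_iff_left one_ne_zero).1 hz)
    rw [h3, h4, zero_smul]

end Centre

/-! ### A quaternion system in the Clifford algebra of an isotropic form -/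

section AdjointSystem

open QuadraticMap

universe u v

variable {F : Type u} {V : Type v} [Field F] [AddCommGroup V] [Module F V]
  [FiniteDimensional F V] {q : QuadraticForm F V} (hq : Nonsingular q)

section Orthogonal

variable {v x : V} (hx : polar q v x = 0)
include hx

theorem gen_mul_gen_of_orthogonal (y : V) : gen hq v x * gen hq v y = -(q v) • gen hq x y := by
  rw [gen_mul_gen, polar_comm, hx, gen_self, smul_mul_assoc, one_mul]
  module

theorem gen_swap_of_orthogonal : gen hq x v = (-1 : F) • gen hq v x := by
  rw [gen_swap, polar_comm, hx]
  module

theorem gen_mul_gen_swap_of_orthogonal {y : V} (hy : polar q v y = 0) :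
    gen hq v x * gen hq v y = -(q v * polar q x y) • (1 : AdjointClifford hq) -
      gen hq v y * gen hq v x := by
  rw [gen_mul_gen_of_orthogonal hq hx, gen_mul_gen_of_orthogonal hq hy, gen_swap hq x y]
  module

theorem gen_mul_gen_right_of_orthogonal {v' : V} (hv : polar q v v' = 1) (hx' : polar q v' x = 0) :
    gen hq v x * gen hq v v' = (1 - gen hq v v') * gen hq v x := by
  have h1 : (1 : AdjointClifford hq) - gen hq v v' = gen hq v' v := by
    rw [gen_swap hq v' v, polar_comm, hv, one_smul]
  rw [gen_mul_gen_of_orthogonal hq hx, h1, gen_mul_gen_self,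
    gen_swap_of_orthogonal hq hx', smul_smul, mul_neg_one, neg_neg]

end Orthogonal

/-- For `x` orthogonal to `v`, the elements `vx` multiply like vectors of the form `-q(v) q`. The
factor `-(q v)⁻¹` on the second members restores `EF + FE = 1`. The element `vv'` is turned into
`v'v = 1 - vv'` by each `vx` with `x` also orthogonal to `v'`. -/
theorem cliffordSystem {k : ℕ} {v v' : V} {e f : Fin k → V} (hv : q v ≠ 0) (hvv : IsPlane q v v')
    (hef : IsPlaneSystem q e f)
    (horth : ∀ i, e i ∈ planeOrthogonal q v v' ∧ f i ∈ planeOrthogonal q v v') :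
    CliffordSystem (fun i => -(q v * q (e i))) (fun i => -((q v)⁻¹ * q (f i)))
      (fun i => (1 - 4 * q (e i) * q (f i))⁻¹) (q v * q v') (fun i => gen hq v (e i))
      (fun i => -(q v)⁻¹ • gen hq v (f i)) (gen hq v v') := by
  simp only [mem_planeOrthogonal] at horth
  have he i := (horth i).1.1
  have he' i := (horth i).1.2
  have hf i := (horth i).2.1
  have hf' i := (horth i).2.2
  refine ⟨fun i => ⟨?_, ?_, ?_⟩, fun i => ?_, fun i j hij => ?_, fun i j hij => ?_,
    fun i j hij => ?_, fun i => ?_, fun i => ?_, ?_, ?_⟩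
  · rw [gen_mul_gen_of_orthogonal hq (he i), gen_self, smul_smul, neg_mul]
  · rw [smul_mul_smul_comm, gen_mul_gen_of_orthogonal hq (hf i), gen_self, smul_smul, smul_smul]
    congr 1
    field_simp
  · rw [smul_mul_assoc, mul_smul_comm, gen_mul_gen_of_orthogonal hq (he i),
      gen_mul_gen_of_orthogonal hq (hf i), smul_smul, smul_smul, neg_mul_neg,
      inv_mul_cancel₀ hv, one_smul, one_smul, gen_swap, polar_comm, (hef.isPlane i).polar_eq,
      one_smul]
  · have h1 : (1 : F) - 4 * -(q v * q (e i)) * -((q v)⁻¹ * q (f i)) =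
        1 - 4 * q (e i) * q (f i) := by field_simp
    rw [h1, inv_mul_cancel₀ (hef.isPlane i).disc]
  · rw [gen_mul_gen_swap_of_orthogonal hq (he i) (he j), hef.left_left i j hij]
    simp
  · rw [smul_mul_assoc, mul_smul_comm, gen_mul_gen_swap_of_orthogonal hq (he i) (hf j),
      hef.left_right i j hij]
    simp only [mul_zero, neg_zero, zero_smul, zero_sub, smul_neg]
  · rw [smul_mul_smul_comm, smul_mul_smul_comm, gen_mul_gen_swap_of_orthogonal hq (hf i) (hf j),
      hef.right_right i j hij]
    simp
  · exact gen_mul_gen_right_of_orthogonal hq (he i) hvv.polar_eq (he' i)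
  · rw [smul_mul_assoc, mul_smul_comm,
      gen_mul_gen_right_of_orthogonal hq (hf i) hvv.polar_eq (hf' i)]
  · rw [gen_mul_gen, polar_comm, hvv.polar_eq, gen_self, gen_self, smul_mul_smul_comm, one_smul,
      mul_one]
  · rw [← mul_assoc]
    exact hvv.disc.isUnit

/-- `xy = q(v)⁻¹ (xv)(vy)`, and `xv` is a scalar minus `vx`. -/
theorem adjoin_gen_of_span {v : V} (hv : q v ≠ 0) {T : Set V} (hT : Submodule.span F T = ⊤)
    {S : Subalgebra F (AdjointClifford hq)} (hS : ∀ y ∈ T, gen hq v y ∈ S) : S = ⊤ := by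
  have h1 : ∀ y, gen hq v y ∈ S := by
    intro y
    have hy : y ∈ Submodule.span F T := hT ▸ Submodule.mem_top
    induction hy using Submodule.span_induction with
    | mem y hy => exact hS y hy
    | zero =>
      have h2 := gen_smul_right hq 0 v v
      rw [zero_smul, zero_smul] at h2
      exact h2 ▸ S.zero_mem
    | add y z _ _ h2 h3 => rw [gen_add_right]; exact add_mem h2 h3
    | smul r y _ h2 => rw [gen_smul_right]; exact S.smul_mem h2 r
  rw [eq_top_iff, ← adjoin_gen hq]
  refine Algebra.adjoin_le ?_
  rintro _ ⟨⟨x, y⟩, rfl⟩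
  have h2 : gen hq x y = (q v)⁻¹ • (gen hq x v * gen hq v y) := by
    rw [gen_mul_gen_self, smul_smul, inv_mul_cancel₀ hv, one_smul]
  change gen hq x y ∈ S
  rw [h2, gen_swap hq x v]
  exact S.smul_mem (mul_mem (sub_mem (S.smul_mem S.one_mem _) (h1 x)) (h1 y)) _

/-- The hyperbolic plane sits at index `0`, where untwisting changes nothing. So `α 0 = β 0 = 0`,
and `E 0 * G 0 = (q v)⁻¹ (q v) xy` is the image of a rank one map of trace `1`. -/
theorem exists_adjoint_quaternionSystem {k : ℕ} (hiso : ¬ q.Anisotropic)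
    (hV : Module.finrank F V = 2 * (k + 2)) :
    ∃ (α β γ : Fin (k + 1) → F) (E G : Fin (k + 1) → AdjointClifford hq)
      (ω : AdjointClifford hq) (δ : F) (x y : V),
      QuaternionSystem α β γ E G ∧ (∀ i, Commute (E i) ω ∧ Commute (G i) ω) ∧
      ω * ω = ω - δ • (1 : AdjointClifford hq) ∧ IsUnit (1 - 4 * δ) ∧ α 0 = 0 ∧ β 0 = 0 ∧
      E 0 * G 0 = gen hq x y ∧ polar q x y = 1 ∧
      Algebra.adjoin F (Set.range E ∪ Set.range G ∪ {ω}) = ⊤ ∧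
      (∀ i, (canonicalInvol _ _).toLin (E i) = ((-1 : F) ^ (i : ℕ) * -1) • E i ∧
        (canonicalInvol _ _).toLin (G i) = ((-1 : F) ^ (i : ℕ) * -1) • G i) ∧
      (Even k → (canonicalInvol _ _).toLin ω = ω) := by
  obtain ⟨v, v', e, f, hv, hvv, hef, horth, he0, hf0, hspan⟩ :=
    exists_isotropic_decomposition q (fun x hx => eq_of_polar hq fun y => by simp [hx]) hiso hV
  obtain ⟨α, β, γ, E, G, ω, δ, hsys, hω, hωω, hδ, h0, hadj, hσ⟩ :=
    (cliffordSystem hq hv hvv hef horth).exists_quaternionSystem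
  obtain ⟨⟨hα, hβ⟩, hE0, hG0⟩ := h0 0 rfl
  simp only [mem_planeOrthogonal] at horth
  obtain ⟨hσ1, hσ2⟩ := hσ (canonicalInvol (adjointInvol hq) (adjointSemitrace hq)) (-1) (by simp)
    (fun i => by
      rw [map_smul, canonicalInvol_gen, canonicalInvol_gen,
        gen_swap_of_orthogonal hq (horth i).1.1, gen_swap_of_orthogonal hq (horth i).2.1,
        smul_comm]
      exact ⟨rfl, rfl⟩)
  refine ⟨α, β, γ, E, G, ω, δ, e 0, f 0, hsys, hω, hωω, hδ, by rw [hα, he0]; simp,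
    by rw [hβ, hf0]; simp, ?_, (hef.isPlane 0).polar_eq, ?_, hσ1, fun hk => ?_⟩
  · rw [hE0, hG0, mul_smul_comm, gen_mul_gen_of_orthogonal hq (horth 0).1.1, smul_smul,
      neg_mul_neg, inv_mul_cancel₀ hv, one_smul]
  · rw [← hadj]
    refine adjoin_gen_of_span hq hv hspan ?_
    have hsub := Algebra.subset_adjoin (R := F) (s := Set.range (fun i => gen hq v (e i)) ∪
      Set.range (fun i => -(q v)⁻¹ • gen hq v (f i)) ∪ {gen hq v v'})
    rintro y ((rfl | rfl) | (⟨i, rfl⟩ | ⟨i, rfl⟩))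
    · rw [gen_self]
      exact Subalgebra.smul_mem _ (Subalgebra.one_mem _) _
    · exact hsub (by simp)
    · exact hsub (Or.inl (Or.inl ⟨i, rfl⟩))
    · have h1 : gen hq v (f i) = -(q v) • (-(q v)⁻¹ • gen hq v (f i)) := by
        rw [smul_smul, neg_mul_neg, mul_inv_cancel₀ hv, one_smul]
      rw [h1]
      exact Subalgebra.smul_mem _ (hsub (Or.inl (Or.inr ⟨i, rfl⟩))) _
  -- Initially `vv' ↦ v'v = 1 - vv'`, the case `p = 1`; after untwisting `k + 1` pairs the relevant
  -- parity is that of `k + 2`.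
  · rw [hσ2 1, if_pos]
    · obtain ⟨j, rfl⟩ := hk
      exact ⟨j + 1, by ring⟩
    · rw [if_neg (by decide), canonicalInvol_gen, gen_swap, polar_comm, hvv.polar_eq, one_smul]

/-! ### Independence of the choice of an element of trace one -/

include hq in
-- The orthogonal space `W` of `x` and `y` has codimension at most 2. If the polar form vanished on
-- it, then `W` would lie in its own orthogonal space, of dimension at most 2, and `V` would have
-- dimension at most 4.
theorem exists_orthogonal_pair (hV : 4 < Module.finrank F V) (x y : V) :
    ∃ g h, polar q x g = 0 ∧ polar q x h = 0 ∧ polar q y g = 0 ∧ polar q y h = 0 ∧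
      polar q g h = 1 := by
  set W := planeOrthogonal q x y with hW
  have h1 : Module.finrank F V ≤ Module.finrank F W + 2 := by
    have h2 := LinearMap.finrank_range_add_finrank_ker ((polarBilin q x).prod (polarBilin q y))
    have h3 := Submodule.finrank_le (LinearMap.range ((polarBilin q x).prod (polarBilin q y)))
    rw [Module.finrank_prod, Module.finrank_self] at h3
    have h4 : W = LinearMap.ker ((polarBilin q x).prod (polarBilin q y)) := rfl
    rw [h4]; omega
  have h5 : ∃ g ∈ W, ∃ h ∈ W, polar q g h ≠ 0 := by
    by_contra! h6
    have h7 : W ≤ LinearMap.BilinForm.orthogonal (polarBilin q) W := by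
      intro g hg
      rw [LinearMap.BilinForm.mem_orthogonal_iff]
      intro h hh
      exact h6 h hh g hg
    have h8 := Submodule.finrank_mono h7
    rw [LinearMap.BilinForm.finrank_orthogonal hq] at h8
    omega
  obtain ⟨g, hg, h, hh, hgh⟩ := h5
  rw [hW, mem_planeOrthogonal] at hg hh
  refine ⟨g, (polar q g h)⁻¹ • h, hg.1, ?_, hg.2, ?_, ?_⟩
  · rw [polar_smul_right, hh.1, smul_zero]
  · rw [polar_smul_right, hh.2, smul_zero]
  · rw [polar_smul_right, smul_eq_mul, inv_mul_cancel₀ hgh]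

/-- With `g`, `h` orthogonal to `x`, `y` and `b(g,h) = 1`, the elements `xy` and `gh` commute. For
`z = (xy)(gh)` one gets `σ(z) = (hg)(yx) = (1 - gh)(-xy) = z - xy`. -/
theorem exists_gen_eq_sub (hV : 4 < Module.finrank F V) {x y : V} (hxy : polar q x y = 0) :
    ∃ z, gen hq x y = z - (canonicalInvol _ _).toLin z := by
  obtain ⟨g, h, hxg, hxh, hyg, hyh, hgh⟩ := exists_orthogonal_pair hq hV x y
  refine ⟨gen hq x y * gen hq g h, ?_⟩
  have h1 : gen hq g h * gen hq x y = gen hq x y * gen hq g h := by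
    rw [gen_mul_gen hq g h x y, gen_mul_gen hq x y g h, hyg, polar_comm _ h x, hxh,
      gen_swap_of_orthogonal hq hxg, gen_swap_of_orthogonal hq hyh, zero_smul, zero_smul]
    rw [smul_mul_smul_comm, neg_mul_neg, one_mul, one_smul]
  rw [(canonicalInvol _ _).map_mul', canonicalInvol_gen, canonicalInvol_gen,
    gen_swap_of_orthogonal hq hxy, gen_swap hq h g, polar_comm, hgh, one_smul, sub_mul, one_mul,
    mul_smul_comm, h1]
  module

omit [FiniteDimensional F V] in
-- If `b(x,f) ≠ 0`, then `y` may be replaced by a multiple of `f` modulo the orthogonal of `x`, and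
-- then `x` by a multiple of `e` modulo the orthogonal of `f`. If `b(x,f) = 0`, the first case
-- applies to `x + e` and `e`.
theorem eq_polar_smul {M : Type*} [AddCommGroup M] [Module F M] (φ : V →ₗ[F] V →ₗ[F] M)
    (hφ : ∀ x y, polar q x y = 0 → φ x y = 0) {e f : V} (hef : polar q e f = 1) (x y : V) :
    φ x y = polar q x y • φ e f := by
  have h1 : ∀ x y, polar q x f ≠ 0 → φ x y = polar q x y • φ e f := by
    intro x y hx
    have h2 := hφ x (y - (polar q x y * (polar q x f)⁻¹) • f) (by
      rw [polar_sub_right, polar_smul_right, smul_eq_mul, inv_mul_cancel_right₀ hx, sub_self])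
    have h3 := hφ (x - polar q x f • e) f (by
      rw [polar_sub_left, polar_smul_left, hef, smul_eq_mul, mul_one, sub_self])
    rw [map_sub, map_smul, sub_eq_zero] at h2
    rw [map_sub, map_smul, LinearMap.sub_apply, LinearMap.smul_apply, sub_eq_zero] at h3
    rw [h2, h3, smul_smul, inv_mul_cancel_right₀ hx]
  by_cases hx : polar q x f = 0
  · have h2 := h1 (x + e) y (by rw [polar_add_left, hx, hef, zero_add]; exact one_ne_zero)
    rw [map_add, LinearMap.add_apply, h1 e y (by rw [hef]; exact one_ne_zero), polar_add_left,
      add_smul] at h2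
    exact add_right_cancel h2
  · exact h1 x y hx

end AdjointSystem

/-! ### The canonical pair over the centre -/

section CanonicalPair

open QuadraticMap

universe u v

/-- The canonical involution as an involution over the centre, when it fixes the centre. -/
def centreInvol {F : Type u} {A : Type v} [Field F] [Ring A] [Algebra F A] (σ : Involution F A)
    (f : σ.sym →ₗ[F] F)
    (h : ∀ z : CliffordCentre σ f, (canonicalInvol σ f).toLin (z : Clifford σ f) = z) :
    Involution (CliffordCentre σ f) (Clifford σ f) where
  toLin :=
    { toFun := (canonicalInvol σ f).toLin
      map_add' := map_add _
      map_smul' := fun z x => by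
        change (canonicalInvol σ f).toLin ((z : Clifford σ f) * x) = (z : Clifford σ f) * _
        rw [(canonicalInvol σ f).map_mul', h, Subalgebra.mem_center_iff.1 z.2] }
  map_mul' := (canonicalInvol σ f).map_mul'
  invol' := (canonicalInvol σ f).invol'

instance isScalarTower_cliffordCentre {F : Type u} {A : Type v} [Field F] [Ring A] [Algebra F A]
    (σ : Involution F A) (f : σ.sym →ₗ[F] F) :
    IsScalarTower F (CliffordCentre σ f) (Clifford σ f) :=
  ⟨fun r z x => smul_mul_assoc r (z : Clifford σ f) x⟩

variable {F : Type u} {V : Type v} [Field F] [AddCommGroup V] [Module F V]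
  [FiniteDimensional F V] {q : QuadraticForm F V} (hq : Nonsingular q)

/-- The centre of the Clifford algebra of the quadratic pair adjoint to `q`. -/
abbrev AdjointCentre := CliffordCentre (adjointInvol hq) (adjointSemitrace hq)

variable {τ : Involution (AdjointCentre hq) (AdjointClifford hq)}
  {t : AdjointClifford hq →ₗ[AdjointCentre hq] AdjointCentre hq}

/-- The bilinear map `(g, h) ↦ t((gh)s)` vanishes on orthogonal pairs, because there `gh` has the
form `z - σ(z)`. It is thus proportional to `b`, which on rank one maps is the trace. -/
theorem trace_cliffordMap_mul (hV : 4 < Module.finrank F V)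
    (hτ : ∀ x, τ.toLin x = (canonicalInvol _ _).toLin x)
    (hcomm : ∀ x y, t (x * y) = t (y * x)) (hσ : ∀ x, t (τ.toLin x) = t x)
    {x y : V} (hxy : polar q x y = 1) (a : Module.End F V) (s : τ.sym) :
    t (cliffordMap (adjointInvol hq) (adjointSemitrace hq) a * (s : AdjointClifford hq)) =
      LinearMap.trace F V a • t (gen hq x y * s) := by
  let ψ : Module.End F V →ₗ[F] AdjointCentre hq :=
    t.restrictScalars F ∘ₗ LinearMap.mulRight F (s : AdjointClifford hq) ∘ₗ cliffordMap _ _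
  have hψ : ∀ g h, ψ (rankOne q g h) = t (gen hq g h * s) := fun g h => rfl
  let φ : V →ₗ[F] V →ₗ[F] AdjointCentre hq := LinearMap.mk₂ F (fun g h => ψ (rankOne q g h))
    (fun g g' h => by rw [rankOne_add_left, map_add])
    (fun r g h => by rw [rankOne_smul_left, map_smul])
    (fun g h h' => by rw [rankOne_add_right, map_add])
    (fun r g h => by rw [rankOne_smul_right, map_smul])
  have hφ : ∀ g h, polar q g h = 0 → φ g h = 0 := by
    intro g h hgh
    obtain ⟨z, hz⟩ := exists_gen_eq_sub hq hV hgh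
    change ψ (rankOne q g h) = 0
    rw [hψ, hz, ← hτ, sub_mul, map_sub, apply_involution_mul_of_mem_sym (σ := τ) (t := t) hcomm hσ, sub_self]
  have h1 : ψ = (LinearMap.trace F V).smulRight (t (gen hq x y * s)) := by
    refine end_ext (M := AdjointCentre hq) hq fun g h => ?_
    rw [LinearMap.smulRight_apply, trace_rankOne, polar_comm]
    exact eq_polar_smul (q := q) (M := AdjointCentre hq) φ hφ hxy g h
  exact LinearMap.congr_fun h1 a

theorem isCanonicalPair_traceForm (hV : 4 < Module.finrank F V)
    (hτ : ∀ x, τ.toLin x = (canonicalInvol _ _).toLin x)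
    (hcomm : ∀ x y, t (x * y) = t (y * x)) (hσ : ∀ x, t (τ.toLin x) = t x)
    (ht : trd (AdjointCentre hq) (AdjointClifford hq) = t) {x y : V} (hxy : polar q x y = 1) :
    IsCanonicalPair (adjointInvol hq) (adjointSemitrace hq) τ (traceForm τ t (gen hq x y)) where
  invol_eq := hτ
  semitrace_eq a ha s := by
    rw [trd_end] at ha
    rw [ht, trace_cliffordMap_mul hq hV hτ hcomm hσ hxy, ha, one_smul, traceForm_apply]

theorem prod_signs (j : ℕ) : ∏ i ∈ Finset.range (4 * j + 3), ((-1 : F) ^ i * -1) = 1 := by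
  induction j with
  | zero => simp [Finset.prod_range_succ]
  | succ j ih =>
    have h1 : 4 * (j + 1) + 3 = 4 * j + 3 + 4 := by ring
    have h2 : ((-1 : F) ^ (4 * j)) = 1 := by rw [pow_mul]; norm_num
    rw [h1]
    iterate 4 rw [Finset.prod_range_succ]
    rw [ih]
    simp only [pow_add, h2]
    norm_num

theorem prod_signs_of_dvd {k : ℕ} (h : (2 : F) = 0 ∨ 4 ∣ k + 2) :
    ∏ i : Fin (k + 1), ((-1 : F) ^ (i : ℕ) * -1) = 1 := by
  rcases h with h | ⟨j, hj⟩
  · have h1 : (-1 : F) = 1 := by linear_combination -h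
    simp [h1]
  · obtain ⟨j, rfl⟩ : ∃ i, j = i + 1 := ⟨j - 1, by omega⟩
    -- With `m = k + 2` divisible by 4, the number `k + 1` of pairs is `3` modulo 4. The signs
    -- alternate from `-1`, so the first three, and then each block of four, have product `1`.
    obtain rfl : k = 4 * j + 2 := by omega
    rw [Fin.prod_univ_eq_prod_range (fun i => (-1 : F) ^ i * -1)]
    exact prod_signs j

end CanonicalPair

end QuadPair
end

/-! ### The main theorem -/

theorem mainTheorem10 {F : Type*} [Field F] {V : Type*} [AddCommGroup V] [Module F V]
    [FiniteDimensional F V] (q : QuadraticForm F V) (hq : QuadPair.Nonsingular q)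
    (hiso : ¬ q.Anisotropic) (m : ℕ) (hdim : Module.finrank F V = 2 * m) (hm8 : 8 ≤ 2 * m)
    (hm : Even m) :
    ∃ (τ : QuadPair.Involution
          (QuadPair.CliffordCentre (QuadPair.adjointInvol hq) (QuadPair.adjointSemitrace hq))
          (QuadPair.Clifford (QuadPair.adjointInvol hq) (QuadPair.adjointSemitrace hq)))
      (g : τ.sym →ₗ[QuadPair.CliffordCentre (QuadPair.adjointInvol hq)
            (QuadPair.adjointSemitrace hq)]
          QuadPair.CliffordCentre (QuadPair.adjointInvol hq) (QuadPair.adjointSemitrace hq)),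
      QuadPair.IsCanonicalPair (QuadPair.adjointInvol hq) (QuadPair.adjointSemitrace hq) τ g ∧
      QuadPair.IsSemitrace τ g ∧
      ((2 : F) = 0 ∨ 4 ∣ m → QuadPair.IsQuadraticPair τ g) ∧
      QuadPair.IsHyperbolic τ g := by
  -- Of the `k + 2` planes, one provides `v` and `v'`; the other `k + 1` provide the quaternion
  -- pairs.
  obtain ⟨k, rfl⟩ : ∃ k, m = k + 2 := ⟨m - 2, by omega⟩
  obtain ⟨α, β, γ, E, G, ω, δ, x, y, hsys, hω, hωω, hδ, hα, hβ, hEG, hxy, htop, hσE, hσω⟩ :=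
    QuadPair.exists_adjoint_quaternionSystem hq hiso hdim
  have hnt := QuadPair.nontrivial_adjointClifford hq
  have hωc : ω ∈ QuadPair.AdjointCentre hq := by
    rw [Subalgebra.mem_center_iff]
    intro z
    have h1 : Algebra.adjoin F (Set.range E ∪ Set.range G ∪ {ω}) ≤
        Subalgebra.centralizer F {ω} := by
      refine Algebra.adjoin_le ?_
      rintro u ((⟨i, rfl⟩ | ⟨i, rfl⟩) | rfl) <;> rw [SetLike.mem_coe, Subalgebra.mem_centralizer_iff]
      · rintro _ rfl; exact (hω i).1.symm
      · rintro _ rfl; exact (hω i).2.symm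
      · rintro _ rfl; rfl
    rw [htop] at h1
    exact ((Subalgebra.mem_centralizer_iff F).1 (h1 (Algebra.mem_top (x := z))) ω rfl).symm
  have hZ : ∀ z : QuadPair.AdjointCentre hq, ∃ a b : F,
      z = a • (1 : QuadPair.AdjointCentre hq) + b • ⟨ω, hωc⟩ := by
    intro z
    obtain ⟨a, b, h1⟩ := hsys.exists_eq_of_commute hω hωω htop
      (x := (z : QuadPair.AdjointClifford hq)) fun i =>
        ⟨Subalgebra.mem_center_iff.1 z.2 _, Subalgebra.mem_center_iff.1 z.2 _⟩
    exact ⟨a, b, Subtype.ext h1⟩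
  -- The centre may be a field or split; reducedness is what makes the reduced trace over it unique.
  have hred : IsReduced (QuadPair.AdjointCentre hq) :=
    QuadPair.isReduced_of_quadratic (ω := (⟨ω, hωc⟩ : QuadPair.AdjointCentre hq)) (δ := δ)
      (Subtype.ext hωω) hδ hZ
  have hinj : Function.Injective
      (algebraMap (QuadPair.AdjointCentre hq) (QuadPair.AdjointClifford hq)) :=
    Subtype.val_injective
  have hsysZ := hsys.extendScalars (QuadPair.AdjointCentre hq)
  -- Over the centre as base ring, the centralizer of all the pairs is the base ring itself.
  obtain ⟨t, ht⟩ := hsysZ.exists_isCasimir hinj fun z hz => by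
    obtain ⟨a, b, rfl⟩ := hsys.exists_eq_of_commute hω hωω htop hz
    exact ⟨a • 1 + b • ⟨ω, hωc⟩, rfl⟩
  have hcard := QuadPair.card_tuple (k + 1)
  have htrd := ht.trd_eq hcard
  have hcomm := ht.apply_mul_comm hcard
  have hk : Even k := by simpa [Nat.even_add] using hm
  let τ := QuadPair.centreInvol (QuadPair.adjointInvol hq) (QuadPair.adjointSemitrace hq) (by
    intro z
    obtain ⟨a, b, rfl⟩ := hZ z
    change (QuadPair.canonicalInvol _ _).toLin (a • (1 : QuadPair.AdjointClifford hq) + b • ω) =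
      a • (1 : QuadPair.AdjointClifford hq) + b • ω
    rw [map_add, map_smul, map_smul, QuadPair.Involution.toLin_one, hσω hk])
  let c : Fin (k + 1) → QuadPair.AdjointCentre hq :=
    fun i => algebraMap F _ ((-1) ^ (i : ℕ) * -1)
  have hc : ∀ i, c i * c i = 1 := fun i => by
    rw [← map_mul, mul_mul_mul_comm, ← mul_pow]; simp
  have hE : ∀ i, τ.toLin (E i) = c i • E i := fun i => by
    rw [algebraMap_smul]; exact (hσE i).1
  have hG : ∀ i, τ.toLin (G i) = c i • G i := fun i => by
    rw [algebraMap_smul]; exact (hσE i).2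
  have hτt := hsysZ.form_involution ht hinj τ c hE hG hc
  -- The same element `xy` both defines the semi-trace and generates the isotropic ideal.
  have hε : QuadPair.gen hq x y + τ.toLin (QuadPair.gen hq x y) = 1 := by
    change _ + (QuadPair.canonicalInvol _ _).toLin _ = _
    rw [QuadPair.canonicalInvol_gen, QuadPair.gen_add_gen, hxy, one_smul]
  have hst : QuadPair.IsSemitrace τ (QuadPair.traceForm τ t (QuadPair.gen hq x y)) := fun z => by
    rw [htrd, QuadPair.traceForm_add_involution hcomm hτt hε]
  refine ⟨τ, QuadPair.traceForm τ t (QuadPair.gen hq x y),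
    QuadPair.isCanonicalPair_traceForm hq (by omega) (fun _ => rfl) hcomm hτt htrd hxy, hst,
    fun h => ⟨ht.isAzumaya hinj, ⟨2 ^ (k + 1), QuadPair.QuaternionSystem.finrank_eq ht,
      hsysZ.sym_free_finrank ht τ c hE hG hc ?_⟩, hst⟩,
    LinearMap.range (LinearMap.mulLeft _ (QuadPair.gen hq x y)),
    QuadPair.isIsotropicRightIdeal_range_mulLeft hcomm hε ?_, ?_⟩
  · rw [← map_prod, QuadPair.prod_signs_of_dvd h, map_one]
  -- `E 0 * G 0` is idempotent because `(G 0)² = β 0 = 0`.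
  · have h0 := hsys.pair 0
    rw [← hEG, mul_assoc, ← mul_assoc (G 0), h0.swap, sub_mul, one_mul, mul_assoc, h0.sq_right,
      hβ, zero_smul, mul_zero, sub_zero]
  · rw [← hEG]
    exact hsysZ.ideal_free_finrank ht (by rw [hα, map_zero]) (by rw [hβ, map_zero])
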